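/- Let $d\ge 1$ and let $Q\subset\mathbb{R}^{d}\times(0,T)$ be an open space-time domain that is decomposed into $N$ non-overlapping patches, $\overline Q=\bigcup_i\overline{Q_i}$, $Q_i=\Phi_i((0,1)^{d+1})\subset Q$, where each $\Phi_i$ is $C^1$ and injective with non-singular Jacobian on $[0,1]^{d+1}$. Let $n_i=(n_{i,x},n_{i,t})$ be the outer unit normal of $Q_i$, let $F_{ij}=\partial Q_i\cap\partial Q_j$ be the interior facets ($\mathcal F_I$; each one taken once, with some order of $i$ and $j$), and let $\mathcal F_T$ be the set of the facets $F_i=\partial Q_i\cap\Sigma_T$, where $\Sigma_0,\Sigma_T,\Sigma$ are the parts of $\partial Q$ with $t=0$, $t=T$, $0<t<T$. On $F_{ij}$ put $[\![v]\!]_x=v_in_{i,x}+v_jn_{j,x}$, $[\![v]\!]_t=v_in_{i,t}+v_jn_{j,t}$, $\{v\}=\frac12(v_i+v_j)$, and $\{v\}^{up}=v_i$ if $n_{i,t}\ge0$, $\{v\}^{up}=v_j$ otherwise, where $v_i,v_j$ are the traces of $v$ from $Q_i,Q_j$. For every $i$ let $V_{h,i}$ be the span of the functions $\widehat B\circ\Phi_i^{-1}$,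 where $\widehat B$ runs through the tensor product B-splines of fixed degrees $p_{i,\alpha}\ge1$ for some knot vectors on $[0,1]$, which are assumed to be $C^1$ and to represent $\Phi_i$. The mesh elements $K$ of $Q_i$ are the images of the boxes between consecutive distinct knots, $h_K=\operatorname{diam}K$, $h_i=\max_Kh_K$. The meshes are assumed to be quasi-uniform with constant $C_q\ge1$, i.e. $h_K\le h_i\le C_qh_K$ for all elements $K$ of $Q_i$, and $h_i\le C_qh_j$ if $F_{ij}$ has positive surface measure, and shape regular, i.e. the ratio of two edge lengths of a parameter element is at most a constant $\rho$. Let $V_{0h}$ be the set of the $v\in L_2(Q)$ with $v|_{Q_i}\in V_{h,i}$ for all $i$ and $v=0$ on $\Sigma\cup\Sigma_0$, and let $V_{0h,*}=H^2(Q)+V_{0h}$. For $\delta_1,\delta_2,\theta_1,\dots,\theta_N>0$ let $$\begin{aligned} a_h(u,v)&=\sum_{i}\int_{Q_i}\big(-u\,\partial_tv+\theta_ih_i\,\partial_tu\,\partial_tv+\nabla_xu\cdot\nabla_xv-\theta_ih_i\,\partial_t\nabla_xu\cdot\nabla_xv\big)\,dx\,dt\\ &+\sum_{\mathcal F_I}\int_{F_{ij}}\{u\}^{up}[\![v]\!]_t\,ds+\sum_{\mathcal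 F_T}\int_{F_i}uv\,ds+\sum_{\mathcal F_T}\theta_ih_i\int_{F_i}\nabla_xu\cdot\nabla_xv\,ds+\sum_{\mathcal F_I}\theta_ih_i\int_{F_{ij}}\{\nabla_xu\}^{up}\cdot[\![\nabla_xv]\!]_t\,ds\\ &+\sum_{\mathcal F_I}\int_{F_{ij}}\big(-\{\nabla_xu\}\cdot[\![v]\!]_x+\{\nabla_xv\}\cdot[\![u]\!]_x\big)\,ds+\sum_{\mathcal F_I}\theta_ih_i\int_{F_{ij}}\big(-\{\nabla_xu\}\cdot[\![\partial_tv]\!]_x+\{\nabla_xv\}\cdot[\![\partial_tu]\!]_x\big)\,ds\\ &+\sum_{\mathcal F_I}\int_{F_{ij}}\Big(\frac{\delta_1}{h_i}[\![u]\!]_x\cdot[\![v]\!]_x+\delta_2\theta_ih_i[\![\partial_tu]\!]_x\cdot[\![\partial_tv]\!]_x\Big)\,ds, \end{aligned}$$ $$\begin{aligned} \|v\|_h^2&=\sum_i\big(\|\nabla_xv\|_{L_2(Q_i)}^2+\theta_ih_i\|\partial_tv\|_{L_2(Q_i)}^2\big)+\frac12\sum_{\mathcal F_T}\|v\|_{L_2(F_i)}^2+\sum_{\mathcal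 F_T}\frac{\theta_ih_i}2\|\nabla_xv\|_{L_2(F_i)}^2+\frac12\sum_{\mathcal F_I}\|[\![v]\!]_t\|_{L_2(F_{ij})}^2\\ &+\sum_{\mathcal F_I}\frac{\theta_ih_i}2\|[\![\nabla_xv]\!]_t\|_{L_2(F_{ij})}^2+\sum_{\mathcal F_I}\Big(\frac{\delta_1}{h_i}\|[\![v]\!]_x\|_{L_2(F_{ij})}^2+\delta_2\theta_ih_i\|[\![\partial_tv]\!]_x\|_{L_2(F_{ij})}^2\Big),\\ \|v\|_{h,*}^2&=\|v\|_h^2+\sum_i\big((\theta_ih_i)^{-1}\|v\|_{L_2(Q_i)}^2+(\theta_ih_i)^2\|\partial_t\nabla_xv\|_{L_2(Q_i)}^2\big)+\sum_{\mathcal F_I}\|\{v\}^{up}\|_{L_2(F_{ij})}^2\\ &+\sum_{\mathcal F_I}\theta_ih_i\|\{\nabla_xv\}^{up}\|_{L_2(F_{ij})}^2+\sum_ih_i\|\nabla_xv_i\|_{L_2(\partial Q_i)}^2. \end{aligned}$$ Then there is a constant $C_{inv}>0$, which depends only on the decomposition (the maps $\Phi_i$), the degrees, $C_q$ and $\rho$,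 and not on the meshes, $\delta_1$, $\delta_2$ or the $\theta_i$, such that for all such meshes the inverse inequality $\|w\|_{L_2(\partial Q_i)}^2\le C_{inv}h_i^{-1}\|w\|_{L_2(Q_i)}^2$ holds for all $i$, $w=v$ and $w=\nabla_xv$ with $v\in V_{h,i}$, and such that for all $\delta_1,\delta_2,\theta_i>0$ $$|a_h(u,v_h)|\le\mu_b\,\|u\|_{h,*}\,\|v_h\|_h\qquad\text{for all }u\in V_{0h,*},\ v_h\in V_{0h},$$ with the constant, independent of the mesh sizes and with $\theta=\max_i\theta_i$, $$\mu_b=2\sqrt{\max\Big\{\tfrac14C_{inv}C_q(\delta_1^{-1}+\theta\delta_2^{-1})+1,\ \tfrac18(\delta_1^{-1}+\theta\delta_2^{-1})\Big\}}.$$ -/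

import Mathlib

open MeasureTheory Set Filter Topology
open scoped ContDiff

namespace SpaceTimeDG

noncomputable section

/-- Space-time `ℝ^{d+1}`: the coordinates `0, …, d-1` are spatial, the last one is time. -/
abbrev SpaceTime (d : ℕ) : Type := EuclideanSpace ℝ (Fin (d + 1))

/-! ### Sobolev functions, weak derivatives and traces on a subset of space-time -/

/-- `g` is the weak partial derivative `∂_j u` on the open set `Ω`. -/
def HasWeakPartial {d : ℕ} (Ω : Set (SpaceTime d)) (j : Fin (d + 1)) (u g : SpaceTime d → ℝ) :
    Prop :=
  ∀ φ : SpaceTime d → ℝ, ContDiff ℝ ∞ φ → HasCompactSupport φ → tsupport φ ⊆ Ω →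
    ∫ x in Ω, u x * fderiv ℝ φ x (EuclideanSpace.single j 1) = -∫ x in Ω, g x * φ x

/-- The space `H^k(Ω)`: all weak derivatives of order at most `k` are in `L²(Ω)`. -/
def MemSobolev {d : ℕ} (Ω : Set (SpaceTime d)) : ℕ → (SpaceTime d → ℝ) → Prop
  | 0, u => MemLp u 2 (volume.restrict Ω)
  | k + 1, u => MemLp u 2 (volume.restrict Ω) ∧
      ∀ j, ∃ g, HasWeakPartial Ω j u g ∧ MemSobolev Ω k g

open Classical in
/-- The weak partial derivative `∂_j u ∈ L²(Ω)` (unique up to null sets; `0` if there is none). -/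
def weakPartial {d : ℕ} (Ω : Set (SpaceTime d)) (j : Fin (d + 1)) (u : SpaceTime d → ℝ) :
    SpaceTime d → ℝ :=
  if h : ∃ g, MemLp g 2 (volume.restrict Ω) ∧ HasWeakPartial Ω j u g then h.choose else 0

/-- The time derivative `∂_t u`. -/
def dt {d : ℕ} (Ω : Set (SpaceTime d)) (u : SpaceTime d → ℝ) : SpaceTime d → ℝ :=
  weakPartial Ω (Fin.last d) u

/-- The spatial gradient `∇_x u`. -/
def gradx {d : ℕ} (Ω : Set (SpaceTime d)) (u : SpaceTime d → ℝ) (x : SpaceTime d) :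
    EuclideanSpace ℝ (Fin d) :=
  WithLp.toLp 2 fun k => weakPartial Ω k.castSucc u x

/-- The mixed derivative `∂_t ∇_x u`. -/
def dtGradx {d : ℕ} (Ω : Set (SpaceTime d)) (u : SpaceTime d → ℝ) (x : SpaceTime d) :
    EuclideanSpace ℝ (Fin d) :=
  WithLp.toLp 2 fun k => dt Ω (weakPartial Ω k.castSucc u) x

/-- The `d`-dimensional surface measure on a set `F ⊆ ℝ^{d+1}`. -/
def surf {d : ℕ} (F : Set (SpaceTime d)) : Measure (SpaceTime d) :=
  (Measure.euclideanHausdorffMeasure d : Measure (SpaceTime d)).restrict F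

/-- `g ∈ L²(∂Ω)` is the trace of `w ∈ H¹(Ω)`: there are smooth functions that tend to `w` in
`H¹(Ω)` and whose boundary values tend to `g` in `L²(∂Ω)`. -/
def IsTrace {d : ℕ} (Ω : Set (SpaceTime d)) (w g : SpaceTime d → ℝ) : Prop :=
  MemSobolev Ω 1 w ∧ MemLp g 2 (surf (frontier Ω)) ∧
    ∃ φ : ℕ → SpaceTime d → ℝ, (∀ m, ContDiff ℝ ∞ (φ m)) ∧
      Tendsto (fun m => eLpNorm (fun x => φ m x - w x) 2 (volume.restrict Ω)) atTop (𝓝 0) ∧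
      (∀ j, Tendsto (fun m => eLpNorm
        (fun x => fderiv ℝ (φ m) x (EuclideanSpace.single j 1) - weakPartial Ω j w x) 2
        (volume.restrict Ω)) atTop (𝓝 0)) ∧
      Tendsto (fun m => eLpNorm (fun x => φ m x - g x) 2 (surf (frontier Ω))) atTop (𝓝 0)

open Classical in
/-- The trace of `w ∈ H¹(Ω)` on `∂Ω` (`0` if there is none). -/
def trace {d : ℕ} (Ω : Set (SpaceTime d)) (w : SpaceTime d → ℝ) : SpaceTime d → ℝ :=
  if h : ∃ g, IsTrace Ω w g then h.choose else 0

/-- The trace of `∂_t u` on `∂Ω`. -/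
def traceDt {d : ℕ} (Ω : Set (SpaceTime d)) (u : SpaceTime d → ℝ) : SpaceTime d → ℝ :=
  trace Ω (dt Ω u)

/-- The trace of `∇_x u` on `∂Ω`. -/
def traceGradx {d : ℕ} (Ω : Set (SpaceTime d)) (u : SpaceTime d → ℝ) (x : SpaceTime d) :
    EuclideanSpace ℝ (Fin d) :=
  WithLp.toLp 2 fun k => trace Ω (weakPartial Ω k.castSucc u) x

/-- The squared `L²(μ)`-norm of a scalar or vector valued function. -/
def sqL2 {d : ℕ} {V : Type} [NormedAddCommGroup V] (μ : Measure (SpaceTime d))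
    (f : SpaceTime d → V) : ℝ :=
  ∫ x, ‖f x‖ ^ 2 ∂μ

/-! ### B-splines -/

/-- The Cox-de Boor recursion: the `i`-th B-spline of degree `p` for the knots `ξ`
(division by zero gives zero). -/
def bspline (ξ : ℕ → ℝ) : ℕ → ℕ → ℝ → ℝ
  | 0, i, x => (Ico (ξ i) (ξ (i + 1))).indicator 1 x
  | p + 1, i, x =>
      (x - ξ i) / (ξ (i + p + 1) - ξ i) * bspline ξ p i x +
        (ξ (i + p + 2) - x) / (ξ (i + p + 2) - ξ (i + 1)) * bspline ξ p (i + 1) x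

/-- A knot vector `0 = ξ 0 ≤ … ≤ ξ (n + p) = 1` for `n` B-splines of degree `p`; only the
values of `ξ` at `0, …, n + p` matter. -/
structure KnotVector (p : ℕ) where
  n : ℕ
  ξ : ℕ → ℝ
  mono : MonotoneOn ξ (Iic (n + p))
  first : ξ 0 = 0
  last : ξ (n + p) = 1

/-- The parameter domain `(0,1)^{d+1}`. -/
def cube (d : ℕ) : Set (SpaceTime d) := {ξ | ∀ α, 0 < ξ α ∧ ξ α < 1}

/-- The closed parameter domain `[0,1]^{d+1}`. -/
def closedCube (d : ℕ) : Set (SpaceTime d) := {ξ | ∀ α, 0 ≤ ξ α ∧ ξ α ≤ 1}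

/-- The tensor product B-spline with multi-index `k`. -/
def tensorBSpline {d : ℕ} {p : Fin (d + 1) → ℕ} (Ξ : ∀ α, KnotVector (p α))
    (k : ∀ α, Fin (Ξ α).n) (x : SpaceTime d) : ℝ :=
  ∏ α, bspline (Ξ α).ξ (p α) (k α) (x α)

/-- `∏ (a α, b α)` is an element of the parameter mesh: in every direction, `a α < b α` are
consecutive distinct knots. -/
def IsParamElement {d : ℕ} {p : Fin (d + 1) → ℕ} (Ξ : ∀ α, KnotVector (p α))
    (a b : Fin (d + 1) → ℝ) : Prop :=
  ∀ α, a α < b α ∧ a α ∈ (Ξ α).ξ '' Iic ((Ξ α).n + p α) ∧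
    b α ∈ (Ξ α).ξ '' Iic ((Ξ α).n + p α) ∧
    ∀ m ≤ (Ξ α).n + p α, ¬ (a α < (Ξ α).ξ m ∧ (Ξ α).ξ m < b α)

/-- The open box `∏ (a α, b α)`. -/
def openBox {d : ℕ} (a b : Fin (d + 1) → ℝ) : Set (SpaceTime d) :=
  {x | ∀ α, a α < x α ∧ x α < b α}

/-! ### The multi-patch space-time domain -/

/-- A space-time domain `Q = {(x,t) : 0 < t < T, x ∈ Ω(t)}`, decomposed into `N`
non-overlapping patches `Q_i = Φ_i((0,1)^{d+1})`, with regular maps `Φ_i`. -/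
structure MultiPatch (d N : ℕ) where
  T : ℝ
  T_pos : 0 < T
  Q : Set (SpaceTime d)
  isOpen_Q : IsOpen Q
  Q_subset : ∀ x ∈ Q, 0 < x (Fin.last d) ∧ x (Fin.last d) < T
  Φ : Fin N → SpaceTime d → SpaceTime d
  contDiffOn_Φ : ∀ i, ContDiffOn ℝ 1 (Φ i) (closedCube d)
  injOn_Φ : ∀ i, InjOn (Φ i) (closedCube d)
  regular_Φ : ∀ i, ∀ ξ ∈ closedCube d, (fderivWithin ℝ (Φ i) (closedCube d) ξ).det ≠ 0
  patch_subset : ∀ i, Φ i '' cube d ⊆ Q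
  patch_disjoint : ∀ i j, i ≠ j → Disjoint (Φ i '' cube d) (Φ j '' cube d)
  closure_Q : closure Q = ⋃ i, closure (Φ i '' cube d)
  /-- The interior facets `F_ij`, each listed once, with an (arbitrary) order of the two
  patches. -/
  facets : Finset (Fin N × Fin N)
  facets_ne : ∀ i j, (i, j) ∈ facets → i ≠ j
  facets_once : ∀ i j, i ≠ j → ((i, j) ∈ facets ↔ (j, i) ∉ facets)

namespace MultiPatch

variable {d N : ℕ} (G : MultiPatch d N)

/-- The patch `Q_i`. -/
def patch (i : Fin N) : Set (SpaceTime d) := G.Φ i '' cube d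

/-- The interior facet `F_ij = ∂Q_i ∩ ∂Q_j`. -/
def facet (i j : Fin N) : Set (SpaceTime d) := frontier (G.patch i) ∩ frontier (G.patch j)

/-- The bottom `Σ_0` of the space-time domain. -/
def bottom : Set (SpaceTime d) := frontier G.Q ∩ {x | x (Fin.last d) = 0}

/-- The top `Σ_T` of the space-time domain. -/
def top : Set (SpaceTime d) := frontier G.Q ∩ {x | x (Fin.last d) = G.T}

/-- The lateral boundary `Σ` of the space-time domain. -/
def lateral : Set (SpaceTime d) :=
  frontier G.Q ∩ {x | 0 < x (Fin.last d) ∧ x (Fin.last d) < G.T}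

/-- The facet `∂Q_i ∩ Σ_T`. -/
def topFacet (i : Fin N) : Set (SpaceTime d) := frontier (G.patch i) ∩ G.top

/-- The inverse of `Φ_i`, on the closed patch. -/
def inv (i : Fin N) : SpaceTime d → SpaceTime d := Function.invFunOn (G.Φ i) (closedCube d)

/-- The outer normal direction of the unit cube: `± e_α` on the faces (edges play no role). -/
def refNormal (ξ : SpaceTime d) : SpaceTime d :=
  WithLp.toLp 2 fun α => if ξ α = 1 then 1 else if ξ α = 0 then -1 else 0

/-- The outer unit normal `n_i` on `∂Q_i`: the normalized vector `(DΦ_i)^{-T} ν`, where `ν` is the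
outer normal of the cube. -/
def normal (i : Fin N) (x : SpaceTime d) : SpaceTime d :=
  let D := fderivWithin ℝ (G.Φ i) (closedCube d) (G.inv i x)
  let w := ContinuousLinearMap.adjoint D.inverse (refNormal (G.inv i x))
  ‖w‖⁻¹ • w

/-- The time component `n_{i,t}`. -/
def nt (i : Fin N) (x : SpaceTime d) : ℝ := G.normal i x (Fin.last d)

/-- The space component `n_{i,x}`. -/
def nx (i : Fin N) (x : SpaceTime d) : EuclideanSpace ℝ (Fin d) :=
  WithLp.toLp 2 fun k => G.normal i x k.castSucc

/-! Jumps, averages and upwind values on `F_ij`; `f l` is the one-sided trace from `Q_l`. -/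

/-- The jump in space direction, `f_i n_{i,x} + f_j n_{j,x}`. -/
def jumpX (f : Fin N → SpaceTime d → ℝ) (i j : Fin N) (x : SpaceTime d) :
    EuclideanSpace ℝ (Fin d) :=
  f i x • G.nx i x + f j x • G.nx j x

/-- The jump in time direction, `f_i n_{i,t} + f_j n_{j,t}`. -/
def jumpT {V : Type} [AddCommGroup V] [Module ℝ V] (f : Fin N → SpaceTime d → V) (i j : Fin N)
    (x : SpaceTime d) : V :=
  G.nt i x • f i x + G.nt j x • f j x

/-- The average `(f_i + f_j) / 2`. -/
def avg {V : Type} [AddCommGroup V] [Module ℝ V] (f : Fin N → SpaceTime d → V) (i j : Fin N)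
    (x : SpaceTime d) : V :=
  (1 / 2 : ℝ) • (f i x + f j x)

open Classical in
/-- The upwind value in time direction. -/
def up {V : Type} (f : Fin N → SpaceTime d → V) (i j : Fin N) (x : SpaceTime d) : V :=
  if 0 ≤ G.nt i x then f i x else f j x

/-- The traces of `u` from the patches. -/
def tr (u : SpaceTime d → ℝ) (i : Fin N) : SpaceTime d → ℝ := trace (G.patch i) u

/-- The traces of `∂_t u` from the patches. -/
def trDt (u : SpaceTime d → ℝ) (i : Fin N) : SpaceTime d → ℝ := traceDt (G.patch i) u

/-- The traces of `∇_x u` from the patches. -/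
def trGradx (u : SpaceTime d → ℝ) (i : Fin N) : SpaceTime d → EuclideanSpace ℝ (Fin d) :=
  traceGradx (G.patch i) u

end MultiPatch

/-! ### The isogeometric discretization -/

/-- The discretization of a multi-patch domain by B-splines of degree `p i α` on the `i`-th patch
in direction `α`: knot vectors with continuously differentiable basis functions which, patch by
patch, also represent the map `Φ_i`. -/
structure Discretization {d N : ℕ} (G : MultiPatch d N) (p : Fin N → Fin (d + 1) → ℕ) where
  knots : ∀ i α, KnotVector (p i α)
  smooth : ∀ i k, ContDiffOn ℝ 1 (tensorBSpline (knots i) k) (cube d)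
  repr_Φ : ∀ i, ∃ C : (∀ α, Fin (knots i α).n) → SpaceTime d,
    ∀ ξ ∈ cube d, G.Φ i ξ = ∑ k, tensorBSpline (knots i) k ξ • C k

/-- The parameters `δ₁, δ₂, θ_i > 0` of the method. -/
structure Params (N : ℕ) where
  δ₁ : ℝ
  δ₂ : ℝ
  θ : Fin N → ℝ
  δ₁_pos : 0 < δ₁
  δ₂_pos : 0 < δ₂
  θ_pos : ∀ i, 0 < θ i

namespace Discretization

variable {d N : ℕ} {G : MultiPatch d N} {p : Fin N → Fin (d + 1) → ℕ} (D : Discretization G p)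

/-- The mesh size `h_i`: the maximum of the diameters of the mesh elements of `Q_i`. -/
def h (i : Fin N) : ℝ :=
  sSup {r | ∃ a b, IsParamElement (D.knots i) a b ∧ r = Metric.diam (G.Φ i '' openBox a b)}

/-- Quasi-uniformity with constant `C`: in every patch `h_i ≤ C h_K` for all elements `K`
(while `h_K ≤ h_i` by definition), and `h_i ≤ C h_j` if `Q_i` and `Q_j` share a facet. -/
def IsQuasiUniform (C : ℝ) : Prop :=
  (∀ i a b, IsParamElement (D.knots i) a b → D.h i ≤ C * Metric.diam (G.Φ i '' openBox a b)) ∧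
  ∀ i j, i ≠ j → surf (G.facet i j) ≠ 0 → D.h i ≤ C * D.h j

/-- Shape regularity with constant `ρ`: the ratio of two edge lengths of a parameter element is at
most `ρ`. -/
def IsShapeRegular (ρ : ℝ) : Prop :=
  ∀ i a b, IsParamElement (D.knots i) a b → ∀ α β, b α - a α ≤ ρ * (b β - a β)

/-- The spline space on the parameter domain. -/
def splineSpace (i : Fin N) : Submodule ℝ (SpaceTime d → ℝ) :=
  Submodule.span ℝ (range (tensorBSpline (D.knots i)))

/-- `v|_{Q_i}` belongs to the space `V_{h,i}` spanned by the mapped B-splines. -/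
def MemPatchSpace (i : Fin N) (v : SpaceTime d → ℝ) : Prop :=
  ∃ s ∈ D.splineSpace i, v =ᵐ[volume.restrict (G.patch i)] s ∘ G.inv i

/-- The discrete space `V_{0h}`: patchwise splines in `L²(Q)` that vanish on `Σ` and `Σ_0`. -/
def V0h : Set (SpaceTime d → ℝ) :=
  {v | MemLp v 2 (volume.restrict G.Q) ∧ ∀ i, D.MemPatchSpace i v ∧
    G.tr v i =ᵐ[surf (frontier (G.patch i) ∩ (G.lateral ∪ G.bottom))] 0}

/-- The space `V_{0h,*} = H²(Q) + V_{0h}` (equality in `L²(Q)`). -/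
def V0hStar : Set (SpaceTime d → ℝ) :=
  {u | ∃ w, MemSobolev G.Q 2 w ∧ ∃ v ∈ D.V0h, u =ᵐ[volume.restrict G.Q] fun x => w x + v x}

/-- `C` is an admissible constant in the inverse trace inequality
`‖w‖²_{L²(∂Q_i)} ≤ C h_i⁻¹ ‖w‖²_{L²(Q_i)}`, for `w = v` and for `w = ∇_x v`, `v ∈ V_{h,i}`. -/
def IsInverseConstant (C : ℝ) : Prop :=
  ∀ i v, D.MemPatchSpace i v →
    sqL2 (surf (frontier (G.patch i))) (G.tr v i) ≤
      C * (D.h i)⁻¹ * sqL2 (volume.restrict (G.patch i)) v ∧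
    sqL2 (surf (frontier (G.patch i))) (G.trGradx v i) ≤
      C * (D.h i)⁻¹ * sqL2 (volume.restrict (G.patch i)) (gradx (G.patch i) v)

variable (P : Params N)

/-- The discrete bilinear form `a_h(u, v)`. -/
def ah (u v : SpaceTime d → ℝ) : ℝ :=
  (∑ i, ∫ x in G.patch i,
      (-(u x * dt (G.patch i) v x)
        + P.θ i * D.h i * (dt (G.patch i) u x * dt (G.patch i) v x)
        + inner ℝ (gradx (G.patch i) u x) (gradx (G.patch i) v x)
        - P.θ i * D.h i * inner ℝ (dtGradx (G.patch i) u x) (gradx (G.patch i) v x)))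
  + (∑ F ∈ G.facets, ∫ x, G.up (G.tr u) F.1 F.2 x * G.jumpT (G.tr v) F.1 F.2 x
      ∂(surf (G.facet F.1 F.2)))
  + (∑ i, ∫ x, G.tr u i x * G.tr v i x ∂(surf (G.topFacet i)))
  + (∑ i, P.θ i * D.h i * ∫ x, inner ℝ (G.trGradx u i x) (G.trGradx v i x)
      ∂(surf (G.topFacet i)))
  + (∑ F ∈ G.facets, P.θ F.1 * D.h F.1 *
      ∫ x, inner ℝ (G.up (G.trGradx u) F.1 F.2 x) (G.jumpT (G.trGradx v) F.1 F.2 x)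
        ∂(surf (G.facet F.1 F.2)))
  + (∑ F ∈ G.facets,
      ∫ x, (-inner ℝ (MultiPatch.avg (G.trGradx u) F.1 F.2 x) (G.jumpX (G.tr v) F.1 F.2 x)
        + inner ℝ (MultiPatch.avg (G.trGradx v) F.1 F.2 x) (G.jumpX (G.tr u) F.1 F.2 x))
        ∂(surf (G.facet F.1 F.2)))
  + (∑ F ∈ G.facets, P.θ F.1 * D.h F.1 *
      ∫ x, (-inner ℝ (MultiPatch.avg (G.trGradx u) F.1 F.2 x) (G.jumpX (G.trDt v) F.1 F.2 x)
        + inner ℝ (MultiPatch.avg (G.trGradx v) F.1 F.2 x) (G.jumpX (G.trDt u) F.1 F.2 x))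
        ∂(surf (G.facet F.1 F.2)))
  + (∑ F ∈ G.facets,
      ∫ x, (P.δ₁ / D.h F.1 * inner ℝ (G.jumpX (G.tr u) F.1 F.2 x) (G.jumpX (G.tr v) F.1 F.2 x)
        + P.δ₂ * P.θ F.1 * D.h F.1 *
          inner ℝ (G.jumpX (G.trDt u) F.1 F.2 x) (G.jumpX (G.trDt v) F.1 F.2 x))
        ∂(surf (G.facet F.1 F.2)))

/-- The squared discrete norm `‖v‖_h²`. -/
def normSq (v : SpaceTime d → ℝ) : ℝ :=
  (∑ i, (sqL2 (volume.restrict (G.patch i)) (gradx (G.patch i) v)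
    + P.θ i * D.h i * sqL2 (volume.restrict (G.patch i)) (dt (G.patch i) v)))
  + 1 / 2 * (∑ i, sqL2 (surf (G.topFacet i)) (G.tr v i))
  + (∑ i, P.θ i * D.h i / 2 * sqL2 (surf (G.topFacet i)) (G.trGradx v i))
  + 1 / 2 * (∑ F ∈ G.facets, sqL2 (surf (G.facet F.1 F.2)) (G.jumpT (G.tr v) F.1 F.2))
  + (∑ F ∈ G.facets, P.θ F.1 * D.h F.1 / 2 *
      sqL2 (surf (G.facet F.1 F.2)) (G.jumpT (G.trGradx v) F.1 F.2))
  + (∑ F ∈ G.facets,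
      (P.δ₁ / D.h F.1 * sqL2 (surf (G.facet F.1 F.2)) (G.jumpX (G.tr v) F.1 F.2)
        + P.δ₂ * P.θ F.1 * D.h F.1 *
          sqL2 (surf (G.facet F.1 F.2)) (G.jumpX (G.trDt v) F.1 F.2)))

/-- The discrete norm `‖v‖_h`. -/
def norm (v : SpaceTime d → ℝ) : ℝ := √(D.normSq P v)

/-- The squared augmented norm `‖v‖_{h,*}²`. -/
def normStarSq (v : SpaceTime d → ℝ) : ℝ :=
  D.normSq P v
  + (∑ i, ((P.θ i * D.h i)⁻¹ * sqL2 (volume.restrict (G.patch i)) v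
      + (P.θ i * D.h i) ^ 2 * sqL2 (volume.restrict (G.patch i)) (dtGradx (G.patch i) v)))
  + (∑ F ∈ G.facets, sqL2 (surf (G.facet F.1 F.2)) (G.up (G.tr v) F.1 F.2))
  + (∑ F ∈ G.facets, P.θ F.1 * D.h F.1 *
      sqL2 (surf (G.facet F.1 F.2)) (G.up (G.trGradx v) F.1 F.2))
  + (∑ i, D.h i * sqL2 (surf (frontier (G.patch i))) (G.trGradx v i))

/-- The augmented norm `‖v‖_{h,*}`. -/
def normStar (v : SpaceTime d → ℝ) : ℝ := √(D.normStarSq P v)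

end Discretization

/-- The boundedness constant `μ_b`, with `θ = max_i θ_i`. -/
def muB {N : ℕ} (Cinv Cq : ℝ) (P : Params N) : ℝ :=
  2 * √(max (Cinv * Cq * (P.δ₁⁻¹ + (⨆ i, P.θ i) * P.δ₂⁻¹) / 4 + 1)
    ((P.δ₁⁻¹ + (⨆ i, P.θ i) * P.δ₂⁻¹) / 8))

end

end SpaceTimeDG

open SpaceTimeDG

/-!
The theorem has two parts. The first one is the inverse inequality
`‖w‖²_{L²(∂Q_i)} ≤ C h_i⁻¹ ‖w‖²_{L²(Q_i)}` for mapped splines `w = v` and their gradients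
`w = ∇_x v`. Traces are `L²(∂Q_i)`-limits of smooth functions `φ_m` that tend to `w` in `H¹(Q_i)`.
On each coordinate line of the parameter cube that starts at a face, the trace inequality in one
variable gives, for the value `φ(0)` at the face and for small `ε`,
`ε |φ(0)|² ≤ 2 ε² ∫₀¹ |∂φ|² + 2 ∫₀^ε |φ|²`,
and `∫₀^ε |φ|²` is at most `2 ∫₀^ε |φ - w|² + 2 ε sup |w|²`. Next to the face, up to a distance `ℓ`
comparable with `h_i`, the function `det DΦ_i · (w ∘ Φ_i)` is a polynomial of bounded degree along
the line: `Φ_i` is itself a spline, and by Cramer's rule the determinant clears the denominators of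
`∇_x v`. Hence `sup |w|² ≤ C ℓ⁻¹ ∫ |w|²` on this part of the line. Integrating over the lines
(`MultiPatch.exists_eLpNorm_frontier_le`), and letting first `m → ∞` and then `ε → 0`
(`MultiPatch.exists_eLpNorm_trace_le`), leaves the bound for the trace. The constants depend only on
`Φ_i`, the degrees, quasi-uniformity and shape regularity
(`Discretization.exists_isInverseConstant`).

The second part is the boundedness of `a_h` (`Discretization.abs_ah_le`). Every product in `a_h` is
split by Young's inequality with a common factor `t` and with weights such that the squares of `u`
appear in `‖u‖_{h,*}²` and those of `v` in `‖v‖_h²`. The only squares of `v` that do not appear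
there are those of `{∇_x v}` on the facets, which the inverse inequality reduces to
`‖∇_x v‖²_{L²(Q_i)}`. The sum over all terms is a bound `|a_h(u, v)| ≤ t/2 A + 1/(2t) B` for all `t > 0`, so that
`|a_h(u, v)| ≤ √A √B`. An inverse constant may be enlarged, and the enlargement by the factor
`2 (N + 1)` makes up for counting the facets of a patch coarsely in the sums.
-/

namespace SpaceTimeDG

/-! ### Functions that are polynomial on an interval -/

/-- On `I`, the function `f` agrees with a polynomial of degree at most `n`. -/
def IsPolyOn (n : ℕ) (I : Set ℝ) (f : ℝ → ℝ) : Prop :=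
  ∃ q : Polynomial ℝ, q.natDegree ≤ n ∧ ∀ t ∈ I, f t = q.eval t

namespace IsPolyOn

variable {n m : ℕ} {I J : Set ℝ} {f g : ℝ → ℝ}

lemma mono (h : IsPolyOn n I f) (hnm : n ≤ m) (hJ : J ⊆ I) : IsPolyOn m J f := by
  obtain ⟨q, hq, he⟩ := h
  exact ⟨q, hq.trans hnm, fun t ht => he t (hJ ht)⟩

lemma congr (h : IsPolyOn n I f) (hfg : ∀ t ∈ I, g t = f t) : IsPolyOn n I g := by
  obtain ⟨q, hq, he⟩ := h
  exact ⟨q, hq, fun t ht => (hfg t ht).trans (he t ht)⟩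

lemma const (n : ℕ) (I : Set ℝ) (c : ℝ) : IsPolyOn n I fun _ => c :=
  ⟨Polynomial.C c, by simp, by simp⟩

lemma affine (a b : ℝ) : IsPolyOn 1 I fun t => a * t + b :=
  ⟨Polynomial.C a * Polynomial.X + Polynomial.C b, Polynomial.natDegree_linear_le, by simp⟩

lemma add (hf : IsPolyOn n I f) (hg : IsPolyOn n I g) : IsPolyOn n I fun t => f t + g t := by
  obtain ⟨p, hp, hpe⟩ := hf
  obtain ⟨q, hq, hqe⟩ := hg
  refine ⟨p + q, (Polynomial.natDegree_add_le _ _).trans (max_le hp hq), fun t ht => ?_⟩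
  simp [hpe t ht, hqe t ht]

lemma mul (hf : IsPolyOn n I f) (hg : IsPolyOn m I g) :
    IsPolyOn (n + m) I fun t => f t * g t := by
  obtain ⟨p, hp, hpe⟩ := hf
  obtain ⟨q, hq, hqe⟩ := hg
  refine ⟨p * q, Polynomial.natDegree_mul_le.trans (add_le_add hp hq), fun t ht => ?_⟩
  simp [hpe t ht, hqe t ht]

lemma const_mul (c : ℝ) (hf : IsPolyOn n I f) : IsPolyOn n I fun t => c * f t := by
  simpa using (const 0 I c).mul hf

lemma sum {ι : Type*} (s : Finset ι) {F : ι → ℝ → ℝ} (h : ∀ i ∈ s, IsPolyOn n I (F i)) :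
    IsPolyOn n I fun t => ∑ i ∈ s, F i t := by
  classical
  induction s using Finset.induction_on with
  | empty => simpa using const n I 0
  | insert a s ha ih =>
    simp only [Finset.sum_insert ha]
    exact (h a (by simp)).add (ih fun i hi => h i (by simp [hi]))

lemma prod {ι : Type*} (s : Finset ι) {F : ι → ℝ → ℝ} (h : ∀ i ∈ s, IsPolyOn n I (F i)) :
    IsPolyOn (s.card * n) I fun t => ∏ i ∈ s, F i t := by
  classical
  induction s using Finset.induction_on with
  | empty => simpa using const 0 I 1
  | insert a s ha ih =>
    simp only [Finset.prod_insert ha, Finset.card_insert_of_notMem ha]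
    refine ((h a (by simp)).mul (ih fun i hi => h i (by simp [hi]))).mono ?_ subset_rfl
    rw [add_mul, one_mul, add_comm]

lemma det {k : ℕ} {M : ℝ → Matrix (Fin k) (Fin k) ℝ}
    (h : ∀ i j, IsPolyOn n I fun t => M t i j) : IsPolyOn (k * n) I fun t => (M t).det := by
  simp only [Matrix.det_apply']
  refine sum _ fun σ _ => const_mul _ ?_
  have := prod (n := n) (I := I) Finset.univ (F := fun i t => M t (σ i) i) fun i _ => h _ _
  simpa using this

/-- Polynomials of bounded degree are closed under pointwise limits: their coefficients are
determined by the values at finitely many nodes. -/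
lemma of_tendsto {F : ℕ → ℝ → ℝ} {a b : ℝ} (hab : a < b)
    (hF : ∀ᶠ m in atTop, IsPolyOn n (Ioo a b) (F m))
    (hlim : ∀ t ∈ Ioo a b, Tendsto (fun m => F m t) atTop (𝓝 (f t))) :
    IsPolyOn n (Ioo a b) f := by
  classical
  obtain ⟨s, hs, hcard⟩ := (Ioo_infinite hab).exists_subset_card_eq (n + 1)
  refine ⟨Lagrange.interpolate s id f, ?_, fun t ht => ?_⟩
  · have h := Lagrange.degree_interpolate_lt (s := s) (v := id) f (injOn_id _)
    rw [hcard] at h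
    exact Polynomial.natDegree_le_iff_coeff_eq_zero.2 fun N hN =>
      Polynomial.coeff_eq_zero_of_degree_lt (h.trans_le (by exact_mod_cast hN))
  · have h1 : ∀ᶠ m in atTop, F m t = (Lagrange.interpolate s id (F m)).eval t := by
      filter_upwards [hF] with m ⟨q, hq, hqe⟩
      rw [hqe t ht]
      congr 1
      refine Lagrange.eq_interpolate_of_eval_eq _ (injOn_id _) ?_ fun i hi => ?_
      · rw [hcard]
        exact Polynomial.degree_le_natDegree.trans_lt (by exact_mod_cast Nat.lt_succ_of_le hq)
      · simp [hqe i (hs hi)]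
    refine tendsto_nhds_unique (hlim t ht) (Tendsto.congr' (EventuallyEq.symm h1) ?_)
    simp only [Lagrange.interpolate_apply, Polynomial.eval_finsetSum, Polynomial.eval_mul,
      Polynomial.eval_C]
    exact tendsto_finsetSum _ fun i hi => (hlim i (hs hi)).mul_const _

lemma comp_affine (h : IsPolyOn n J f) (a b : ℝ) (hI : ∀ t ∈ I, b * t + a ∈ J) :
    IsPolyOn n I fun t => f (b * t + a) := by
  obtain ⟨q, hq, he⟩ := h
  refine ⟨q.comp (Polynomial.C b * Polynomial.X + Polynomial.C a), ?_, fun t ht => ?_⟩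
  · refine Polynomial.natDegree_comp_le.trans ?_
    calc _ ≤ n * 1 := Nat.mul_le_mul hq Polynomial.natDegree_linear_le
      _ = n := mul_one n
  · simp [he _ (hI t ht)]

lemma deriv {f' : ℝ → ℝ} (hI : IsOpen I) (h : IsPolyOn n I f)
    (hd : ∀ t ∈ I, HasDerivAt f (f' t) t) : IsPolyOn n I f' := by
  obtain ⟨q, hq, he⟩ := h
  refine ⟨q.derivative, (Polynomial.natDegree_derivative_le q).trans (by omega), fun t ht => ?_⟩
  refine (hd t ht).unique ((q.hasDerivAt t).congr_of_eventuallyEq ?_)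
  filter_upwards [hI.mem_nhds ht] with x hx using he x hx

end IsPolyOn

/-! ### Inequalities on an interval -/

/-- The inverse inequality for polynomials in one variable: after scaling to `(0, 1)`, the
quadratic form `∫ q²` of the coefficients is positive on their unit sphere, which is compact. -/
lemma exists_sq_eval_le_integral (n : ℕ) : ∃ C : ℝ, 0 < C ∧ ∀ q : Polynomial ℝ,
    q.natDegree ≤ n → ∀ ℓ > 0, ∀ t ∈ Ioo (0 : ℝ) ℓ,
      q.eval t ^ 2 ≤ C / ℓ * ∫ s in (0 : ℝ)..ℓ, q.eval s ^ 2 := by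
  let ev : (Fin (n + 1) → ℝ) → ℝ → ℝ := fun a s => ∑ i, a i * s ^ (i : ℕ)
  have hevc : Continuous (Function.uncurry ev) := by
    simp only [ev, Function.uncurry_def]; fun_prop
  let F : (Fin (n + 1) → ℝ) → ℝ := fun a => ∫ s in (0 : ℝ)..1, ev a s ^ 2
  have hFc : Continuous F := by
    refine intervalIntegral.continuous_parametric_intervalIntegral_of_continuous' ?_ 0 1
    exact hevc.pow 2
  have hevc' : ∀ a, Continuous (ev a) := fun a =>
    hevc.comp (by fun_prop : Continuous fun s => (a, s))
  have hFpos : ∀ a, a ≠ 0 → 0 < F a := by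
    intro a ha
    refine lt_of_le_of_ne (intervalIntegral.integral_nonneg (by norm_num)
      fun s _ => sq_nonneg _) fun h0 => ha ?_
    have hz : ∀ s ∈ Ioo (0 : ℝ) 1, ev a s = 0 := by
      intro s hs
      by_contra hne
      have : 0 < F a := by
        refine intervalIntegral.integral_pos (by norm_num) ((hevc' a).pow 2).continuousOn
          (fun s _ => sq_nonneg _) ⟨s, Ioo_subset_Icc_self hs, by positivity⟩
      exact this.ne h0
    let q : Polynomial ℝ := ∑ i : Fin (n + 1), Polynomial.monomial (i : ℕ) (a i)
    have hqe : ∀ s, q.eval s = ev a s := fun s => by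
      simp [q, ev, Polynomial.eval_finsetSum]
    have hq0 : q = 0 := Polynomial.eq_zero_of_infinite_isRoot q
      ((Ioo_infinite (zero_lt_one (α := ℝ))).mono fun s hs => by
        simp [Polynomial.IsRoot, hqe, hz s hs])
    funext i
    have : q.coeff (i : ℕ) = a i := by
      simp only [q, Polynomial.finsetSum_coeff, Polynomial.coeff_monomial]
      rw [Finset.sum_eq_single i]
      · simp
      · intro j _ hj
        simp [Fin.val_inj, hj]
      · simp
    rw [← this, hq0]; simp
  obtain ⟨c, hc, hcF⟩ : ∃ c > 0, ∀ a, c * ‖a‖ ^ 2 ≤ F a := by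
    obtain ⟨a₀, ha₀, hmin⟩ := (isCompact_sphere (0 : Fin (n + 1) → ℝ) 1).exists_isMinOn
      (NormedSpace.sphere_nonempty.2 zero_le_one) hFc.continuousOn
    have ha₀' : ‖a₀‖ = 1 := by simpa using ha₀
    refine ⟨F a₀, hFpos _ fun h => by simp [h] at ha₀', fun a => ?_⟩
    rcases eq_or_ne a 0 with rfl | ha
    · simp [F, ev]
    have hn : 0 < ‖a‖ := norm_pos_iff.2 ha
    have h1 : F a₀ ≤ F (‖a‖⁻¹ • a) := hmin (by simp [norm_smul, hn.ne'])
    have h2 : F (‖a‖⁻¹ • a) = (‖a‖⁻¹) ^ 2 * F a := by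
      simp only [F, ← intervalIntegral.integral_const_mul]
      congr 1; funext s
      simp only [ev, Pi.smul_apply, smul_eq_mul, ← mul_pow, Finset.mul_sum, mul_assoc]
    rw [h2] at h1
    calc F a₀ * ‖a‖ ^ 2 ≤ ((‖a‖⁻¹) ^ 2 * F a) * ‖a‖ ^ 2 := by gcongr
      _ = F a := by field_simp
  refine ⟨(n + 1) ^ 2 / c, by positivity, fun q hq ℓ hℓ t ht => ?_⟩
  let a : Fin (n + 1) → ℝ := fun i => q.coeff i * ℓ ^ (i : ℕ)
  have hae : ∀ s, q.eval (ℓ * s) = ev a s := fun s => by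
    rw [Polynomial.eval_eq_sum_range' (Nat.lt_succ_of_le hq), Finset.sum_range]
    simp only [ev, a, mul_pow, mul_assoc]
  have hF : ∫ s in (0 : ℝ)..ℓ, q.eval s ^ 2 = ℓ * F a := by
    have := intervalIntegral.mul_integral_comp_mul_left (a := 0) (b := 1)
      (f := fun s => q.eval s ^ 2) (c := ℓ)
    simp only [mul_zero, mul_one] at this
    rw [← this]; simp only [hae, F]
  have hb : |ev a (t / ℓ)| ≤ (n + 1) * ‖a‖ := by
    have htl : 0 ≤ t / ℓ ∧ t / ℓ ≤ 1 := ⟨by have := ht.1; positivity, (div_le_one hℓ).2 ht.2.le⟩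
    calc |ev a (t / ℓ)| ≤ ∑ i : Fin (n + 1), |a i * (t / ℓ) ^ (i : ℕ)| :=
          Finset.abs_sum_le_sum_abs _ _
      _ ≤ ∑ i : Fin (n + 1), ‖a‖ := by
          refine Finset.sum_le_sum fun i _ => ?_
          rw [abs_mul, abs_of_nonneg (pow_nonneg htl.1 _)]
          calc _ ≤ |a i| * 1 := by gcongr; exact pow_le_one₀ htl.1 htl.2
            _ ≤ ‖a‖ := by simpa using norm_le_pi_norm a i
      _ = _ := by simp
  have hqt : q.eval t = ev a (t / ℓ) := by rw [← hae]; congr 1; field_simp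
  rw [hqt, hF]
  calc ev a (t / ℓ) ^ 2 = |ev a (t / ℓ)| ^ 2 := (sq_abs _).symm
    _ ≤ ((n + 1) * ‖a‖) ^ 2 := by gcongr
    _ = (n + 1) ^ 2 / c * (c * ‖a‖ ^ 2) := by field_simp
    _ ≤ (n + 1) ^ 2 / c * F a := by gcongr; exact hcF a
    _ = _ := by field_simp

lemma enorm_sq_eq_ofReal (x : ℝ) : ‖x‖ₑ ^ 2 = ENNReal.ofReal (x ^ 2) := by
  rw [← sq_abs, ENNReal.ofReal_pow (abs_nonneg _), ← Real.enorm_eq_ofReal_abs]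

lemma add_sq_le_two_mul_ennreal (a b : ENNReal) : (a + b) ^ 2 ≤ 2 * a ^ 2 + 2 * b ^ 2 := by
  have := ENNReal.rpow_add_le_mul_rpow_add_rpow a b (p := 2) (by norm_num)
  norm_num at this
  rw [← mul_add]
  exact_mod_cast this

lemma enorm_sq_le_two_mul (x y : ℝ) : ‖x‖ₑ ^ 2 ≤ 2 * ‖x - y‖ₑ ^ 2 + 2 * ‖y‖ₑ ^ 2 := by
  refine le_trans ?_ (add_sq_le_two_mul_ennreal _ _)
  gcongr
  simpa using enorm_add_le (x - y) y

/-- The Cauchy–Schwarz inequality for `1 * f`. -/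
lemma sq_lintegral_le {α : Type*} [MeasurableSpace α] (μ : Measure α) {f : α → ENNReal}
    (hf : AEMeasurable f μ) : (∫⁻ x, f x ∂μ) ^ 2 ≤ μ univ * ∫⁻ x, f x ^ 2 ∂μ := by
  have h := ENNReal.lintegral_mul_le_Lp_mul_Lq μ (Real.HolderConjugate.two_two) (f := 1) (g := f)
    aemeasurable_const hf
  simp only [Pi.mul_apply, Pi.one_apply, one_mul, ENNReal.one_rpow, lintegral_const] at h
  calc (∫⁻ x, f x ∂μ) ^ 2 ≤
        ((μ univ) ^ (1 / 2 : ℝ) * (∫⁻ x, f x ^ (2 : ℝ) ∂μ) ^ (1 / 2 : ℝ)) ^ 2 := by gcongr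
    _ = _ := by
        rw [mul_pow, ← ENNReal.rpow_natCast, ← ENNReal.rpow_natCast, ← ENNReal.rpow_mul,
          ← ENNReal.rpow_mul]
        norm_num

/-- The trace inequality on the interval `(0,1)`, with weights: `g 0` differs from `g σ`, `σ < ε`,
by an integral of `g'` over an interval of length at most `ε`. -/
lemma trace_inequality_interval {g g' : ℝ → ℝ} (hg : ContinuousOn g (Icc 0 1))
    (hd : ∀ σ ∈ Ioo (0 : ℝ) 1, HasDerivAt g (g' σ) σ) (hg' : ContinuousOn g' (Icc 0 1))
    {ε : ℝ} (hε1 : ε ≤ 1) :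
    ENNReal.ofReal ε * ‖g 0‖ₑ ^ 2 ≤
      2 * ENNReal.ofReal ε ^ 2 * (∫⁻ σ in Ioo 0 1, ‖g' σ‖ₑ ^ 2) +
        2 * ∫⁻ σ in Ioo 0 ε, ‖g σ‖ₑ ^ 2 := by
  set D := ∫⁻ σ in Ioo (0 : ℝ) 1, ‖g' σ‖ₑ ^ 2
  have key : ∀ σ ∈ Ioo 0 ε, ‖g 0‖ₑ ^ 2 ≤ 2 * (ENNReal.ofReal ε * D) + 2 * ‖g σ‖ₑ ^ 2 := by
    intro σ hσ
    have hσ1 : σ ≤ 1 := hσ.2.le.trans hε1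
    have hsub : Icc 0 σ ⊆ Icc (0 : ℝ) 1 := Icc_subset_Icc_right hσ1
    have hftc := intervalIntegral.integral_eq_sub_of_hasDerivAt_of_le hσ.1.le (hg.mono hsub)
      (fun x hx => hd x ⟨hx.1, hx.2.trans_le hσ1⟩)
      ((hg'.mono (by rwa [uIcc_of_le hσ.1.le])).intervalIntegrable)
    have h1 : ‖g 0 - g σ‖ₑ ≤ ∫⁻ s in Ioo 0 σ, ‖g' s‖ₑ := by
      rw [← enorm_neg, neg_sub, ← hftc, intervalIntegral.integral_of_le hσ.1.le,
        integral_Ioc_eq_integral_Ioo]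
      exact enorm_integral_le_lintegral_enorm _
    have hm : AEMeasurable (fun s => ‖g' s‖ₑ) (volume.restrict (Ioo 0 σ)) :=
      ((hg'.mono (Ioo_subset_Icc_self.trans hsub)).aemeasurable measurableSet_Ioo).enorm
    have h2 : ‖g 0 - g σ‖ₑ ^ 2 ≤ ENNReal.ofReal ε * D := by
      calc _ ≤ (∫⁻ s in Ioo 0 σ, ‖g' s‖ₑ) ^ 2 := by gcongr
        _ ≤ _ := sq_lintegral_le _ hm
        _ ≤ _ := by
          simp only [Measure.restrict_apply_univ, Real.volume_Ioo, sub_zero]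
          gcongr
          · exact hσ.2.le
          · exact lintegral_mono_set (Ioo_subset_Ioo_right hσ1)
    exact (enorm_sq_le_two_mul _ (g σ)).trans (by gcongr)
  have hgm : AEMeasurable (fun s => 2 * ‖g s‖ₑ ^ 2) (volume.restrict (Ioo 0 ε)) :=
    ((((hg.mono (Ioo_subset_Icc_self.trans (Icc_subset_Icc_right hε1))).aemeasurable
      measurableSet_Ioo).enorm).pow_const 2).const_mul 2
  calc ENNReal.ofReal ε * ‖g 0‖ₑ ^ 2 = ∫⁻ _ in Ioo 0 ε, ‖g 0‖ₑ ^ 2 := by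
        simp [mul_comm]
    _ ≤ ∫⁻ σ in Ioo 0 ε, (2 * (ENNReal.ofReal ε * D) + 2 * ‖g σ‖ₑ ^ 2) :=
        setLIntegral_mono' measurableSet_Ioo key
    _ = _ := by
        rw [lintegral_add_right' _ hgm, lintegral_const_mul' _ (fun σ => ‖g σ‖ₑ ^ 2) (by norm_num)]
        simp only [lintegral_const, Measure.restrict_apply_univ, Real.volume_Ioo, sub_zero]
        ring

/-! ### B-splines along coordinate lines -/

/-- B-splines are polynomial on intervals that contain no knot. -/
lemma bspline_isPolyOn {ξ : ℕ → ℝ} {M : ℕ} {a b : ℝ} (hab : ∀ m ≤ M, ¬ (a < ξ m ∧ ξ m < b)) :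
    ∀ p i, i + p + 1 ≤ M → IsPolyOn p (Ioo a b) (bspline ξ p i)
  | 0, i, hi => by
    have h1 := hab i (by omega)
    have h2 := hab (i + 1) (by omega)
    by_cases h : ξ i ≤ a ∧ b ≤ ξ (i + 1)
    · refine (IsPolyOn.const 0 _ 1).congr fun t ht => ?_
      simp only [bspline]
      exact indicator_of_mem (show t ∈ Ico _ _ from ⟨h.1.trans ht.1.le, ht.2.trans_le h.2⟩) _
    · refine (IsPolyOn.const 0 _ 0).congr fun t ht => ?_
      simp only [bspline]
      refine indicator_of_notMem (fun hm => h ⟨?_, ?_⟩) _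
      · exact not_lt.1 fun hlt => h1 ⟨hlt, hm.1.trans_lt ht.2⟩
      · exact not_lt.1 fun hlt => h2 ⟨ht.1.trans hm.2, hlt⟩
  | p + 1, i, hi => by
    have h1 := bspline_isPolyOn hab p i (by omega)
    have h2 := bspline_isPolyOn hab p (i + 1) (by omega)
    have e1 := ((IsPolyOn.affine (I := Ioo a b) (ξ (i + p + 1) - ξ i)⁻¹
      (-(ξ i * (ξ (i + p + 1) - ξ i)⁻¹))).mul h1)
    have e2 := ((IsPolyOn.affine (I := Ioo a b) (-(ξ (i + p + 2) - ξ (i + 1))⁻¹)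
      (ξ (i + p + 2) * (ξ (i + p + 2) - ξ (i + 1))⁻¹)).mul h2)
    refine ((e1.add e2).mono (by omega) subset_rfl).congr fun t _ => ?_
    simp only [bspline, div_eq_mul_inv]
    ring

/-- The point of space-time with coordinate `τ` in direction `α` and the other coordinates `y`. -/
noncomputable def line {d : ℕ} (α : Fin (d + 1)) (y : Fin d → ℝ) (τ : ℝ) : SpaceTime d :=
  WithLp.toLp 2 (α.insertNth τ y : Fin (d + 1) → ℝ)

section line

variable {d : ℕ} (α : Fin (d + 1)) (y : Fin d → ℝ) (τ : ℝ)

@[simp] lemma line_same : line α y τ α = τ := by simp [line]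

@[simp] lemma line_succAbove (j : Fin d) : line α y τ (α.succAbove j) = y j := by simp [line]

lemma line_self_succAbove (x : SpaceTime d) : line α (fun j => x (α.succAbove j)) (x α) = x := by
  ext β
  rcases Fin.eq_self_or_eq_succAbove α β with rfl | ⟨j, rfl⟩ <;> simp

lemma forall_line {P : Fin (d + 1) → ℝ → Prop} :
    (∀ β, P β (line α y τ β)) ↔ P α τ ∧ ∀ j, P (α.succAbove j) (y j) := by
  rw [Fin.forall_iff_succAbove α]; simp

lemma line_mem_cube : line α y τ ∈ cube d ↔ τ ∈ Ioo (0 : ℝ) 1 ∧ ∀ j, y j ∈ Ioo (0 : ℝ) 1 :=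
  forall_line α y τ (P := fun _ t => 0 < t ∧ t < 1)

lemma line_mem_closedCube :
    line α y τ ∈ closedCube d ↔ τ ∈ Icc (0 : ℝ) 1 ∧ ∀ j, y j ∈ Icc (0 : ℝ) 1 :=
  forall_line α y τ (P := fun _ t => 0 ≤ t ∧ t ≤ 1)

lemma hasDerivAt_line : HasDerivAt (line α y) (EuclideanSpace.single α 1) τ := by
  have h : HasDerivAt (fun t => (α.insertNth t y : Fin (d + 1) → ℝ)) (Pi.single α 1) τ := by
    rw [hasDerivAt_pi]
    intro β
    rcases Fin.eq_self_or_eq_succAbove α β with rfl | ⟨j, rfl⟩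
    · simpa using hasDerivAt_id' τ
    · simpa using hasDerivAt_const τ (y j)
  exact (PiLp.continuousLinearEquiv 2 ℝ fun _ : Fin (d + 1) => ℝ).symm.hasFDerivAt.comp_hasDerivAt
    τ h

lemma continuous_line : Continuous fun q : ℝ × (Fin d → ℝ) => line α q.2 q.1 := by
  refine (PiLp.continuous_toLp 2 _).comp (continuous_pi fun β => ?_)
  rcases Fin.eq_self_or_eq_succAbove α β with rfl | ⟨j, rfl⟩ <;> simp <;> fun_prop

lemma line_add_single (j : Fin d) (h : ℝ) :
    line α y τ + EuclideanSpace.single (α.succAbove j) h =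
      line α (Function.update y j (y j + h)) τ := by
  ext γ
  rcases Fin.eq_self_or_eq_succAbove α γ with rfl | ⟨k, rfl⟩
  · simp
  · rcases eq_or_ne k j with rfl | hk <;> simp [*]

end line

section spline

variable {d : ℕ} {p : Fin (d + 1) → ℕ} {Ξ : ∀ α, KnotVector (p α)}

lemma tensorBSpline_isPolyOn {α : Fin (d + 1)} {a b : ℝ}
    (hab : ∀ m ≤ (Ξ α).n + p α, ¬ (a < (Ξ α).ξ m ∧ (Ξ α).ξ m < b)) (k : ∀ α, Fin (Ξ α).n)
    (y : Fin d → ℝ) : IsPolyOn (p α) (Ioo a b) fun τ => tensorBSpline Ξ k (line α y τ) := by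
  have h := bspline_isPolyOn hab (p α) (k α) (by have := (k α).2; omega)
  refine (h.const_mul (∏ j, bspline (Ξ (α.succAbove j)).ξ (p (α.succAbove j))
    (k (α.succAbove j)) (y j))).congr fun τ _ => ?_
  rw [tensorBSpline, Fin.prod_univ_succAbove _ α, mul_comm]
  simp

lemma isPolyOn_of_mem_span {α : Fin (d + 1)} {a b : ℝ}
    (hab : ∀ m ≤ (Ξ α).n + p α, ¬ (a < (Ξ α).ξ m ∧ (Ξ α).ξ m < b)) (y : Fin d → ℝ)
    {s : SpaceTime d → ℝ} (hs : s ∈ Submodule.span ℝ (range (tensorBSpline Ξ))) :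
    IsPolyOn (p α) (Ioo a b) fun τ => s (line α y τ) := by
  induction hs using Submodule.span_induction with
  | mem _ hx => obtain ⟨k, rfl⟩ := hx; exact tensorBSpline_isPolyOn hab k y
  | zero => exact IsPolyOn.const _ _ 0
  | add f g _ _ hf hg => exact hf.add hg
  | smul c f _ hf => exact hf.const_mul c

/-- At both ends of `[0,1]` there is an element of the knot mesh. The point `c + (1 - 2c) σ` lies
at distance `σ` from the end point `c ∈ {0, 1}`. -/
lemma KnotVector.exists_end_element {p : ℕ} (K : KnotVector p) {c : ℝ} (hc : c = 0 ∨ c = 1) :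
    ∃ a b, (a < b ∧ a ∈ K.ξ '' Iic (K.n + p) ∧ b ∈ K.ξ '' Iic (K.n + p) ∧
      ∀ m ≤ K.n + p, ¬ (a < K.ξ m ∧ K.ξ m < b)) ∧
      ∀ σ ∈ Ioo 0 (b - a), c + (1 - 2 * c) * σ ∈ Ioo a b := by
  have h0 : (0 : ℝ) ∈ K.ξ '' Iic (K.n + p) := ⟨0, by simp, K.first⟩
  have h1 : (1 : ℝ) ∈ K.ξ '' Iic (K.n + p) := ⟨K.n + p, by simp, K.last⟩
  have hfin : (K.ξ '' Iic (K.n + p)).Finite := (finite_Iic _).image _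
  rcases hc with rfl | rfl
  · obtain ⟨b, ⟨hb, hb0⟩, hmin⟩ := exists_min_image (K.ξ '' Iic (K.n + p) ∩ Ioi 0) id
      (hfin.subset inter_subset_left) ⟨1, h1, by simp⟩
    refine ⟨0, b, ⟨hb0, h0, hb, fun m hm h => ?_⟩, fun σ hσ => by simpa using hσ⟩
    exact absurd (hmin (K.ξ m) ⟨mem_image_of_mem _ hm, h.1⟩) (not_le.2 h.2)
  · obtain ⟨a, ⟨ha, ha1⟩, hmax⟩ := exists_max_image (K.ξ '' Iic (K.n + p) ∩ Iio 1) id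
      (hfin.subset inter_subset_left) ⟨0, h0, by simp⟩
    refine ⟨a, 1, ⟨ha1, ha, h1, fun m hm h => ?_⟩, fun σ hσ => ?_⟩
    · exact absurd (hmax (K.ξ m) ⟨mem_image_of_mem _ hm, h.2⟩) (not_le.2 h.1)
    · constructor <;> linarith [hσ.1, hσ.2]

lemma KnotVector.mem_Icc {p : ℕ} (K : KnotVector p) {x : ℝ} (hx : x ∈ K.ξ '' Iic (K.n + p)) :
    x ∈ Icc (0 : ℝ) 1 := by
  obtain ⟨m, hm, rfl⟩ := hx
  exact ⟨K.first ▸ K.mono (by simp) hm (Nat.zero_le m),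
    K.last ▸ K.mono hm (by simp) hm⟩

lemma IsParamElement.openBox_subset {a b : Fin (d + 1) → ℝ} (h : IsParamElement Ξ a b) :
    openBox a b ⊆ closedCube d := fun _ hx α =>
  ⟨((Ξ α).mem_Icc (h α).2.1).1.trans (hx α).1.le, (hx α).2.le.trans ((Ξ α).mem_Icc (h α).2.2.1).2⟩

end spline

/-! ### The mesh size -/

lemma norm_le_card_mul {d : ℕ} {x : SpaceTime d} {r : ℝ} (h : ∀ α, |x α| ≤ r) :
    ‖x‖ ≤ (d + 1) * r := by
  have hr : 0 ≤ r := (abs_nonneg _).trans (h 0)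
  rw [EuclideanSpace.norm_eq]
  refine Real.sqrt_le_iff.2 ⟨by positivity, ?_⟩
  calc ∑ i, ‖x i‖ ^ 2 ≤ ∑ _i : Fin (d + 1), r ^ 2 := by gcongr with i; exact h i
    _ = (d + 1) * r ^ 2 := by simp
    _ ≤ ((d + 1) * r) ^ 2 := by
      rw [mul_pow]; gcongr
      nlinarith [(Nat.cast_nonneg d : (0 : ℝ) ≤ d)]

namespace Discretization

variable {d N : ℕ} {G : MultiPatch d N} {p : Fin N → Fin (d + 1) → ℕ} (D : Discretization G p)
  {i : Fin N}

lemma diam_element_le {L : ℝ} (hL0 : 0 ≤ L)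
    (hL : ∀ x ∈ closedCube d, ∀ y ∈ closedCube d, ‖G.Φ i x - G.Φ i y‖ ≤ L * ‖x - y‖)
    {a b : Fin (d + 1) → ℝ} (h : IsParamElement (D.knots i) a b) {r : ℝ}
    (hr : ∀ α, b α - a α ≤ r) : Metric.diam (G.Φ i '' openBox a b) ≤ L * ((d + 1) * r) := by
  have hr0 : 0 ≤ r := (sub_nonneg.2 (h 0).1.le).trans (hr 0)
  refine Metric.diam_le_of_forall_dist_le (by positivity) ?_
  rintro _ ⟨x, hx, rfl⟩ _ ⟨y, hy, rfl⟩
  rw [dist_eq_norm]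
  refine (hL x (h.openBox_subset hx) y (h.openBox_subset hy)).trans ?_
  gcongr
  refine norm_le_card_mul fun α => (abs_le.2 ⟨?_, ?_⟩ : |x α - y α| ≤ r) <;>
  linarith [(hx α).1, (hx α).2, (hy α).1, (hy α).2, hr α]

/-- The mesh size is positive. The supremum in its definition is one of a bounded set, as `Φ_i` is
Lipschitz, so that it is not a junk value. -/
lemma h_pos {L : ℝ} (hL0 : 0 ≤ L)
    (hL : ∀ x ∈ closedCube d, ∀ y ∈ closedCube d, ‖G.Φ i x - G.Φ i y‖ ≤ L * ‖x - y‖) :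
    0 < D.h i := by
  have hbound : ∀ a b, IsParamElement (D.knots i) a b →
      Metric.diam (G.Φ i '' openBox a b) ≤ L * ((d + 1) * 1) := fun a b hab =>
    D.diam_element_le hL0 hL hab fun α => by
      linarith [((D.knots i α).mem_Icc (hab α).2.1).1, ((D.knots i α).mem_Icc (hab α).2.2.1).2]
  choose a b hab _ using fun α => (D.knots i α).exists_end_element (c := 0) (Or.inl rfl)
  have hel : IsParamElement (D.knots i) a b := hab
  refine lt_of_lt_of_le ?_ (le_csSup ⟨L * ((d + 1) * 1), ?_⟩ ⟨a, b, hel, rfl⟩)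
  · -- the image of an element has positive diameter, as `Φ_i` is injective
    have hlt : ∀ α, a α < b α := fun α => (hab α).1
    have hx : ∀ t ∈ Ioo (0 : ℝ) 1,
        (WithLp.toLp 2 fun α => a α + t * (b α - a α) : SpaceTime d) ∈ openBox a b := by
      intro t ht α
      have := hlt α
      simp only
      constructor <;> nlinarith [ht.1, ht.2]
    have hb : Bornology.IsBounded (G.Φ i '' openBox a b) := by
      refine Metric.isBounded_iff.2 ⟨L * ((d + 1) * 1), ?_⟩
      rintro _ ⟨x, hx, rfl⟩ _ ⟨y, hy, rfl⟩
      rw [dist_eq_norm]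
      refine (hL x (hel.openBox_subset hx) y (hel.openBox_subset hy)).trans ?_
      gcongr
      have hx' := hel.openBox_subset hx
      have hy' := hel.openBox_subset hy
      refine norm_le_card_mul fun α => (abs_le.2 ⟨?_, ?_⟩ : |x α - y α| ≤ 1) <;>
      linarith [(hx' α).1, (hx' α).2, (hy' α).1, (hy' α).2]
    refine Metric.diam_pos (Set.Nontrivial.image_of_injOn ?_
      ((G.injOn_Φ i).mono hel.openBox_subset)) hb
    refine ⟨_, hx (1 / 2) (by norm_num), _, hx (1 / 3) (by norm_num), fun h => ?_⟩
    have := congrArg (fun x : SpaceTime d => x 0) h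
    simp only at this
    linarith [hlt 0]
  · rintro r ⟨a, b, hab, rfl⟩
    exact hbound a b hab

/-- `(a, b)` is contained in `[0, 1]` and contains no knot for direction `α`. -/
def IsKnotFree (i : Fin N) (α : Fin (d + 1)) (a b : ℝ) : Prop :=
  Ioo a b ⊆ Ioo 0 1 ∧
    ∀ m ≤ (D.knots i α).n + p i α, ¬ (a < (D.knots i α).ξ m ∧ (D.knots i α).ξ m < b)

/-- Next to each face of the cube the elements of the parameter mesh have a width comparable with
the mesh size. -/
lemma exists_end_interval {L Cq ρ : ℝ} (hL0 : 0 ≤ L)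
    (hL : ∀ x ∈ closedCube d, ∀ y ∈ closedCube d, ‖G.Φ i x - G.Φ i y‖ ≤ L * ‖x - y‖)
    (hCq : 0 ≤ Cq) (hq : D.IsQuasiUniform Cq) (hs : D.IsShapeRegular ρ)
    (α : Fin (d + 1)) {c : ℝ} (hc : c = 0 ∨ c = 1) :
    ∃ a b, a < b ∧ b - a ≤ 1 ∧ D.h i ≤ Cq * (L * ((d + 1) * ρ)) * (b - a) ∧
      (∀ σ ∈ Ioo 0 (b - a), c + (1 - 2 * c) * σ ∈ Ioo a b) ∧ D.IsKnotFree i α a b := by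
  choose a b hab hσ using fun α => (D.knots i α).exists_end_element hc
  have hel : IsParamElement (D.knots i) a b := hab
  refine ⟨a α, b α, (hab α).1, ?_, ?_, hσ α, Ioo_subset_Ioo ((D.knots i α).mem_Icc (hab α).2.1).1
    ((D.knots i α).mem_Icc (hab α).2.2.1).2, (hab α).2.2.2⟩
  · linarith [((D.knots i α).mem_Icc (hab α).2.1).1, ((D.knots i α).mem_Icc (hab α).2.2.1).2]
  · calc D.h i ≤ Cq * Metric.diam (G.Φ i '' openBox a b) := hq.1 i a b hel
      _ ≤ Cq * (L * ((d + 1) * (ρ * (b α - a α)))) := by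
        gcongr
        exact D.diam_element_le hL0 hL hel fun β => hs i a b hel β α
      _ = _ := by ring

end Discretization

/-! ### The parameter cube and the patches -/

section cube

variable {d : ℕ}

lemma isOpen_cube : IsOpen (cube d) := by
  simp only [cube, ofPred_forall, ofPred_and]
  exact isOpen_iInter_of_finite fun α =>
    (isOpen_lt (by fun_prop) (by fun_prop)).inter (isOpen_lt (by fun_prop) (by fun_prop))

lemma isCompact_closedCube : IsCompact (closedCube d) := by
  refine Metric.isCompact_of_isClosed_isBounded ?_ ?_
  · simp only [closedCube, ofPred_forall, ofPred_and]
    exact isClosed_iInter fun α =>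
      (isClosed_le (by fun_prop) (by fun_prop)).inter (isClosed_le (by fun_prop) (by fun_prop))
  · exact isBounded_iff_forall_norm_le.2 ⟨(d + 1) * 1, fun x hx =>
      norm_le_card_mul fun α => abs_le.2 ⟨by linarith [(hx α).1], (hx α).2⟩⟩

lemma convex_closedCube : Convex ℝ (closedCube d) := by
  intro x hx y hy a b ha hb hab α
  simp only [PiLp.add_apply, PiLp.smul_apply, smul_eq_mul]
  constructor <;> nlinarith [hx α, hy α]

lemma cube_subset_closedCube : cube d ⊆ closedCube d := fun _ hx α => ⟨(hx α).1.le, (hx α).2.le⟩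

lemma closedCube_mem_nhds {ξ : SpaceTime d} (hξ : ξ ∈ cube d) : closedCube d ∈ 𝓝 ξ :=
  mem_of_superset (isOpen_cube.mem_nhds hξ) cube_subset_closedCube

lemma nonempty_closedCube : (closedCube d).Nonempty := ⟨0, fun α => by simp⟩

lemma uniqueDiffOn_closedCube : UniqueDiffOn ℝ (closedCube d) :=
  uniqueDiffOn_convex convex_closedCube ⟨WithLp.toLp 2 fun _ => 1 / 2,
    mem_interior_iff_mem_nhds.2 (closedCube_mem_nhds fun α => by norm_num)⟩

/-- The coordinate representation of the cube is measure preserving, also if the coordinate in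
direction `α` is measured from the face with coordinate `c`. -/
lemma lintegral_cube_eq (α : Fin (d + 1)) {c : ℝ} (hc : c = 0 ∨ c = 1) {F : SpaceTime d → ENNReal}
    (hF : AEMeasurable F (volume.restrict (cube d))) :
    ∫⁻ x in cube d, F x = ∫⁻ y in univ.pi fun _ : Fin d => Ioo (0 : ℝ) 1,
      ∫⁻ σ in Ioo (0 : ℝ) 1, F (line α y (c + (1 - 2 * c) * σ)) := by
  have h1 : MeasurePreserving (fun q : ℝ × (Fin d → ℝ) => line α q.2 q.1) :=
    (PiLp.volume_preserving_toLp (Fin (d + 1))).comp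
      (volume_preserving_piFinSuccAbove (fun _ => ℝ) α).symm
  have h2 : MeasurePreserving (fun σ : ℝ => c + (1 - 2 * c) * σ) := by
    rcases hc with rfl | rfl
    · have : (fun σ : ℝ => 0 + (1 - 2 * 0) * σ) = id := by funext σ; simp
      rw [this]; exact MeasurePreserving.id volume
    · have : (fun σ : ℝ => 1 + (1 - 2 * 1) * σ) = fun σ => 1 - σ := by funext σ; ring
      rw [this]; exact Measure.measurePreserving_sub_left volume (1 : ℝ)
  have h3 : MeasurePreserving (fun q : ℝ × (Fin d → ℝ) => line α q.2 (c + (1 - 2 * c) * q.1)) :=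
    h1.comp (h2.prod (MeasurePreserving.id volume))
  have hpre : (fun q : ℝ × (Fin d → ℝ) => line α q.2 (c + (1 - 2 * c) * q.1)) ⁻¹' cube d =
      Ioo (0 : ℝ) 1 ×ˢ univ.pi fun _ : Fin d => Ioo (0 : ℝ) 1 := by
    ext q
    simp only [mem_preimage, line_mem_cube, mem_prod, mem_univ_pi]
    refine and_congr_left fun _ => ?_
    rcases hc with rfl | rfl
    · simp
    · simp only [mem_Ioo]
      constructor <;> rintro ⟨h, h'⟩ <;> constructor <;> linarith
  have h4 := h3.restrict_preimage isOpen_cube.measurableSet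
  have hF' := hF.comp_quasiMeasurePreserving h4.quasiMeasurePreserving
  rw [hpre, Measure.volume_eq_prod, ← Measure.prod_restrict] at hF'
  rw [← h4.map_eq, lintegral_map' (by rwa [h4.map_eq]) h4.measurable.aemeasurable, hpre,
    Measure.volume_eq_prod, ← Measure.prod_restrict]
  exact lintegral_prod_symm _ hF'

end cube

/-- A Lipschitz map increases Hausdorff measure by at most a constant factor. -/
lemma lintegral_image_hausdorffMeasure_le {d : ℕ} {X : Type*} [MetricSpace X] [MeasurableSpace X]
    [BorelSpace X] {f : (Fin d → ℝ) → X} {S : Set (Fin d → ℝ)} (hS : MeasurableSet S) {K : NNReal}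
    (hf : LipschitzOnWith K f S) {F : X → ENNReal} (hF : Measurable F) :
    ∫⁻ x in f '' S, F x ∂(Measure.hausdorffMeasure d) ≤
      (K : ENNReal) ^ (d : ℝ) * ∫⁻ y in S, F (f y) := by
  have hfm : AEMeasurable f (volume.restrict S) := hf.continuousOn.aemeasurable hS
  have hvol : (Measure.hausdorffMeasure d : Measure (Fin d → ℝ)) = volume := by
    simpa using hausdorffMeasure_pi_real (ι := Fin d)
  have hle : (Measure.hausdorffMeasure d : Measure X).restrict (f '' S) ≤
      (K : ENNReal) ^ (d : ℝ) • (volume.restrict S).map f := by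
    refine Measure.le_iff.2 fun A hA => ?_
    rw [Measure.restrict_apply hA, Measure.smul_apply, Measure.map_apply_of_aemeasurable hfm hA,
      Measure.restrict_apply' hS, inter_comm, ← image_inter_preimage, inter_comm (f ⁻¹' A),
      ← hvol]
    exact (hf.mono inter_subset_left).hausdorffMeasure_image_le (Nat.cast_nonneg d)
  calc _ ≤ ∫⁻ x, F x ∂((K : ENNReal) ^ (d : ℝ) • (volume.restrict S).map f) :=
        lintegral_mono' hle le_rfl
    _ = _ := by
        rw [lintegral_smul_measure, lintegral_map' hF.aemeasurable hfm, smul_eq_mul]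

namespace MultiPatch

variable {d N : ℕ} (G : MultiPatch d N) (i : Fin N)

/-- The derivative of `Φ_i` on the closed cube. -/
noncomputable def DΦ (ξ : SpaceTime d) : SpaceTime d →L[ℝ] SpaceTime d :=
  fderivWithin ℝ (G.Φ i) (closedCube d) ξ

lemma continuousOn_DΦ : ContinuousOn (G.DΦ i) (closedCube d) :=
  (G.contDiffOn_Φ i).continuousOn_fderivWithin uniqueDiffOn_closedCube le_rfl

lemma hasStrictFDerivAt_Φ {ξ : SpaceTime d} (hξ : ξ ∈ cube d) :
    HasStrictFDerivAt (G.Φ i) (G.DΦ i ξ) ξ := by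
  have h := ((G.contDiffOn_Φ i).contDiffAt (closedCube_mem_nhds hξ)).hasStrictFDerivAt one_ne_zero
  rwa [← fderivWithin_of_mem_nhds (closedCube_mem_nhds hξ)] at h

/-- `DΦ_i` as an isomorphism. -/
noncomputable def DΦEquiv {ξ : SpaceTime d} (hξ : ξ ∈ closedCube d) :
    SpaceTime d ≃L[ℝ] SpaceTime d :=
  ContinuousLinearMap.toContinuousLinearEquivOfDetNeZero (G.DΦ i ξ) (G.regular_Φ i ξ hξ)

@[simp] lemma coe_DΦEquiv {ξ : SpaceTime d} (hξ : ξ ∈ closedCube d) :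
    (G.DΦEquiv i hξ : SpaceTime d →L[ℝ] SpaceTime d) = G.DΦ i ξ := by
  exact ContinuousLinearMap.coe_toContinuousLinearEquivOfDetNeZero _ _

lemma isOpen_patch : IsOpen (G.patch i) := by
  refine isOpen_iff_mem_nhds.2 ?_
  rintro _ ⟨ξ, hξ, rfl⟩
  have h : HasStrictFDerivAt (G.Φ i)
      (G.DΦEquiv i (cube_subset_closedCube hξ) : SpaceTime d →L[ℝ] SpaceTime d) ξ := by
    rw [coe_DΦEquiv]; exact G.hasStrictFDerivAt_Φ i hξ
  rw [← h.map_nhds_eq_of_equiv]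
  exact image_mem_map (isOpen_cube.mem_nhds hξ)

lemma isCompact_image : IsCompact (G.Φ i '' closedCube d) :=
  isCompact_closedCube.image_of_continuousOn (G.contDiffOn_Φ i).continuousOn

lemma closure_patch_subset : closure (G.patch i) ⊆ G.Φ i '' closedCube d :=
  closure_minimal (image_mono cube_subset_closedCube) (G.isCompact_image i).isClosed

lemma frontier_patch_subset : frontier (G.patch i) ⊆ G.Φ i '' (closedCube d \ cube d) := by
  rintro x hx
  rw [(G.isOpen_patch i).frontier_eq] at hx
  obtain ⟨ξ, hξ, rfl⟩ := G.closure_patch_subset i hx.1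
  exact ⟨ξ, ⟨hξ, fun h => hx.2 ⟨ξ, h, rfl⟩⟩, rfl⟩

lemma inv_Φ {ξ : SpaceTime d} (hξ : ξ ∈ closedCube d) : G.inv i (G.Φ i ξ) = ξ :=
  (G.injOn_Φ i).leftInvOn_invFunOn hξ

lemma continuousOn_inv : ContinuousOn (G.inv i) (G.Φ i '' closedCube d) := by
  rw [continuousOn_iff_isClosed]
  intro t ht
  refine ⟨G.Φ i '' (closedCube d ∩ t), ?_, ?_⟩
  · exact ((isCompact_closedCube.inter_right ht).image_of_continuousOn
      ((G.contDiffOn_Φ i).continuousOn.mono inter_subset_left)).isClosed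
  · ext x
    constructor
    · rintro ⟨hx, ξ, hξ, rfl⟩
      rw [mem_preimage, G.inv_Φ i hξ] at hx
      exact ⟨⟨ξ, ⟨hξ, hx⟩, rfl⟩, ξ, hξ, rfl⟩
    · rintro ⟨⟨ξ, ⟨hξ, hξt⟩, rfl⟩, hx⟩
      exact ⟨by rwa [mem_preimage, G.inv_Φ i hξ], hx⟩

lemma hasFDerivAt_inv {ξ : SpaceTime d} (hξ : ξ ∈ cube d) :
    HasFDerivAt (G.inv i) ((G.DΦEquiv i (cube_subset_closedCube hξ)).symm :
      SpaceTime d →L[ℝ] SpaceTime d) (G.Φ i ξ) := by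
  have hnhds : G.patch i ∈ 𝓝 (G.Φ i ξ) := (G.isOpen_patch i).mem_nhds ⟨ξ, hξ, rfl⟩
  refine HasFDerivAt.of_local_left_inverse (f := G.Φ i) ?_ ?_ ?_
  · exact (G.continuousOn_inv i).continuousAt
      (mem_of_superset hnhds (image_mono cube_subset_closedCube))
  · rw [G.inv_Φ i (cube_subset_closedCube hξ), coe_DΦEquiv]
    exact (G.hasStrictFDerivAt_Φ i hξ).hasFDerivAt
  · filter_upwards [hnhds] with y hy
    obtain ⟨η, hη, rfl⟩ := hy
    rw [G.inv_Φ i (cube_subset_closedCube hη)]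

lemma exists_norm_DΦ_le : ∃ L : ℝ, 0 ≤ L ∧ ∀ ξ ∈ closedCube d, ‖G.DΦ i ξ‖ ≤ L := by
  obtain ⟨L, hL⟩ := isCompact_closedCube.exists_bound_of_continuousOn (G.continuousOn_DΦ i)
  exact ⟨L, (norm_nonneg _).trans (hL _ nonempty_closedCube.some_mem), hL⟩

lemma norm_Φ_sub_le {L : ℝ} (hL : ∀ ξ ∈ closedCube d, ‖G.DΦ i ξ‖ ≤ L) :
    ∀ x ∈ closedCube d, ∀ y ∈ closedCube d, ‖G.Φ i x - G.Φ i y‖ ≤ L * ‖x - y‖ :=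
  fun _ hx _ hy => convex_closedCube.norm_image_sub_le_of_norm_fderivWithin_le
    ((G.contDiffOn_Φ i).differentiableOn one_ne_zero) hL hy hx

/-- By compactness, `|det DΦ_i|` is bounded from above and from below by positive constants. -/
lemma exists_det_bounds : ∃ c C : ℝ, 0 < c ∧
    ∀ ξ ∈ closedCube d, c ≤ |(G.DΦ i ξ).det| ∧ |(G.DΦ i ξ).det| ≤ C := by
  have hcont : ContinuousOn (fun ξ => |(G.DΦ i ξ).det|) (closedCube d) :=
    (ContinuousLinearMap.continuous_det.comp_continuousOn (G.continuousOn_DΦ i)).abs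
  obtain ⟨a, ha, hmin⟩ := isCompact_closedCube.exists_isMinOn nonempty_closedCube hcont
  obtain ⟨b, hb, hmax⟩ := isCompact_closedCube.exists_isMaxOn nonempty_closedCube hcont
  exact ⟨_, _, abs_pos.2 (G.regular_Φ i a ha), fun ξ hξ => ⟨hmin hξ, hmax hξ⟩⟩

/-- The transformation formula, with the Jacobian determinant bounded from below. -/
lemma lintegral_cube_comp_le {c : ℝ} (hc : 0 < c)
    (hdet : ∀ ξ ∈ closedCube d, c ≤ |(G.DΦ i ξ).det|) (F : SpaceTime d → ENNReal) :
    ∫⁻ ξ in cube d, F (G.Φ i ξ) ≤ ENNReal.ofReal c⁻¹ * ∫⁻ x in G.patch i, F x := by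
  rw [patch, lintegral_image_eq_lintegral_abs_det_fderiv_mul volume isOpen_cube.measurableSet
    (fun ξ hξ => (G.hasStrictFDerivAt_Φ i hξ).hasFDerivAt.hasFDerivWithinAt)
    ((G.injOn_Φ i).mono cube_subset_closedCube), ← lintegral_const_mul' _ _ (by simp)]
  refine setLIntegral_mono' isOpen_cube.measurableSet fun ξ hξ => ?_
  rw [← mul_assoc, ← ENNReal.ofReal_mul (by positivity)]
  refine le_mul_of_one_le_left' (ENNReal.one_le_ofReal.2 ?_)
  have := hdet ξ (cube_subset_closedCube hξ)
  rw [inv_mul_eq_div, le_div_iff₀ hc]; linarith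

/-- Pulling back by `Φ_i` preserves null sets. There is no measurability assumption on `P`. -/
lemma ae_cube_of_ae_patch {P : SpaceTime d → Prop} (h : ∀ᵐ x ∂volume.restrict (G.patch i), P x) :
    ∀ᵐ ξ ∂volume.restrict (cube d), P (G.Φ i ξ) := by
  obtain ⟨c, C, hc, hdet⟩ := G.exists_det_bounds i
  obtain ⟨B, hB, hBm, hB0⟩ := exists_measurable_superset_of_null (ae_iff.1 h)
  have h1 := G.lintegral_cube_comp_le i hc (fun ξ hξ => (hdet ξ hξ).1) (B.indicator 1)
  rw [lintegral_indicator_one hBm, hB0, mul_zero, nonpos_iff_eq_zero, lintegral_eq_zero_iff'] at h1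
  · filter_upwards [h1] with ξ hξ
    by_contra hP
    simp [indicator_of_mem (hB hP)] at hξ
  · exact ((measurable_one.indicator hBm).comp_aemeasurable
      (((G.contDiffOn_Φ i).continuousOn.mono cube_subset_closedCube).aemeasurable
        isOpen_cube.measurableSet))

lemma lipschitzOnWith_face {L : ℝ} (hL0 : 0 ≤ L) (hL : ∀ ξ ∈ closedCube d, ‖G.DΦ i ξ‖ ≤ L)
    (α : Fin (d + 1)) {c : ℝ} (hc : c ∈ Icc (0 : ℝ) 1) :
    LipschitzOnWith (L * (d + 1)).toNNReal (fun y => G.Φ i (line α y c))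
      (univ.pi fun _ => Icc 0 1) := by
  refine LipschitzOnWith.of_dist_le_mul fun y hy z hz => ?_
  rw [Real.coe_toNNReal _ (by positivity), dist_eq_norm, dist_eq_norm, mul_assoc]
  refine (G.norm_Φ_sub_le i hL _ ((line_mem_closedCube _ _ _).2 ⟨hc, fun j => hy j trivial⟩) _
    ((line_mem_closedCube _ _ _).2 ⟨hc, fun j => hz j trivial⟩)).trans ?_
  gcongr
  refine norm_le_card_mul fun β => ?_
  rcases Fin.eq_self_or_eq_succAbove α β with rfl | ⟨j, rfl⟩
  · simp
  · simpa using norm_le_pi_norm (y - z) j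

/-- The surface integral over `∂Q_i` is controlled by the integrals over the faces of the cube. -/
lemma exists_lintegral_frontier_le : ∃ C : NNReal, ∀ F : SpaceTime d → ENNReal, Measurable F →
    ∫⁻ x, F x ∂(surf (frontier (G.patch i))) ≤ C * ∑ q : Fin (d + 1) × Bool,
      ∫⁻ y in univ.pi fun _ : Fin d => Ioo (0 : ℝ) 1,
        F (G.Φ i (line q.1 y (if q.2 then 1 else 0))) := by
  obtain ⟨L, hL0, hL⟩ := G.exists_norm_DΦ_le i
  set κ := Measure.addHaarScalarFactor (volume : Measure (EuclideanSpace ℝ (Fin d)))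
    (Measure.hausdorffMeasure d) with hκ
  refine ⟨κ * (L * (d + 1)).toNNReal ^ (d : ℝ), fun F hF => ?_⟩
  let f : Fin (d + 1) × Bool → (Fin d → ℝ) → SpaceTime d := fun q y =>
    G.Φ i (line q.1 y (if q.2 then 1 else 0))
  let S : Set (Fin d → ℝ) := univ.pi fun _ => Icc 0 1
  have hS : MeasurableSet S := MeasurableSet.univ_pi fun _ => measurableSet_Icc
  have hcover : frontier (G.patch i) ⊆ ⋃ q, f q '' S := by
    intro x hx
    obtain ⟨ξ, ⟨hξ, hξ'⟩, rfl⟩ := G.frontier_patch_subset i hx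
    obtain ⟨α, hα⟩ : ∃ α, ξ α = 0 ∨ ξ α = 1 := by
      by_contra! hne
      exact hξ' fun α => ⟨lt_of_le_of_ne (hξ α).1 (hne α).1.symm,
        lt_of_le_of_ne (hξ α).2 (hne α).2⟩
    refine mem_iUnion.2 ⟨(α, decide (ξ α = 1)), fun j => ξ (α.succAbove j),
      fun j _ => hξ _, ?_⟩
    have : (if decide (ξ α = 1) = true then (1 : ℝ) else 0) = ξ α := by
      rcases hα with h | h <;> simp [h]
    simp only [f, this, line_self_succAbove]
  have hUS : volume.restrict S = volume.restrict (univ.pi fun _ : Fin d => Ioo (0 : ℝ) 1) := by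
    rw [show S = Icc (fun _ => (0 : ℝ)) fun _ => 1 from pi_univ_Icc _ _]
    exact Measure.restrict_congr_set (Measure.univ_pi_Ioo_ae_eq_Icc (μ := fun _ => volume)).symm
  calc ∫⁻ x, F x ∂(surf (frontier (G.patch i)))
      = κ * ∫⁻ x in frontier (G.patch i), F x ∂(Measure.hausdorffMeasure d) := by
        rw [surf, Measure.euclideanHausdorffMeasure_def, Measure.restrict_smul,
          lintegral_smul_measure]
        rfl
    _ ≤ κ * ∑ q, ∫⁻ x in f q '' S, F x ∂(Measure.hausdorffMeasure d) := by
        gcongr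
        refine (lintegral_mono_set hcover).trans ((lintegral_iUnion_le _ _).trans ?_)
        rw [tsum_fintype]
    _ ≤ κ * ∑ q, ((L * (d + 1)).toNNReal : ENNReal) ^ (d : ℝ) *
          ∫⁻ y in univ.pi fun _ : Fin d => Ioo (0 : ℝ) 1, F (f q y) := by
        gcongr with q
        rw [← hUS]
        exact lintegral_image_hausdorffMeasure_le hS
          (G.lipschitzOnWith_face i hL0 hL q.1 (by split_ifs <;> simp)) hF
    _ = _ := by
        rw [← Finset.mul_sum, ← mul_assoc, ENNReal.coe_mul,
          ENNReal.coe_rpow_of_nonneg _ (Nat.cast_nonneg d)]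

end MultiPatch

/-! ### Weak derivatives of mapped splines -/

section weak

variable {d : ℕ} {Ω : Set (SpaceTime d)}

lemma integrable_mul_of_locallyIntegrableOn {g φ : SpaceTime d → ℝ}
    (hg : LocallyIntegrableOn g Ω) (hφ : Continuous φ) (hc : HasCompactSupport φ)
    (hs : tsupport φ ⊆ Ω) : Integrable fun x => g x * φ x := by
  have h : IntegrableOn (fun x => g x * φ x) (tsupport φ) :=
    (hg.integrableOn_compact_subset hs hc).mul_continuousOn hφ.continuousOn hc
  refine (integrableOn_iff_integrable_of_support_subset ?_).1 h
  exact (Function.support_mul_subset_right g φ).trans (subset_tsupport φ)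

lemma setIntegral_mul_eq_integral {g φ : SpaceTime d → ℝ} (hs : tsupport φ ⊆ Ω) :
    ∫ x in Ω, g x * φ x = ∫ x, g x * φ x := by
  refine setIntegral_eq_integral_of_forall_compl_eq_zero fun x hx => ?_
  rw [image_eq_zero_of_notMem_tsupport fun h => hx (hs h), mul_zero]

lemma tsupport_fderiv_apply_subset {φ : SpaceTime d → ℝ} (e : SpaceTime d) :
    tsupport (fun x => fderiv ℝ φ x e) ⊆ tsupport φ := by
  refine closure_minimal (fun x hx => ?_) (isClosed_tsupport φ)
  refine support_fderiv_subset ℝ fun h => hx ?_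
  simp [h]

/-- Classical derivatives are weak derivatives. -/
lemma hasWeakPartial_of_differentiableAt {V : SpaceTime d → ℝ} {j : Fin (d + 1)} (hΩ : IsOpen Ω)
    (hV : ∀ x ∈ Ω, DifferentiableAt ℝ V x)
    (hc : ContinuousOn (fun x => fderiv ℝ V x (EuclideanSpace.single j 1)) Ω) :
    HasWeakPartial Ω j V fun x => fderiv ℝ V x (EuclideanSpace.single j 1) := by
  intro φ hφ hcpt hs
  have hVc : ContinuousOn V Ω := fun x hx => (hV x hx).continuousAt.continuousWithinAt
  have hs' := (tsupport_fderiv_apply_subset (φ := φ) (EuclideanSpace.single j 1)).trans hs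
  rw [setIntegral_mul_eq_integral hs, setIntegral_mul_eq_integral hs']
  refine integral_mul_fderiv_eq_neg_fderiv_mul_of_integrable
    (integrable_mul_of_locallyIntegrableOn (hc.locallyIntegrableOn hΩ.measurableSet)
      hφ.continuous hcpt hs)
    (integrable_mul_of_locallyIntegrableOn (hVc.locallyIntegrableOn hΩ.measurableSet)
      ((hφ.continuous_fderiv (by simp)).clm_apply continuous_const) (hcpt.fderiv_apply ℝ _) hs')
    (integrable_mul_of_locallyIntegrableOn (hVc.locallyIntegrableOn hΩ.measurableSet)
      hφ.continuous hcpt hs)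
    (fun x hx => hV x (hs hx)) fun x _ => hφ.differentiable (by simp) x

lemma HasWeakPartial.congr_left {u v g : SpaceTime d → ℝ} {j : Fin (d + 1)}
    (h : HasWeakPartial Ω j u g) (huv : u =ᵐ[volume.restrict Ω] v) : HasWeakPartial Ω j v g := by
  intro φ hφ hc hs
  rw [← h φ hφ hc hs]
  refine integral_congr_ae ?_
  filter_upwards [huv] with x hx
  rw [hx]

lemma HasWeakPartial.ae_eq {u f g : SpaceTime d → ℝ} {j : Fin (d + 1)} (hΩ : IsOpen Ω)
    (hf : HasWeakPartial Ω j u f) (hg : HasWeakPartial Ω j u g) (hfi : LocallyIntegrableOn f Ω)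
    (hgi : LocallyIntegrableOn g Ω) : f =ᵐ[volume.restrict Ω] g := by
  have h := hΩ.ae_eq_zero_of_integral_contDiff_smul_eq_zero (hfi.sub hgi) fun φ hφ hc hs => by
    have h1 := hf φ hφ hc hs
    rw [hg φ hφ hc hs, neg_inj, setIntegral_mul_eq_integral hs,
      setIntegral_mul_eq_integral hs] at h1
    simp only [smul_eq_mul, Pi.sub_apply, mul_comm (φ _), sub_mul]
    rw [integral_sub (integrable_mul_of_locallyIntegrableOn hfi hφ.continuous hc hs)
      (integrable_mul_of_locallyIntegrableOn hgi hφ.continuous hc hs), h1, sub_self]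
  rw [EventuallyEq, ae_restrict_iff' hΩ.measurableSet]
  filter_upwards [h] with x hx hxΩ
  exact sub_eq_zero.1 (hx hxΩ)

lemma memLp_weakPartial (Ω : Set (SpaceTime d)) (j : Fin (d + 1)) (u : SpaceTime d → ℝ) :
    MemLp (weakPartial Ω j u) 2 (volume.restrict Ω) := by
  unfold weakPartial
  split_ifs with h
  · exact h.choose_spec.1
  · exact MemLp.zero

/-- The first alternative is the junk value of `weakPartial`, which occurs if the weak derivative is
not square integrable. -/
lemma weakPartial_ae_eq {u g : SpaceTime d → ℝ} {j : Fin (d + 1)} (hΩ : IsOpen Ω)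
    (hg : HasWeakPartial Ω j u g) (hgi : LocallyIntegrableOn g Ω) :
    weakPartial Ω j u = 0 ∨ weakPartial Ω j u =ᵐ[volume.restrict Ω] g := by
  have hm := memLp_weakPartial Ω j u
  by_cases h : ∃ g, MemLp g 2 (volume.restrict Ω) ∧ HasWeakPartial Ω j u g
  · right
    have hw : HasWeakPartial Ω j u (weakPartial Ω j u) := by
      simp only [weakPartial, dif_pos h]; exact h.choose_spec.2
    exact hw.ae_eq hΩ hg
      (locallyIntegrableOn_of_locallyIntegrable_restrict (hm.locallyIntegrable (by norm_num))) hgi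
  · left
    simp only [weakPartial, dif_neg h]

end weak

section partials

variable {d : ℕ} {s : SpaceTime d → ℝ}

/-- The partial derivatives of a function that is polynomial along the lines in direction `α` are
polynomial along these lines, too: those in transversal directions are limits of difference
quotients, which are polynomials of the same degree. -/
lemma fderiv_isPolyOn (hs : ContDiffOn ℝ 1 s (cube d)) {α : Fin (d + 1)} {n : ℕ} {a b : ℝ}
    (hab : a < b) (hsub : Ioo a b ⊆ Ioo 0 1)
    (hpoly : ∀ y, IsPolyOn n (Ioo a b) fun τ => s (line α y τ)) {y : Fin d → ℝ}
    (hy : ∀ j, y j ∈ Ioo (0 : ℝ) 1) (β : Fin (d + 1)) :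
    IsPolyOn n (Ioo a b) fun τ => fderiv ℝ s (line α y τ) (EuclideanSpace.single β 1) := by
  have hd : ∀ τ ∈ Ioo a b, HasFDerivAt s (fderiv ℝ s (line α y τ)) (line α y τ) := fun τ hτ =>
    ((hs.contDiffAt (isOpen_cube.mem_nhds ((line_mem_cube _ _ _).2
      ⟨hsub hτ, hy⟩))).differentiableAt one_ne_zero).hasFDerivAt
  rcases Fin.eq_self_or_eq_succAbove α β with rfl | ⟨j, rfl⟩
  · exact (hpoly y).deriv isOpen_Ioo fun τ hτ =>
      (hd τ hτ).comp_hasDerivAt τ (hasDerivAt_line β y τ)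
  · have hlim : Tendsto (fun m : ℕ => 1 / ((m : ℝ) + 1)) atTop (𝓝[≠] 0) :=
      tendsto_nhdsWithin_iff.2 ⟨tendsto_one_div_add_atTop_nhds_zero_nat,
        Eventually.of_forall fun m => (by positivity : (1 / ((m : ℝ) + 1)) ≠ 0)⟩
    refine IsPolyOn.of_tendsto hab (F := fun m τ => (1 / ((m : ℝ) + 1))⁻¹ *
      (s (line α (Function.update y j (y j + 1 / ((m : ℝ) + 1))) τ) + -1 * s (line α y τ)))
      (Eventually.of_forall fun m => ((hpoly _).add ((hpoly y).const_mul (-1))).const_mul _) ?_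
    intro τ hτ
    have h1 := ((hd τ hτ).hasLineDerivAt (EuclideanSpace.single (α.succAbove j) 1))
    have h2 := (hasDerivAt_iff_tendsto_slope_zero.1 h1).comp hlim
    refine h2.congr fun m => ?_
    have : (1 / ((m : ℝ) + 1)) • (EuclideanSpace.single (α.succAbove j) 1 : SpaceTime d) =
        EuclideanSpace.single (α.succAbove j) (1 / ((m : ℝ) + 1)) := by
      ext γ; simp
    simp only [Function.comp_apply, zero_add, zero_smul, add_zero, smul_eq_mul, this,
      line_add_single]
    ring

end partials

lemma apply_eq_sum_single {d : ℕ} {F : Type*} [NormedAddCommGroup F] [NormedSpace ℝ F]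
    (A : SpaceTime d →L[ℝ] F) (η : SpaceTime d) :
    A η = ∑ β, η β • A (EuclideanSpace.single β 1) := by
  conv_lhs => rw [← (EuclideanSpace.basisFun (Fin (d + 1)) ℝ).sum_repr η]
  simp [map_sum]

namespace MultiPatch

variable {d N : ℕ} (G : MultiPatch d N) (i : Fin N)

lemma inverse_DΦ {ξ : SpaceTime d} (hξ : ξ ∈ closedCube d) :
    (G.DΦ i ξ).inverse = (G.DΦEquiv i hξ).symm := by
  rw [← G.coe_DΦEquiv i hξ, ContinuousLinearMap.inverse_equiv]

lemma continuousOn_inverse_DΦ : ContinuousOn (fun ξ => (G.DΦ i ξ).inverse) (closedCube d) := by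
  intro ξ hξ
  have h : ContinuousAt ContinuousLinearMap.inverse (G.DΦ i ξ) := by
    rw [← G.coe_DΦEquiv i hξ]
    exact (contDiffAt_map_inverse (n := 0) (G.DΦEquiv i hξ)).continuousAt
  exact h.comp_continuousWithinAt (G.continuousOn_DΦ i ξ hξ)

/-- The Jacobian matrix of `Φ_i`. -/
noncomputable def jacobian (ξ : SpaceTime d) : Matrix (Fin (d + 1)) (Fin (d + 1)) ℝ :=
  Matrix.of fun γ β => G.DΦ i ξ (EuclideanSpace.single β 1) γ

lemma det_jacobian (ξ : SpaceTime d) : (G.jacobian i ξ).det = (G.DΦ i ξ).det := by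
  have : G.jacobian i ξ = LinearMap.toMatrix (EuclideanSpace.basisFun (Fin (d + 1)) ℝ).toBasis
      (EuclideanSpace.basisFun (Fin (d + 1)) ℝ).toBasis (G.DΦ i ξ : SpaceTime d →ₗ[ℝ] _) := by
    ext γ β
    simp [jacobian, LinearMap.toMatrix_apply]
  rw [this, LinearMap.det_toMatrix]

/-- Cramer's rule for the columns of `(DΦ_i)⁻¹`. -/
lemma det_mul_inverse_apply {ξ : SpaceTime d} (hξ : ξ ∈ closedCube d) (k β : Fin (d + 1)) :
    (G.DΦ i ξ).det * (G.DΦ i ξ).inverse (EuclideanSpace.single k 1) β =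
      ((G.jacobian i ξ).updateCol β (Pi.single k 1)).det := by
  set η := (G.DΦ i ξ).inverse (EuclideanSpace.single k 1) with hη
  have h1 : G.DΦ i ξ η = EuclideanSpace.single k 1 := by
    rw [hη, G.inverse_DΦ i hξ]
    exact (congrArg (fun A : SpaceTime d →L[ℝ] SpaceTime d => A _) (G.coe_DΦEquiv i hξ).symm).trans
      ((G.DΦEquiv i hξ).apply_symm_apply _)
  have h2 : (G.jacobian i ξ).mulVec η.ofLp = Pi.single k 1 := by
    funext γ
    rw [apply_eq_sum_single] at h1
    have := congrArg (fun x : SpaceTime d => x γ) h1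
    simp only [WithLp.ofLp_sum, Finset.sum_apply, WithLp.ofLp_smul, Pi.smul_apply, smul_eq_mul,
      EuclideanSpace.single, PiLp.ofLp_single] at this
    rw [← this]
    simp only [Matrix.mulVec, dotProduct, jacobian, Matrix.of_apply, mul_comm]
  rw [← Matrix.cramer_apply, ← h2, Matrix.cramer_eq_adjugate_mulVec, Matrix.mulVec_mulVec,
    Matrix.adjugate_mul, Matrix.smul_mulVec, Matrix.one_mulVec, det_jacobian]
  rfl

end MultiPatch

namespace Discretization

variable {d N : ℕ} {G : MultiPatch d N} {p : Fin N → Fin (d + 1) → ℕ} (D : Discretization G p)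
  {i : Fin N}

lemma contDiffOn_of_mem_splineSpace {s : SpaceTime d → ℝ} (hs : s ∈ D.splineSpace i) :
    ContDiffOn ℝ 1 s (cube d) := by
  induction hs using Submodule.span_induction with
  | mem _ hx => obtain ⟨k, rfl⟩ := hx; exact D.smooth i k
  | zero => exact contDiffOn_const
  | add f g _ _ hf hg => exact hf.add hg
  | smul c f _ hf => exact hf.const_smul c

variable {D}

lemma fderiv_spline_isPolyOn {s : SpaceTime d → ℝ} (hs : s ∈ D.splineSpace i) {α : Fin (d + 1)}
    {a b : ℝ} (hab : a < b) (hfree : D.IsKnotFree i α a b) {y : Fin d → ℝ}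
    (hy : ∀ j, y j ∈ Ioo (0 : ℝ) 1) (β : Fin (d + 1)) :
    IsPolyOn (p i α) (Ioo a b) fun τ =>
      fderiv ℝ s (line α y τ) (EuclideanSpace.single β 1) :=
  fderiv_isPolyOn (D.contDiffOn_of_mem_splineSpace hs) hab hfree.1
    (fun y => isPolyOn_of_mem_span hfree.2 y hs) hy β

/-- As `Φ_i` is represented by splines, its Jacobian matrix is polynomial between the knots, along
lines in coordinate directions. -/
lemma jacobian_isPolyOn {α : Fin (d + 1)} {a b : ℝ} (hab : a < b) (hfree : D.IsKnotFree i α a b)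
    {y : Fin d → ℝ} (hy : ∀ j, y j ∈ Ioo (0 : ℝ) 1) (γ β : Fin (d + 1)) :
    IsPolyOn (p i α) (Ioo a b) fun τ => G.jacobian i (line α y τ) γ β := by
  obtain ⟨C, hC⟩ := D.repr_Φ i
  let s : SpaceTime d → ℝ := ∑ k, C k γ • tensorBSpline (D.knots i) k
  have hs : s ∈ D.splineSpace i :=
    Submodule.sum_mem _ fun k _ => Submodule.smul_mem _ _ (Submodule.subset_span ⟨k, rfl⟩)
  refine (fderiv_spline_isPolyOn hs hab hfree hy β).congr fun τ hτ => ?_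
  have hmem : line α y τ ∈ cube d := (line_mem_cube _ _ _).2 ⟨hfree.1 hτ, hy⟩
  have h1 : HasFDerivAt (fun ξ => G.Φ i ξ γ)
      ((EuclideanSpace.proj γ : SpaceTime d →L[ℝ] ℝ) ∘L G.DΦ i (line α y τ)) (line α y τ) :=
    (EuclideanSpace.proj γ : SpaceTime d →L[ℝ] ℝ).hasFDerivAt.comp _
      (G.hasStrictFDerivAt_Φ i hmem).hasFDerivAt
  have h2 : s =ᶠ[𝓝 (line α y τ)] fun ξ => G.Φ i ξ γ := by
    filter_upwards [isOpen_cube.mem_nhds hmem] with ξ hξ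
    simp [s, hC ξ hξ, mul_comm]
  rw [(h1.congr_of_eventuallyEq h2).fderiv]
  rfl

lemma det_isPolyOn {α : Fin (d + 1)} {a b : ℝ} (hab : a < b) (hfree : D.IsKnotFree i α a b)
    {y : Fin d → ℝ} (hy : ∀ j, y j ∈ Ioo (0 : ℝ) 1) :
    IsPolyOn ((d + 1) * p i α) (Ioo a b) fun τ => (G.DΦ i (line α y τ)).det := by
  simp only [← G.det_jacobian]
  exact IsPolyOn.det fun γ β => jacobian_isPolyOn hab hfree hy γ β

/-- On the cube, `∂_k (s ∘ Φ_i⁻¹) ∘ Φ_i` is `∇s · (DΦ_i)⁻¹ e_k`. -/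
noncomputable def pullbackPartial (G : MultiPatch d N) (i : Fin N) (s : SpaceTime d → ℝ)
    (k : Fin (d + 1)) (ξ : SpaceTime d) : ℝ :=
  fderiv ℝ s ξ ((G.DΦ i ξ).inverse (EuclideanSpace.single k 1))

lemma continuousOn_pullbackPartial {s : SpaceTime d → ℝ} (hs : s ∈ D.splineSpace i)
    (k : Fin (d + 1)) : ContinuousOn (pullbackPartial G i s k) (cube d) :=
  ((D.contDiffOn_of_mem_splineSpace hs).continuousOn_fderiv_of_isOpen isOpen_cube le_rfl).clm_apply
    (((G.continuousOn_inverse_DΦ i).mono cube_subset_closedCube).clm_apply continuousOn_const)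

/-- By Cramer's rule, multiplication by `det DΦ_i` turns the partial derivatives of mapped splines,
which are rational, into polynomials. -/
lemma det_mul_pullbackPartial_isPolyOn {s : SpaceTime d → ℝ} (hs : s ∈ D.splineSpace i)
    (k : Fin (d + 1)) {α : Fin (d + 1)} {a b : ℝ} (hab : a < b) (hfree : D.IsKnotFree i α a b)
    {y : Fin d → ℝ} (hy : ∀ j, y j ∈ Ioo (0 : ℝ) 1) :
    IsPolyOn ((d + 1) * p i α + p i α) (Ioo a b) fun τ =>
      (G.DΦ i (line α y τ)).det * pullbackPartial G i s k (line α y τ) := by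
  have h := IsPolyOn.sum (Finset.univ : Finset (Fin (d + 1)))
    (F := fun β τ => ((G.jacobian i (line α y τ)).updateCol β (Pi.single k 1)).det *
      fderiv ℝ s (line α y τ) (EuclideanSpace.single β 1)) (fun β _ =>
      (IsPolyOn.det (n := p i α) fun γ δ => ?_).mul (fderiv_spline_isPolyOn hs hab hfree hy β))
  · refine h.congr fun τ hτ => ?_
    have hmem : line α y τ ∈ closedCube d :=
      cube_subset_closedCube ((line_mem_cube _ _ _).2 ⟨hfree.1 hτ, hy⟩)
    simp only [← G.det_mul_inverse_apply i hmem]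
    rw [pullbackPartial, apply_eq_sum_single, Finset.mul_sum]
    simp only [smul_eq_mul, mul_assoc]
  · simp only [Matrix.updateCol_apply]
    split_ifs
    · exact IsPolyOn.const _ _ _
    · exact jacobian_isPolyOn hab hfree hy γ δ

/-- The weak partial derivatives of mapped splines are the classical ones, if they are square
integrable, and zero by definition otherwise. -/
lemma weakPartial_comp_Φ {s v : SpaceTime d → ℝ} (hs : s ∈ D.splineSpace i)
    (hv : v =ᵐ[volume.restrict (G.patch i)] s ∘ G.inv i) (k : Fin (d + 1)) :
    weakPartial (G.patch i) k v = 0 ∨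
      ∀ᵐ ξ ∂volume.restrict (cube d),
        weakPartial (G.patch i) k v (G.Φ i ξ) = pullbackPartial G i s k ξ := by
  have hder : ∀ ξ ∈ cube d, HasFDerivAt (s ∘ G.inv i)
      (fderiv ℝ s ξ ∘L (G.DΦ i ξ).inverse) (G.Φ i ξ) := by
    intro ξ hξ
    have h1 : HasFDerivAt s (fderiv ℝ s ξ) (G.inv i (G.Φ i ξ)) := by
      rw [G.inv_Φ i (cube_subset_closedCube hξ)]
      exact (((D.contDiffOn_of_mem_splineSpace hs).contDiffAt
        (isOpen_cube.mem_nhds hξ)).differentiableAt one_ne_zero).hasFDerivAt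
    rw [G.inverse_DΦ i (cube_subset_closedCube hξ)]
    exact h1.comp _ (G.hasFDerivAt_inv i hξ)
  have heq : ∀ x ∈ G.patch i, fderiv ℝ (s ∘ G.inv i) x (EuclideanSpace.single k 1) =
      pullbackPartial G i s k (G.inv i x) := by
    rintro _ ⟨ξ, hξ, rfl⟩
    rw [(hder ξ hξ).fderiv, G.inv_Φ i (cube_subset_closedCube hξ)]; rfl
  have hcont : ContinuousOn
      (fun x => fderiv ℝ (s ∘ G.inv i) x (EuclideanSpace.single k 1)) (G.patch i) := by
    refine ContinuousOn.congr ?_ heq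
    refine (continuousOn_pullbackPartial hs k).comp
      ((G.continuousOn_inv i).mono (image_mono cube_subset_closedCube)) ?_
    rintro _ ⟨ξ, hξ, rfl⟩
    rwa [G.inv_Φ i (cube_subset_closedCube hξ)]
  have hweak := (hasWeakPartial_of_differentiableAt (G.isOpen_patch i) (by
    rintro _ ⟨ξ, hξ, rfl⟩; exact (hder ξ hξ).differentiableAt) hcont).congr_left hv.symm
  refine (weakPartial_ae_eq (G.isOpen_patch i) hweak
    (hcont.locallyIntegrableOn (G.isOpen_patch i).measurableSet)).imp_right fun h => ?_
  filter_upwards [G.ae_cube_of_ae_patch i h, ae_restrict_mem isOpen_cube.measurableSet] with ξ h1 hξ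
  rw [h1, heq _ ⟨ξ, hξ, rfl⟩, G.inv_Φ i (cube_subset_closedCube hξ)]

end Discretization

/-! ### Boundary values near functions with an inverse inequality on lines -/

/-- The inverse inequality for quotients `W` of a polynomial by a function that is bounded from
above and from below. -/
lemma exists_enorm_sq_le_of_mul_isPolyOn (n : ℕ) {c₀ C₀ : ℝ} (hc₀ : 0 < c₀) :
    ∃ K : ℝ, 0 < K ∧ ∀ ℓ > 0, ∀ J W : ℝ → ℝ, IsPolyOn n (Ioo 0 ℓ) (fun σ => J σ * W σ) →
      (∀ σ ∈ Ioo 0 ℓ, c₀ ≤ |J σ| ∧ |J σ| ≤ C₀) → ∀ σ ∈ Ioo 0 ℓ,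
        ‖W σ‖ₑ ^ 2 ≤ ENNReal.ofReal (K / ℓ) * ∫⁻ t in Ioo 0 ℓ, ‖W t‖ₑ ^ 2 := by
  obtain ⟨C, hC, hpoly⟩ := exists_sq_eval_le_integral n
  refine ⟨C * (C₀ ^ 2 + 1) / c₀ ^ 2, by positivity, fun ℓ hℓ J W ⟨q, hq, hqe⟩ hJ σ hσ => ?_⟩
  have hint : ENNReal.ofReal (∫ t in (0 : ℝ)..ℓ, q.eval t ^ 2) ≤
      ENNReal.ofReal (C₀ ^ 2 + 1) * ∫⁻ t in Ioo 0 ℓ, ‖W t‖ₑ ^ 2 := by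
    rw [intervalIntegral.integral_of_le hℓ.le, integral_Ioc_eq_integral_Ioo,
      ofReal_integral_eq_lintegral_ofReal, ← lintegral_const_mul' _ _ (by simp)]
    · refine setLIntegral_mono' measurableSet_Ioo fun t ht => ?_
      rw [enorm_sq_eq_ofReal, ← ENNReal.ofReal_mul (by positivity), ← hqe t ht, mul_pow]
      refine ENNReal.ofReal_le_ofReal ?_
      gcongr
      rw [← sq_abs]
      have := pow_le_pow_left₀ (abs_nonneg _) (hJ t ht).2 2
      linarith
    · exact ((q.continuous.pow 2).continuousOn.integrableOn_compact isCompact_Icc).mono_set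
        Ioo_subset_Icc_self
    · exact Eventually.of_forall fun t => sq_nonneg _
  calc ‖W σ‖ₑ ^ 2 ≤ ENNReal.ofReal ((c₀ ^ 2)⁻¹ * (C / ℓ) * ∫ t in (0 : ℝ)..ℓ, q.eval t ^ 2) := by
        rw [enorm_sq_eq_ofReal]
        refine ENNReal.ofReal_le_ofReal ?_
        have h1 := hpoly q hq ℓ hℓ σ hσ
        rw [← hqe σ hσ, mul_pow] at h1
        have h2 : c₀ ^ 2 ≤ J σ ^ 2 := by
          rw [← sq_abs (J σ)]; exact pow_le_pow_left₀ hc₀.le (hJ σ hσ).1 2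
        rw [mul_assoc, inv_mul_eq_div, le_div_iff₀ (by positivity)]
        nlinarith [sq_nonneg (W σ)]
    _ = ENNReal.ofReal ((c₀ ^ 2)⁻¹ * (C / ℓ)) *
          ENNReal.ofReal (∫ t in (0 : ℝ)..ℓ, q.eval t ^ 2) :=
        ENNReal.ofReal_mul (by positivity)
    _ ≤ ENNReal.ofReal ((c₀ ^ 2)⁻¹ * (C / ℓ)) *
          (ENNReal.ofReal (C₀ ^ 2 + 1) * ∫⁻ t in Ioo 0 ℓ, ‖W t‖ₑ ^ 2) := by gcongr
    _ = _ := by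
        rw [← mul_assoc, ← ENNReal.ofReal_mul (by positivity)]
        congr 2
        field_simp

/-- The estimate of the boundary value of `g` by `g'` and by a function `W` that is close to `g`
and satisfies an inverse inequality near the boundary. -/
lemma boundary_value_le {g g' W : ℝ → ℝ} (hg : ContinuousOn g (Icc 0 1))
    (hd : ∀ σ ∈ Ioo (0 : ℝ) 1, HasDerivAt g (g' σ) σ) (hg' : ContinuousOn g' (Icc 0 1))
    {ℓ ε κ : ℝ} (hℓ1 : ℓ ≤ 1) (hεℓ : ε ≤ ℓ)
    (hW : ∀ σ ∈ Ioo 0 ℓ, ‖W σ‖ₑ ^ 2 ≤ ENNReal.ofReal κ * ∫⁻ t in Ioo 0 ℓ, ‖W t‖ₑ ^ 2) :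
    ENNReal.ofReal ε * ‖g 0‖ₑ ^ 2 ≤ ∫⁻ σ in Ioo (0 : ℝ) 1,
      (2 * ENNReal.ofReal ε ^ 2 * ‖g' σ‖ₑ ^ 2 + (4 * ‖g σ - W σ‖ₑ ^ 2 +
        4 * (ENNReal.ofReal ε * ENNReal.ofReal κ) * ‖W σ‖ₑ ^ 2)) := by
  have h0 := trace_inequality_interval hg hd hg' (hεℓ.trans hℓ1)
  have h1 : ∫⁻ σ in Ioo 0 ε, ‖g σ‖ₑ ^ 2 ≤ 2 * (∫⁻ σ in Ioo 0 1, ‖g σ - W σ‖ₑ ^ 2) +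
      2 * (ENNReal.ofReal ε * ENNReal.ofReal κ) * ∫⁻ σ in Ioo 0 1, ‖W σ‖ₑ ^ 2 := by
    have hpt : ∀ σ ∈ Ioo 0 ε, ‖g σ‖ₑ ^ 2 ≤ 2 * ‖g σ - W σ‖ₑ ^ 2 +
        2 * (ENNReal.ofReal κ * ∫⁻ t in Ioo 0 1, ‖W t‖ₑ ^ 2) := fun σ hσ => by
      refine (enorm_sq_le_two_mul _ (W σ)).trans ?_
      gcongr
      refine (hW σ ⟨hσ.1, hσ.2.trans_le hεℓ⟩).trans ?_
      gcongr
    calc _ ≤ ∫⁻ σ in Ioo 0 ε, (2 * ‖g σ - W σ‖ₑ ^ 2 +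
          2 * (ENNReal.ofReal κ * ∫⁻ t in Ioo 0 1, ‖W t‖ₑ ^ 2)) :=
          setLIntegral_mono' measurableSet_Ioo hpt
      _ = 2 * (∫⁻ σ in Ioo 0 ε, ‖g σ - W σ‖ₑ ^ 2) +
          2 * (ENNReal.ofReal κ * ∫⁻ t in Ioo 0 1, ‖W t‖ₑ ^ 2) * ENNReal.ofReal ε := by
          rw [lintegral_add_right _ measurable_const, lintegral_const_mul' _ _ (by norm_num)]
          simp
      _ ≤ 2 * (∫⁻ σ in Ioo 0 1, ‖g σ - W σ‖ₑ ^ 2) +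
          2 * (ENNReal.ofReal κ * ∫⁻ t in Ioo 0 1, ‖W t‖ₑ ^ 2) * ENNReal.ofReal ε := by
          gcongr
          exact hεℓ.trans hℓ1
      _ = _ := by ring
  calc _ ≤ 2 * ENNReal.ofReal ε ^ 2 * (∫⁻ σ in Ioo 0 1, ‖g' σ‖ₑ ^ 2) +
        2 * (2 * (∫⁻ σ in Ioo 0 1, ‖g σ - W σ‖ₑ ^ 2) +
          2 * (ENNReal.ofReal ε * ENNReal.ofReal κ) * ∫⁻ σ in Ioo 0 1, ‖W σ‖ₑ ^ 2) :=
        h0.trans (by gcongr)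
    _ = (∫⁻ σ in Ioo 0 1, 2 * ENNReal.ofReal ε ^ 2 * ‖g' σ‖ₑ ^ 2) +
        ((∫⁻ σ in Ioo 0 1, 4 * ‖g σ - W σ‖ₑ ^ 2) +
          ∫⁻ σ in Ioo 0 1, 4 * (ENNReal.ofReal ε * ENNReal.ofReal κ) * ‖W σ‖ₑ ^ 2) := by
        rw [lintegral_const_mul' _ _ (by finiteness), lintegral_const_mul' _ _ (by norm_num),
          lintegral_const_mul' _ _ (by finiteness)]
        ring
    _ ≤ _ := (add_le_add le_rfl (le_lintegral_add _ _)).trans (le_lintegral_add _ _)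

namespace MultiPatch

variable {d N : ℕ} (G : MultiPatch d N) (i : Fin N)

/-- `W` satisfies the inverse inequality with constant `κ` along the coordinate lines that start at
a face of the cube, up to a distance `r ∈ [ℓ, 1]` from this face; `r` depends on the face only. The
face is given by the direction `α` of the lines and by the coordinate `c ∈ {0, 1}` of its points. -/
def HasLineInverse (W : SpaceTime d → ℝ) (ℓ κ : ℝ) : Prop :=
  ∀ (α : Fin (d + 1)) (c : ℝ), c = 0 ∨ c = 1 → ∃ r, ℓ ≤ r ∧ r ≤ 1 ∧
    ∀ y : Fin d → ℝ, (∀ j, y j ∈ Ioo (0 : ℝ) 1) → ∀ σ ∈ Ioo 0 r,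
      ‖W (line α y (c + (1 - 2 * c) * σ))‖ₑ ^ 2 ≤ ENNReal.ofReal κ *
        ∫⁻ t in Ioo 0 r, ‖W (line α y (c + (1 - 2 * c) * t))‖ₑ ^ 2

/-- The bound for the values of a smooth function `φ` on the image of a face of the cube, by
integrating `boundary_value_le` over the lines that start there. -/
lemma lintegral_face_le {L c₀ : ℝ} (hc₀ : 0 < c₀)
    (hL : ∀ ξ ∈ closedCube d, ‖G.DΦ i ξ‖ ≤ L) (hdet : ∀ ξ ∈ closedCube d, c₀ ≤ |(G.DΦ i ξ).det|)
    {φ w W : SpaceTime d → ℝ} (hφ : ContDiff ℝ 1 φ) (hW : ContinuousOn W (cube d))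
    (hw : AEMeasurable w (volume.restrict (G.patch i)))
    (hwW : ∀ᵐ ξ ∂volume.restrict (cube d), w (G.Φ i ξ) = W ξ) {ℓ κ ε : ℝ}
    (hlow : HasLineInverse W ℓ κ) (hεℓ : ε ≤ ℓ) (α : Fin (d + 1)) {c : ℝ} (hc : c = 0 ∨ c = 1) :
    ENNReal.ofReal ε * ∫⁻ y in univ.pi fun _ : Fin d => Ioo (0 : ℝ) 1,
        ‖φ (G.Φ i (line α y c))‖ₑ ^ 2 ≤
      ENNReal.ofReal c₀⁻¹ * ENNReal.ofReal (2 * L ^ 2 + 4) *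
        (ENNReal.ofReal ε ^ 2 * (∫⁻ x in G.patch i, ‖fderiv ℝ φ x‖ₑ ^ 2) +
        ((∫⁻ x in G.patch i, ‖φ x - w x‖ₑ ^ 2) +
          ENNReal.ofReal ε * ENNReal.ofReal κ * ∫⁻ x in G.patch i, ‖w x‖ₑ ^ 2)) := by
  obtain ⟨r, hℓr, hr1, hline⟩ := hlow α c hc
  have hcm : ∀ σ ∈ Icc (0 : ℝ) 1, c + (1 - 2 * c) * σ ∈ Icc (0 : ℝ) 1 := by
    rintro σ ⟨h0, h1⟩; rcases hc with rfl | rfl <;> constructor <;> linarith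
  have hcm' : ∀ σ ∈ Ioo (0 : ℝ) 1, c + (1 - 2 * c) * σ ∈ Ioo (0 : ℝ) 1 := by
    rintro σ ⟨h0, h1⟩; rcases hc with rfl | rfl <;> constructor <;> linarith
  have hΦc := (G.contDiffOn_Φ i).continuousOn
  let f' : SpaceTime d → ℝ := fun ξ => fderiv ℝ φ (G.Φ i ξ) (G.DΦ i ξ (EuclideanSpace.single α 1))
  have hf'c : ContinuousOn f' (closedCube d) :=
    ((hφ.continuous_fderiv one_ne_zero).comp_continuousOn hΦc).clm_apply
      ((G.continuousOn_DΦ i).clm_apply continuousOn_const)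
  have hfc : ContinuousOn (fun ξ => φ (G.Φ i ξ)) (closedCube d) :=
    hφ.continuous.comp_continuousOn hΦc
  let F : SpaceTime d → ENNReal := fun ξ => 2 * ENNReal.ofReal ε ^ 2 * ‖f' ξ‖ₑ ^ 2 +
    (4 * ‖φ (G.Φ i ξ) - W ξ‖ₑ ^ 2 + 4 * (ENNReal.ofReal ε * ENNReal.ofReal κ) * ‖W ξ‖ₑ ^ 2)
  have hm : ∀ {f : SpaceTime d → ℝ}, ContinuousOn f (cube d) →
      AEMeasurable (fun ξ => ‖f ξ‖ₑ ^ 2) (volume.restrict (cube d)) := fun hf =>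
    ((hf.aemeasurable isOpen_cube.measurableSet).enorm).pow_const 2
  have hm1 := hm (hf'c.mono cube_subset_closedCube)
  have hm2 := hm ((hfc.mono cube_subset_closedCube).sub hW)
  have hm3 := hm hW
  have hptw : ∀ y ∈ univ.pi fun _ : Fin d => Ioo (0 : ℝ) 1,
      ENNReal.ofReal ε * ‖φ (G.Φ i (line α y c))‖ₑ ^ 2 ≤
        ∫⁻ σ in Ioo (0 : ℝ) 1, F (line α y (c + (1 - 2 * c) * σ)) := by
    intro y hy
    replace hy : ∀ j, y j ∈ Ioo (0 : ℝ) 1 := fun j => hy j trivial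
    have hmem : ∀ σ ∈ Icc (0 : ℝ) 1, line α y (c + (1 - 2 * c) * σ) ∈ closedCube d := fun σ hσ =>
      (line_mem_closedCube _ _ _).2 ⟨hcm σ hσ, fun j => Ioo_subset_Icc_self (hy j)⟩
    have hlc : Continuous fun σ => line α y (c + (1 - 2 * c) * σ) :=
      (continuous_line α).comp (by fun_prop : Continuous fun σ : ℝ => (c + (1 - 2 * c) * σ, y))
    have h := boundary_value_le (g := fun σ => φ (G.Φ i (line α y (c + (1 - 2 * c) * σ))))
      (g' := fun σ => (1 - 2 * c) * f' (line α y (c + (1 - 2 * c) * σ)))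
      (W := fun σ => W (line α y (c + (1 - 2 * c) * σ)))
      (hfc.comp hlc.continuousOn hmem) ?_
      (continuousOn_const.mul (hf'c.comp hlc.continuousOn hmem)) hr1 (hεℓ.trans hℓr) (hline y hy)
    · have hc2 : ‖1 - 2 * c‖ₑ = 1 := by
        rcases hc with rfl | rfl
        · simp
        · rw [show (1 : ℝ) - 2 * 1 = -1 by norm_num]; simp
      simpa only [mul_zero, add_zero, enorm_mul, hc2, one_mul] using h
    · intro σ hσ
      have hξ : line α y (c + (1 - 2 * c) * σ) ∈ cube d := (line_mem_cube _ _ _).2 ⟨hcm' σ hσ, hy⟩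
      have h1 := ((hφ.differentiable one_ne_zero _).hasFDerivAt.comp _
        (G.hasStrictFDerivAt_Φ i hξ).hasFDerivAt).comp_hasDerivAt_of_eq σ
        ((hasDerivAt_line α y (c + (1 - 2 * c) * σ)).scomp σ
          (((hasDerivAt_id' σ).const_mul (1 - 2 * c)).const_add c)) rfl
      exact h1.congr_deriv (by simp [f'])
  calc _ = ∫⁻ y in univ.pi fun _ : Fin d => Ioo (0 : ℝ) 1,
        ENNReal.ofReal ε * ‖φ (G.Φ i (line α y c))‖ₑ ^ 2 :=
        (lintegral_const_mul' _ _ (by simp)).symm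
    _ ≤ _ := setLIntegral_mono' (MeasurableSet.univ_pi fun _ => measurableSet_Ioo) hptw
    _ = ∫⁻ ξ in cube d, F ξ := (lintegral_cube_eq α hc
        ((hm1.const_mul _).add ((hm2.const_mul _).add (hm3.const_mul _)))).symm
    _ ≤ ∫⁻ ξ in cube d, ENNReal.ofReal (2 * L ^ 2 + 4) * (ENNReal.ofReal ε ^ 2 *
          ‖fderiv ℝ φ (G.Φ i ξ)‖ₑ ^ 2 + (‖φ (G.Φ i ξ) - w (G.Φ i ξ)‖ₑ ^ 2 +
          ENNReal.ofReal ε * ENNReal.ofReal κ * ‖w (G.Φ i ξ)‖ₑ ^ 2)) := by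
        refine lintegral_mono_ae ?_
        filter_upwards [hwW, ae_restrict_mem isOpen_cube.measurableSet] with ξ hξ hmem
        have h4 : (4 : ENNReal) ≤ ENNReal.ofReal (2 * L ^ 2 + 4) := by
          rw [← ENNReal.ofReal_ofNat]
          exact ENNReal.ofReal_le_ofReal (by nlinarith [sq_nonneg L])
        have h1 : 2 * ‖f' ξ‖ₑ ^ 2 ≤
            ENNReal.ofReal (2 * L ^ 2 + 4) * ‖fderiv ℝ φ (G.Φ i ξ)‖ₑ ^ 2 := by
          have h2 : ‖f' ξ‖ ≤ ‖fderiv ℝ φ (G.Φ i ξ)‖ * L := by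
            refine (ContinuousLinearMap.le_opNorm _ _).trans ?_
            gcongr
            refine (ContinuousLinearMap.le_opNorm _ _).trans ?_
            simpa using hL ξ (cube_subset_closedCube hmem)
          have h5 : 2 * ENNReal.ofReal (‖f' ξ‖ ^ 2) = ENNReal.ofReal (2 * ‖f' ξ‖ ^ 2) := by
            rw [ENNReal.ofReal_mul zero_le_two, ENNReal.ofReal_ofNat]
          rw [← ofReal_norm, ← ofReal_norm, ← ENNReal.ofReal_pow (norm_nonneg _),
            ← ENNReal.ofReal_pow (norm_nonneg _), ← ENNReal.ofReal_mul (by positivity), h5]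
          refine ENNReal.ofReal_le_ofReal ?_
          have h3 := pow_le_pow_left₀ (norm_nonneg _) h2 2
          rw [mul_pow] at h3
          nlinarith [sq_nonneg ‖fderiv ℝ φ (G.Φ i ξ)‖]
        simp only [F, hξ]
        rw [mul_add, mul_add]
        refine add_le_add ?_ (add_le_add (by gcongr) ?_)
        · calc _ = ENNReal.ofReal ε ^ 2 * (2 * ‖f' ξ‖ₑ ^ 2) := by ring
            _ ≤ ENNReal.ofReal ε ^ 2 * (ENNReal.ofReal (2 * L ^ 2 + 4) *
                ‖fderiv ℝ φ (G.Φ i ξ)‖ₑ ^ 2) := by gcongr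
            _ = _ := by ring
        · rw [mul_assoc]; gcongr
    _ ≤ ENNReal.ofReal c₀⁻¹ * ∫⁻ x in G.patch i, ENNReal.ofReal (2 * L ^ 2 + 4) *
          (ENNReal.ofReal ε ^ 2 * ‖fderiv ℝ φ x‖ₑ ^ 2 + (‖φ x - w x‖ₑ ^ 2 +
          ENNReal.ofReal ε * ENNReal.ofReal κ * ‖w x‖ₑ ^ 2)) :=
        G.lintegral_cube_comp_le i hc₀ hdet _
    _ = _ := by
        have hmφ : Measurable fun x => ENNReal.ofReal ε ^ 2 * ‖fderiv ℝ φ x‖ₑ ^ 2 :=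
          ((hφ.continuous_fderiv one_ne_zero).measurable.enorm.pow_const 2).const_mul _
        rw [lintegral_const_mul' _ _ (by simp), lintegral_add_left hmφ,
          lintegral_add_right' _ ((hw.enorm.pow_const 2).const_mul _),
          lintegral_const_mul' _ _ (by finiteness), lintegral_const_mul' _ _ (by finiteness)]
        ring

end MultiPatch

/-! ### From smooth functions to traces -/

lemma eLpNorm_two_sq {α V : Type*} [MeasurableSpace α] [NormedAddCommGroup V] (f : α → V)
    (μ : Measure α) : eLpNorm f 2 μ ^ 2 = ∫⁻ x, ‖f x‖ₑ ^ 2 ∂μ := by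
  have := eLpNorm_nnreal_pow_eq_lintegral (f := f) (μ := μ) (p := 2) two_ne_zero
  simpa using this

lemma eLpNorm_fderiv_le {d : ℕ} {φ : SpaceTime d → ℝ} (hφ : ContDiff ℝ 1 φ)
    (μ : Measure (SpaceTime d)) : eLpNorm (fderiv ℝ φ) 2 μ ≤
      ∑ j, eLpNorm (fun x => fderiv ℝ φ x (EuclideanSpace.single j 1)) 2 μ := by
  have hm : ∀ j, AEStronglyMeasurable (fun x => fderiv ℝ φ x (EuclideanSpace.single j 1)) μ :=
    fun j => ((hφ.continuous_fderiv one_ne_zero).clm_apply continuous_const).aestronglyMeasurable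
  refine le_trans (eLpNorm_mono_real (g := ∑ j, fun x => ‖fderiv ℝ φ x (EuclideanSpace.single j 1)‖)
    fun x => ?_) ((eLpNorm_sum_le (fun j _ => (hm j).norm) (by norm_num)).trans_eq
      (Finset.sum_congr rfl fun j _ => eLpNorm_norm _))
  refine ContinuousLinearMap.opNorm_le_bound _ (by simp [Finset.sum_nonneg]) fun η => ?_
  rw [apply_eq_sum_single, Finset.sum_apply, Finset.sum_mul]
  refine (norm_sum_le _ _).trans (Finset.sum_le_sum fun j _ => ?_)
  rw [norm_smul, mul_comm]
  gcongr
  exact PiLp.norm_apply_le η j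

namespace MultiPatch

variable {d N : ℕ} (G : MultiPatch d N) (i : Fin N)

/-- The trace inequality for smooth functions `φ` near a function `w` whose pullback to the cube
satisfies an inverse inequality on lines. -/
lemma exists_eLpNorm_frontier_le : ∃ C : NNReal, ∀ φ w W : SpaceTime d → ℝ, ContDiff ℝ 1 φ →
    ContinuousOn W (cube d) → AEMeasurable w (volume.restrict (G.patch i)) →
    (∀ᵐ ξ ∂volume.restrict (cube d), w (G.Φ i ξ) = W ξ) → ∀ ℓ κ ε : ℝ, HasLineInverse W ℓ κ →
    0 < ε → ε ≤ ℓ → ENNReal.ofReal ε * eLpNorm φ 2 (surf (frontier (G.patch i))) ^ 2 ≤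
      C * (ENNReal.ofReal ε ^ 2 * eLpNorm (fderiv ℝ φ) 2 (volume.restrict (G.patch i)) ^ 2 +
        (eLpNorm (fun x => φ x - w x) 2 (volume.restrict (G.patch i)) ^ 2 +
          ENNReal.ofReal ε * ENNReal.ofReal κ *
            eLpNorm w 2 (volume.restrict (G.patch i)) ^ 2)) := by
  obtain ⟨L, -, hL⟩ := G.exists_norm_DΦ_le i
  obtain ⟨c₀, _, hc₀, hdet⟩ := G.exists_det_bounds i
  obtain ⟨C, hC⟩ := G.exists_lintegral_frontier_le i
  refine ⟨C * (Fintype.card (Fin (d + 1) × Bool) * (c₀⁻¹.toNNReal * (2 * L ^ 2 + 4).toNNReal)),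
    fun φ w W hφ hW hw hwW ℓ κ ε hlow hε hεℓ => ?_⟩
  simp only [eLpNorm_two_sq]
  calc _ ≤ ENNReal.ofReal ε * (C * ∑ q : Fin (d + 1) × Bool,
        ∫⁻ y in univ.pi fun _ : Fin d => Ioo (0 : ℝ) 1,
          ‖φ (G.Φ i (line q.1 y (if q.2 then 1 else 0)))‖ₑ ^ 2) := by
        gcongr
        exact hC _ (hφ.continuous.measurable.enorm.pow_const 2)
    _ = C * ∑ q : Fin (d + 1) × Bool, (ENNReal.ofReal ε *
        ∫⁻ y in univ.pi fun _ : Fin d => Ioo (0 : ℝ) 1,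
          ‖φ (G.Φ i (line q.1 y (if q.2 then 1 else 0)))‖ₑ ^ 2) := by
        rw [← Finset.mul_sum]; ring
    _ ≤ C * ∑ _q : Fin (d + 1) × Bool, (ENNReal.ofReal c₀⁻¹ * ENNReal.ofReal (2 * L ^ 2 + 4) *
        (ENNReal.ofReal ε ^ 2 * (∫⁻ x in G.patch i, ‖fderiv ℝ φ x‖ₑ ^ 2) +
        ((∫⁻ x in G.patch i, ‖φ x - w x‖ₑ ^ 2) +
          ENNReal.ofReal ε * ENNReal.ofReal κ * ∫⁻ x in G.patch i, ‖w x‖ₑ ^ 2))) := by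
        refine mul_le_mul' le_rfl (Finset.sum_le_sum fun q _ => ?_)
        exact G.lintegral_face_le i hc₀ hL (fun ξ hξ => (hdet ξ hξ).1) hφ hW hw hwW hlow hεℓ q.1
          (c := if q.2 then 1 else 0) (by cases q.2 <;> simp)
    _ = _ := by
        rw [Finset.sum_const, Finset.card_univ, nsmul_eq_mul]
        simp only [ENNReal.coe_mul, ENNReal.coe_natCast, ENNReal.ofReal]
        ring

/-- The traces of a function whose pullback to the cube satisfies an inverse inequality on lines
are bounded by the function itself. The bound for the smooth functions `φ m` that tend to `w` holds
for every small `ε`, with the factor `ε` in front of their gradients, which are bounded: `m` is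
chosen depending on `ε`, and `ε → 0`. In this way the trace need not be identified with the boundary
values of `W`. -/
lemma exists_eLpNorm_trace_le : ∃ C : NNReal, ∀ w W : SpaceTime d → ℝ,
    ContinuousOn W (cube d) → (∀ᵐ ξ ∂volume.restrict (cube d), w (G.Φ i ξ) = W ξ) →
    ∀ ℓ κ : ℝ, HasLineInverse W ℓ κ → 0 < ℓ →
      eLpNorm (trace (G.patch i) w) 2 (surf (frontier (G.patch i))) ^ 2 ≤
        C * ENNReal.ofReal κ * eLpNorm w 2 (volume.restrict (G.patch i)) ^ 2 := by
  obtain ⟨C, hC⟩ := G.exists_eLpNorm_frontier_le i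
  refine ⟨2 * C, fun w W hW hwW ℓ κ hlow hℓ => ?_⟩
  by_cases hex : ∃ g, IsTrace (G.patch i) w g
  swap
  · simp [trace, hex]
  have htr : IsTrace (G.patch i) w (trace (G.patch i) w) := by
    simp only [trace, dif_pos hex]; exact hex.choose_spec
  set g := trace (G.patch i) w
  obtain ⟨hw, hg, φ, hφ, hφw, hφd, hφg⟩ := htr
  have hwL : MemLp w 2 (volume.restrict (G.patch i)) := hw.1
  -- a bound for the gradients of `φ m`, for large `m`
  set M : ENNReal := (∑ j, (1 + eLpNorm (weakPartial (G.patch i) j w) 2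
    (volume.restrict (G.patch i)))) ^ 2 with hM
  have hMtop : M ≠ ⊤ := by
    rw [hM]
    refine ENNReal.pow_ne_top (ENNReal.sum_ne_top.2 fun j _ => ?_)
    exact ENNReal.add_ne_top.2 ⟨ENNReal.one_ne_top, (memLp_weakPartial _ j w).2.ne⟩
  set R : ENNReal := C * (ENNReal.ofReal κ * eLpNorm w 2 (volume.restrict (G.patch i)) ^ 2)
  have key : ∀ ε ∈ Ioc 0 ℓ, eLpNorm g 2 (surf (frontier (G.patch i))) ^ 2 ≤
      ENNReal.ofReal ε * (2 * ENNReal.ofReal ε + 2 * (C * (M + 1))) + 2 * R := by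
    intro ε ⟨hε, hεℓ⟩
    have hε0 : 0 < ENNReal.ofReal ε := ENNReal.ofReal_pos.2 hε
    obtain ⟨m, ⟨h1, h2⟩, h3⟩ := ((((tendsto_order.1 hφw).2 _ hε0).and
      ((tendsto_order.1 hφg).2 _ hε0)).and
      (eventually_all.2 fun j => (tendsto_order.1 (hφd j)).2 1 one_pos)).exists
    have hφm : ContDiff ℝ 1 (φ m) := (hφ m).of_le (by exact_mod_cast le_top)
    have hgrad : eLpNorm (fderiv ℝ (φ m)) 2 (volume.restrict (G.patch i)) ^ 2 ≤ M := by
      rw [hM]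
      refine pow_le_pow_left₀ zero_le ((eLpNorm_fderiv_le hφm _).trans
        (Finset.sum_le_sum fun j _ => ?_)) 2
      have hmj : AEStronglyMeasurable (fun x => fderiv ℝ (φ m) x (EuclideanSpace.single j 1))
        (volume.restrict (G.patch i)) := ((hφm.continuous_fderiv one_ne_zero).clm_apply
          continuous_const).aestronglyMeasurable
      have hmw := (memLp_weakPartial (G.patch i) j w).1
      calc _ = eLpNorm ((fun x => fderiv ℝ (φ m) x (EuclideanSpace.single j 1) -
            weakPartial (G.patch i) j w x) + weakPartial (G.patch i) j w) 2
            (volume.restrict (G.patch i)) := by congr 1; funext x; simp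
        _ ≤ _ := (eLpNorm_add_le (hmj.sub hmw) hmw (by norm_num)).trans (by
            gcongr; exact (h3 j).le)
    have hφm2 : eLpNorm (φ m) 2 (surf (frontier (G.patch i))) ^ 2 ≤
        C * (ENNReal.ofReal ε * (M + 1)) + R := by
      have h4 := hC (φ m) w W hφm hW hwL.1.aemeasurable hwW ℓ κ ε hlow hε hεℓ
      have h5 : ENNReal.ofReal ε * eLpNorm (φ m) 2 (surf (frontier (G.patch i))) ^ 2 ≤
          ENNReal.ofReal ε * (C * (ENNReal.ofReal ε * (M + 1)) + R) := by
        refine h4.trans ?_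
        calc _ ≤ (C : ENNReal) * (ENNReal.ofReal ε ^ 2 * M + (ENNReal.ofReal ε ^ 2 +
              ENNReal.ofReal ε * ENNReal.ofReal κ *
                eLpNorm w 2 (volume.restrict (G.patch i)) ^ 2)) := by gcongr
          _ = _ := by simp only [R]; ring
      exact (ENNReal.mul_le_mul_iff_right hε0.ne' ENNReal.ofReal_ne_top).1 h5
    have hφmm : AEStronglyMeasurable (φ m) (surf (frontier (G.patch i))) :=
      hφm.continuous.aestronglyMeasurable
    have hgsplit : eLpNorm g 2 (surf (frontier (G.patch i))) ≤
        ENNReal.ofReal ε + eLpNorm (φ m) 2 (surf (frontier (G.patch i))) := by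
      calc _ = eLpNorm (φ m - fun x => φ m x - g x) 2 (surf (frontier (G.patch i))) := by
            congr 1; funext x; simp
        _ ≤ _ := (eLpNorm_sub_le hφmm (hφmm.sub hg.1) (by norm_num)).trans (by
            rw [add_comm]; gcongr; exact h2.le)
    calc _ ≤ (ENNReal.ofReal ε + eLpNorm (φ m) 2 (surf (frontier (G.patch i)))) ^ 2 := by gcongr
      _ ≤ _ := add_sq_le_two_mul_ennreal _ _
      _ ≤ 2 * ENNReal.ofReal ε ^ 2 + 2 * (C * (ENNReal.ofReal ε * (M + 1)) + R) := by gcongr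
      _ = _ := by ring
  have hlim : Tendsto (fun ε : ℝ => ENNReal.ofReal ε *
      (2 * ENNReal.ofReal ε + 2 * (C * (M + 1))) + 2 * R) (𝓝[>] 0) (𝓝 (2 * R)) := by
    have h0 : Tendsto (fun ε : ℝ => ENNReal.ofReal ε) (𝓝[>] 0) (𝓝 0) := by
      have := (ENNReal.continuous_ofReal.tendsto 0).mono_left
        (nhdsWithin_le_nhds (s := Ioi (0 : ℝ)))
      simpa using this
    have h1 : Tendsto (fun ε : ℝ => 2 * ENNReal.ofReal ε + 2 * (C * (M + 1))) (𝓝[>] 0)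
        (𝓝 (2 * 0 + 2 * (C * (M + 1)))) :=
      (ENNReal.Tendsto.const_mul h0 (Or.inr (by norm_num))).add tendsto_const_nhds
    have hfin : 2 * 0 + 2 * ((C : ENNReal) * (M + 1)) ≠ ⊤ := by finiteness
    have h2 := (ENNReal.Tendsto.mul h0 (Or.inr hfin) h1 (Or.inr (by simp))).add
      (tendsto_const_nhds (x := 2 * R))
    simpa using h2
  refine (ge_of_tendsto hlim (Filter.mem_of_superset (Ioc_mem_nhdsGT hℓ) key)).trans_eq ?_
  simp only [R, ENNReal.coe_mul, ENNReal.coe_ofNat]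
  ring

end MultiPatch

/-! ### The inverse trace inequality for splines -/

section sqL2

variable {d : ℕ} {V : Type} [NormedAddCommGroup V] {μ : Measure (SpaceTime d)}

lemma sqL2_nonneg (μ : Measure (SpaceTime d)) (f : SpaceTime d → V) : 0 ≤ sqL2 μ f :=
  integral_nonneg fun _ => sq_nonneg _

lemma ofReal_sqL2 {f : SpaceTime d → V} (hf : MemLp f 2 μ) :
    ENNReal.ofReal (sqL2 μ f) = eLpNorm f 2 μ ^ 2 := by
  rw [sqL2, ofReal_integral_eq_lintegral_ofReal ((memLp_two_iff_integrable_sq_norm hf.1).1 hf)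
    (Eventually.of_forall fun x => sq_nonneg _), eLpNorm_two_sq]
  simp only [ENNReal.ofReal_pow (norm_nonneg _), ofReal_norm]

lemma sqL2_toLp {f : Fin d → SpaceTime d → ℝ} (hf : ∀ k, MemLp (f k) 2 μ) :
    sqL2 μ (fun x => (WithLp.toLp 2 fun k => f k x : EuclideanSpace ℝ (Fin d))) =
      ∑ k, sqL2 μ (f k) := by
  simp only [sqL2, EuclideanSpace.norm_sq_eq]
  exact integral_finsetSum _ fun k _ => (memLp_two_iff_integrable_sq_norm (hf k).1).1 (hf k)

lemma memLp_trace (Ω : Set (SpaceTime d)) (w : SpaceTime d → ℝ) :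
    MemLp (trace Ω w) 2 (surf (frontier Ω)) := by
  unfold trace
  split_ifs with h
  · exact h.choose_spec.2.1
  · exact MemLp.zero

lemma trace_eq_zero_of_not_memLp {Ω : Set (SpaceTime d)} {w : SpaceTime d → ℝ}
    (hw : ¬ MemLp w 2 (volume.restrict Ω)) : trace Ω w = 0 := by
  unfold trace
  exact dif_neg fun ⟨_, hg⟩ => hw hg.1.1

end sqL2

namespace MultiPatch

variable {d N : ℕ} (G : MultiPatch d N) (i : Fin N)

/-- If `w` is not square integrable, then the right hand side may be a junk value, but it is
nonnegative, and the left hand side is zero, since `w` has no trace. -/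
lemma exists_sqL2_trace_le : ∃ C : ℝ, 0 ≤ C ∧ ∀ w W : SpaceTime d → ℝ,
    ContinuousOn W (cube d) → (∀ᵐ ξ ∂volume.restrict (cube d), w (G.Φ i ξ) = W ξ) →
    ∀ ℓ κ : ℝ, HasLineInverse W ℓ κ → 0 < ℓ → 0 ≤ κ →
      sqL2 (surf (frontier (G.patch i))) (trace (G.patch i) w) ≤
        C * κ * sqL2 (volume.restrict (G.patch i)) w := by
  obtain ⟨C, hC⟩ := G.exists_eLpNorm_trace_le i
  refine ⟨C, C.coe_nonneg, fun w W hW hwW ℓ κ hlow hℓ hκ => ?_⟩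
  have hnn : 0 ≤ (C : ℝ) * κ := mul_nonneg C.coe_nonneg hκ
  by_cases hw : MemLp w 2 (volume.restrict (G.patch i))
  · rw [← ENNReal.ofReal_le_ofReal_iff (mul_nonneg hnn (sqL2_nonneg _ _)),
      ENNReal.ofReal_mul hnn, ENNReal.ofReal_mul C.coe_nonneg, ofReal_sqL2 (memLp_trace _ _),
      ofReal_sqL2 hw, ENNReal.ofReal_coe_nnreal]
    exact hC w W hW hwW ℓ κ hlow hℓ
  · rw [trace_eq_zero_of_not_memLp hw]
    simpa [sqL2] using mul_nonneg hnn (sqL2_nonneg (volume.restrict (G.patch i)) w)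

end MultiPatch

namespace Discretization

variable {d N : ℕ} {G : MultiPatch d N} {p : Fin N → Fin (d + 1) → ℕ} {i : Fin N}

/-- Functions whose product with `det DΦ_i` is polynomial on the elements, along the lines in
coordinate directions, satisfy the inverse inequality on lines with a constant of order
`1 / h_i`. -/
lemma exists_hasLineInverse (G : MultiPatch d N) (p : Fin N → Fin (d + 1) → ℕ) (i : Fin N)
    (n : ℕ) {Cq ρ : ℝ} (hCq : 0 ≤ Cq) :
    ∃ K : ℝ, 0 ≤ K ∧ ∀ D : Discretization G p, D.IsQuasiUniform Cq → D.IsShapeRegular ρ →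
      0 < D.h i ∧ ∃ ℓ > 0, ∀ W : SpaceTime d → ℝ,
      (∀ α a b, a < b → D.IsKnotFree i α a b → ∀ y : Fin d → ℝ, (∀ j, y j ∈ Ioo (0 : ℝ) 1) →
        IsPolyOn n (Ioo a b) fun τ => (G.DΦ i (line α y τ)).det * W (line α y τ)) →
      MultiPatch.HasLineInverse W ℓ (K * (D.h i)⁻¹) := by
  obtain ⟨L, hL0, hL⟩ := G.exists_norm_DΦ_le i
  have hLip := G.norm_Φ_sub_le i hL
  obtain ⟨c₀, C₀, hc₀, hdet⟩ := G.exists_det_bounds i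
  obtain ⟨K, hK, hKW⟩ := exists_enorm_sq_le_of_mul_isPolyOn n (C₀ := C₀) hc₀
  set A := Cq * (L * ((d + 1) * ρ)) with hA
  refine ⟨K * |A|, by positivity, fun D hq hs => ⟨D.h_pos hL0 hLip, ?_⟩⟩
  have hh : 0 < D.h i := D.h_pos hL0 hLip
  -- `ρ` may be any number, but the existence of the mesh forces `A` to be positive
  have hApos : 0 < A := by
    obtain ⟨a, b, hab, -, hle, -⟩ := D.exists_end_interval hL0 hLip hCq hq hs 0 (Or.inl rfl)
    exact pos_of_mul_pos_left (hh.trans_le hle) (sub_pos.2 hab).le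
  rw [abs_of_pos hApos]
  refine ⟨D.h i / A, by positivity, fun W hW α c hc => ?_⟩
  obtain ⟨a, b, hab, hab1, hle, hσ, hfree⟩ := D.exists_end_interval hL0 hLip hCq hq hs α hc
  refine ⟨b - a, (div_le_iff₀' hApos).2 hle, hab1, fun y hy => ?_⟩
  have hr : 0 < b - a := sub_pos.2 hab
  have hpoly := (hW α a b hab hfree y hy).comp_affine c (1 - 2 * c) (I := Ioo 0 (b - a))
    fun t ht => by rw [add_comm]; exact hσ t ht
  have h := hKW (b - a) hr (fun σ => (G.DΦ i (line α y (c + (1 - 2 * c) * σ))).det)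
    (fun σ => W (line α y (c + (1 - 2 * c) * σ)))
    (by simpa only [add_comm c] using hpoly) fun σ hσ' => hdet _ (cube_subset_closedCube
      ((line_mem_cube _ _ _).2 ⟨hfree.1 (hσ σ hσ'), hy⟩))
  intro σ hσ'
  refine (h σ hσ').trans ?_
  gcongr
  rw [div_eq_mul_inv, mul_assoc]
  gcongr
  rw [← div_eq_mul_inv, le_div_iff₀ hh, inv_mul_le_iff₀ hr, mul_comm]
  exact hle

lemma ae_comp_Φ_eq {s v : SpaceTime d → ℝ}
    (hv : v =ᵐ[volume.restrict (G.patch i)] s ∘ G.inv i) :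
    ∀ᵐ ξ ∂volume.restrict (cube d), v (G.Φ i ξ) = s ξ := by
  filter_upwards [G.ae_cube_of_ae_patch i hv, ae_restrict_mem isOpen_cube.measurableSet] with ξ h hξ
  rw [h, Function.comp_apply, G.inv_Φ i (cube_subset_closedCube hξ)]

/-- The inverse trace inequality for splines and their spatial gradients, with a constant that is
uniform for all quasi-uniform and shape regular meshes. -/
theorem exists_isInverseConstant (G : MultiPatch d N) (p : Fin N → Fin (d + 1) → ℕ) {Cq ρ : ℝ}
    (hCq : 0 ≤ Cq) : ∃ C : ℝ, 0 ≤ C ∧ ∀ D : Discretization G p, D.IsQuasiUniform Cq →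
      D.IsShapeRegular ρ → (∀ i, 0 < D.h i) ∧ D.IsInverseConstant C := by
  choose C₁ hC₁ hC₁' using G.exists_sqL2_trace_le
  choose K hK hK' using fun i => exists_hasLineInverse G p i
    ((d + 1) * (∑ α, p i α) + ∑ α, p i α) (ρ := ρ) hCq
  refine ⟨∑ i, C₁ i * K i, Finset.sum_nonneg fun i _ => mul_nonneg (hC₁ i) (hK i),
    fun D hq hs => ⟨fun i => (hK' i D hq hs).1, fun i v hv => ?_⟩⟩
  obtain ⟨s, hsp, hvs⟩ := hv
  obtain ⟨hh, ℓ, hℓ, hline⟩ := hK' i D hq hs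
  have hpα : ∀ α, p i α ≤ ∑ α, p i α := fun α =>
    Finset.single_le_sum (f := fun α => p i α) (fun _ _ => Nat.zero_le _) (Finset.mem_univ α)
  have hCi : C₁ i * K i ≤ ∑ i, C₁ i * K i := Finset.single_le_sum (f := fun i => C₁ i * K i)
    (fun j _ => mul_nonneg (hC₁ j) (hK j)) (Finset.mem_univ i)
  have key : ∀ w W : SpaceTime d → ℝ, ContinuousOn W (cube d) →
      (∀ᵐ ξ ∂volume.restrict (cube d), w (G.Φ i ξ) = W ξ) →
      (∀ α a b, a < b → D.IsKnotFree i α a b → ∀ y : Fin d → ℝ, (∀ j, y j ∈ Ioo (0 : ℝ) 1) →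
        IsPolyOn ((d + 1) * p i α + p i α) (Ioo a b)
          fun τ => (G.DΦ i (line α y τ)).det * W (line α y τ)) →
      sqL2 (surf (frontier (G.patch i))) (trace (G.patch i) w) ≤
        (∑ i, C₁ i * K i) * (D.h i)⁻¹ * sqL2 (volume.restrict (G.patch i)) w := by
    intro w W hW hwW hpoly
    refine (hC₁' i w W hW hwW ℓ _ (hline W fun α a b hab hfree y hy =>
      (hpoly α a b hab hfree y hy).mono ?_ subset_rfl) hℓ (mul_nonneg (hK i) (by positivity))).trans ?_
    · have := hpα α
      gcongr
    · rw [← mul_assoc]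
      have := sqL2_nonneg (volume.restrict (G.patch i)) w
      gcongr
  refine ⟨key v s (D.contDiffOn_of_mem_splineSpace hsp).continuousOn (ae_comp_Φ_eq hvs)
    fun α a b hab hfree y hy => (det_isPolyOn hab hfree hy).mul
      (isPolyOn_of_mem_span hfree.2 y hsp), ?_⟩
  have hcomp : ∀ k : Fin d, sqL2 (surf (frontier (G.patch i)))
      (trace (G.patch i) (weakPartial (G.patch i) k.castSucc v)) ≤
      (∑ i, C₁ i * K i) * (D.h i)⁻¹ * sqL2 (volume.restrict (G.patch i))
        (weakPartial (G.patch i) k.castSucc v) := by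
    intro k
    rcases weakPartial_comp_Φ hsp hvs k.castSucc with h0 | h
    · rw [h0]
      exact key 0 0 continuousOn_const (by simp) fun α a b _ _ y _ => by
        simpa using IsPolyOn.const _ _ 0
    · exact key _ _ (continuousOn_pullbackPartial hsp _) h fun α a b hab hfree y hy =>
        det_mul_pullbackPartial_isPolyOn hsp _ hab hfree hy
  calc sqL2 (surf (frontier (G.patch i))) (G.trGradx v i)
      = ∑ k : Fin d, sqL2 (surf (frontier (G.patch i)))
          (trace (G.patch i) (weakPartial (G.patch i) k.castSucc v)) :=
        sqL2_toLp fun k => memLp_trace _ _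
    _ ≤ ∑ k : Fin d, _ := Finset.sum_le_sum fun k _ => hcomp k
    _ = _ := by
        rw [← Finset.mul_sum]
        congr 1
        exact (sqL2_toLp fun k => memLp_weakPartial _ _ _).symm

end Discretization

/-! ### Normals, jumps and averages -/

section young

variable {d : ℕ} {V : Type} [NormedAddCommGroup V] [InnerProductSpace ℝ V]
  {μ : Measure (SpaceTime d)}

lemma integrable_inner_of_memLp {f g : SpaceTime d → V} (hf : MemLp f 2 μ) (hg : MemLp g 2 μ) :
    Integrable (fun x => inner ℝ (f x) (g x)) μ := by
  refine (((memLp_two_iff_integrable_sq_norm hf.1).1 hf).add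
    ((memLp_two_iff_integrable_sq_norm hg.1).1 hg)).mono' (hf.1.inner hg.1)
    (Eventually.of_forall fun x => (norm_inner_le_norm _ _).trans ?_)
  simp only [Pi.add_apply]
  nlinarith [sq_nonneg (‖f x‖ - ‖g x‖), sq_nonneg (‖f x‖ + ‖g x‖)]

lemma integrable_mul_of_memLp {f g : SpaceTime d → ℝ} (hf : MemLp f 2 μ) (hg : MemLp g 2 μ) :
    Integrable (fun x => f x * g x) μ := by
  simpa [mul_comm] using integrable_inner_of_memLp hg hf

/-- The weighted inequality of Young for integrals. -/
lemma abs_integral_inner_le {f g : SpaceTime d → V} (hf : MemLp f 2 μ) (hg : MemLp g 2 μ)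
    {t w : ℝ} (ht : 0 < t) (hw : 0 < w) :
    |∫ x, inner ℝ (f x) (g x) ∂μ| ≤
      t / 2 * (w * sqL2 μ f) + 1 / (2 * t) * (w⁻¹ * sqL2 μ g) := by
  have hf2 := (memLp_two_iff_integrable_sq_norm hf.1).1 hf
  have hg2 := (memLp_two_iff_integrable_sq_norm hg.1).1 hg
  have h1 := norm_integral_le_of_norm_le (f := fun x => inner ℝ (f x) (g x))
    (((hf2.const_mul w).const_mul (t / 2)).add ((hg2.const_mul w⁻¹).const_mul (1 / (2 * t))))
    (Eventually.of_forall fun x => (norm_inner_le_norm (f x) (g x)).trans ?_)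
  · refine h1.trans_eq ?_
    simp only [Pi.add_apply]
    rw [integral_add ((hf2.const_mul w).const_mul (t / 2))
      ((hg2.const_mul w⁻¹).const_mul (1 / (2 * t)))]
    simp only [integral_const_mul, sqL2]
  · have h2 : t / 2 * (w * ‖f x‖ ^ 2) + 1 / (2 * t) * (w⁻¹ * ‖g x‖ ^ 2) - ‖f x‖ * ‖g x‖ =
        (t * w * ‖f x‖ - ‖g x‖) ^ 2 / (2 * t * w) := by
      field_simp; ring
    have h3 : 0 ≤ (t * w * ‖f x‖ - ‖g x‖) ^ 2 / (2 * t * w) := by positivity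
    simp only [Pi.add_apply]
    linarith

lemma abs_integral_mul_le {f g : SpaceTime d → ℝ} (hf : MemLp f 2 μ) (hg : MemLp g 2 μ)
    {t w : ℝ} (ht : 0 < t) (hw : 0 < w) :
    |∫ x, f x * g x ∂μ| ≤ t / 2 * (w * sqL2 μ f) + 1 / (2 * t) * (w⁻¹ * sqL2 μ g) := by
  simpa [mul_comm (g _)] using abs_integral_inner_le hf hg ht hw

lemma sqL2_mono_measure {W : Type} [NormedAddCommGroup W] {ν : Measure (SpaceTime d)}
    {f : SpaceTime d → W} (hf : MemLp f 2 ν) (h : μ ≤ ν) : sqL2 μ f ≤ sqL2 ν f :=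
  integral_mono_measure h (Eventually.of_forall fun _ => sq_nonneg _)
    ((memLp_two_iff_integrable_sq_norm hf.1).1 hf)

/-- The product bound that corresponds to a family of weighted bounds. -/
lemma le_sqrt_mul_sqrt_of_forall {X A B : ℝ} (hA : 0 ≤ A) (hB : 0 ≤ B)
    (h : ∀ t > 0, X ≤ t / 2 * A + 1 / (2 * t) * B) : X ≤ √A * √B := by
  have hsa : 0 ≤ √A := Real.sqrt_nonneg A
  have hsb : 0 ≤ √B := Real.sqrt_nonneg B
  refine le_of_forall_pos_le_add fun η hη => ?_
  -- the optimal weight is `√B / √A`, regularized here to be positive and finite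
  obtain ⟨κ, hκ, hκη⟩ : ∃ κ > 0, κ * (√A + √B + κ) ≤ η := by
    refine ⟨min 1 (η / (√A + √B + 1)), by positivity, ?_⟩
    calc _ ≤ η / (√A + √B + 1) * (√A + √B + 1) := by
          gcongr
          · exact min_le_right _ _
          · exact min_le_left _ _
      _ = η := by field_simp
  have ha : 0 < √A + κ := by positivity
  have hb : 0 < √B + κ := by positivity
  have h1 := h ((√B + κ) / (√A + κ)) (by positivity)
  have hA2 : A ≤ (√A + κ) ^ 2 := by
    nlinarith [Real.sq_sqrt hA]
  have hB2 : B ≤ (√B + κ) ^ 2 := by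
    nlinarith [Real.sq_sqrt hB]
  calc X ≤ (√B + κ) / (√A + κ) / 2 * (√A + κ) ^ 2 +
        1 / (2 * ((√B + κ) / (√A + κ))) * (√B + κ) ^ 2 := h1.trans (by gcongr)
    _ = (√A + κ) * (√B + κ) := by field_simp; ring
    _ = √A * √B + κ * (√A + √B + κ) := by ring
    _ ≤ _ := by gcongr

end young

namespace MultiPatch

variable {d N : ℕ} (G : MultiPatch d N) (i : Fin N)

lemma measurable_refNormal : Measurable (refNormal : SpaceTime d → SpaceTime d) := by
  refine (PiLp.continuous_toLp 2 _).measurable.comp (measurable_pi_lambda _ fun α => ?_)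
  have hα : Measurable fun ξ : SpaceTime d => ξ α := (by fun_prop : Continuous _).measurable
  exact Measurable.ite (measurableSet_eq_fun hα measurable_const) measurable_const
    (Measurable.ite (measurableSet_eq_fun hα measurable_const) measurable_const measurable_const)

lemma aestronglyMeasurable_normal :
    AEStronglyMeasurable (G.normal i) (surf (frontier (G.patch i))) := by
  have hsub : frontier (G.patch i) ⊆ G.Φ i '' closedCube d :=
    (G.frontier_patch_subset i).trans (image_mono sdiff_subset)
  have hinv : ContinuousOn (G.inv i) (frontier (G.patch i)) := (G.continuousOn_inv i).mono hsub
  have hmaps : MapsTo (G.inv i) (frontier (G.patch i)) (closedCube d) := by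
    intro x hx
    obtain ⟨ξ, hξ, rfl⟩ := hsub hx
    rwa [G.inv_Φ i hξ]
  have h1 : AEStronglyMeasurable
      (fun x => ContinuousLinearMap.adjoint (G.DΦ i (G.inv i x)).inverse)
      (surf (frontier (G.patch i))) :=
    (ContinuousLinearMap.adjoint.continuous.comp_continuousOn
      ((G.continuousOn_inverse_DΦ i).comp hinv hmaps)).aestronglyMeasurable
      isClosed_frontier.measurableSet
  have h2 : AEStronglyMeasurable (fun x => refNormal (G.inv i x)) (surf (frontier (G.patch i))) :=
    (measurable_refNormal.comp_aemeasurable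
      (hinv.aemeasurable isClosed_frontier.measurableSet)).aestronglyMeasurable
  have h3 : AEStronglyMeasurable (fun x => ContinuousLinearMap.adjoint
      (G.DΦ i (G.inv i x)).inverse (refNormal (G.inv i x))) (surf (frontier (G.patch i))) :=
    isBoundedBilinearMap_apply.continuous.comp_aestronglyMeasurable (h1.prodMk h2)
  exact (h3.norm.aemeasurable.inv.aestronglyMeasurable).smul h3

lemma norm_normal_le (x : SpaceTime d) : ‖G.normal i x‖ ≤ 1 := by
  simp only [normal, norm_smul, norm_inv, norm_norm]
  exact inv_mul_le_one

lemma abs_nt_le (x : SpaceTime d) : ‖G.nt i x‖ ≤ 1 :=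
  (PiLp.norm_apply_le _ _).trans (G.norm_normal_le i x)

lemma norm_nx_le (x : SpaceTime d) : ‖G.nx i x‖ ≤ 1 := by
  refine le_trans ?_ (G.norm_normal_le i x)
  rw [EuclideanSpace.norm_eq, EuclideanSpace.norm_eq]
  refine Real.sqrt_le_sqrt ?_
  rw [Fin.sum_univ_castSucc]
  exact le_add_of_nonneg_right (sq_nonneg _)

lemma aestronglyMeasurable_nt : AEStronglyMeasurable (G.nt i) (surf (frontier (G.patch i))) :=
  (EuclideanSpace.proj (𝕜 := ℝ) (Fin.last d)).continuous.comp_aestronglyMeasurable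
    (G.aestronglyMeasurable_normal i)

lemma aestronglyMeasurable_nx : AEStronglyMeasurable (G.nx i) (surf (frontier (G.patch i))) := by
  have : Continuous fun x : SpaceTime d =>
      (WithLp.toLp 2 fun k : Fin d => x k.castSucc : EuclideanSpace ℝ (Fin d)) :=
    (PiLp.continuous_toLp 2 _).comp (by fun_prop)
  exact this.comp_aestronglyMeasurable (G.aestronglyMeasurable_normal i)

lemma surf_mono {s t : Set (SpaceTime d)} (h : s ⊆ t) : surf s ≤ surf t :=
  Measure.restrict_mono h le_rfl

section facet

variable {V : Type} [NormedAddCommGroup V] {i} {j : Fin N} {f : Fin N → SpaceTime d → V}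

lemma surf_facet_le_left : surf (G.facet i j) ≤ surf (frontier (G.patch i)) :=
  surf_mono inter_subset_left

lemma surf_facet_le_right : surf (G.facet i j) ≤ surf (frontier (G.patch j)) :=
  surf_mono inter_subset_right

lemma memLp_up (hf : ∀ i, MemLp (f i) 2 (surf (frontier (G.patch i)))) :
    MemLp (G.up f i j) 2 (surf (G.facet i j)) := by
  have hi := (hf i).mono_measure (G.surf_facet_le_left (j := j))
  have hj := (hf j).mono_measure (G.surf_facet_le_right (i := i))
  refine (hi.norm.add hj.norm).of_le ?_ (Eventually.of_forall fun x => ?_)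
  · obtain ⟨n, hn, hne⟩ := ((G.aestronglyMeasurable_nt i).mono_measure
      (G.surf_facet_le_left (j := j))).aemeasurable
    classical
    refine (AEStronglyMeasurable.piecewise (s := {x | 0 ≤ n x})
      (measurableSet_le measurable_const hn) hi.1.restrict hj.1.restrict).congr ?_
    filter_upwards [hne] with x hx
    simp only [piecewise, up, hx, mem_ofPred_eq]
  · simp only [up, Pi.add_apply]
    rw [Real.norm_of_nonneg (by positivity)]
    split_ifs <;> simp

variable [NormedSpace ℝ V]

lemma memLp_jumpT (hf : ∀ i, MemLp (f i) 2 (surf (frontier (G.patch i)))) :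
    MemLp (G.jumpT f i j) 2 (surf (G.facet i j)) := by
  have h : ∀ i, MemLp (fun x => G.nt i x • f i x) 2 (surf (frontier (G.patch i))) := fun i =>
    (hf i).of_le ((G.aestronglyMeasurable_nt i).smul (hf i).1) (Eventually.of_forall fun x => by
      rw [norm_smul]; exact mul_le_of_le_one_left (norm_nonneg _) (G.abs_nt_le i x))
  exact ((h i).mono_measure G.surf_facet_le_left).add ((h j).mono_measure G.surf_facet_le_right)

lemma memLp_jumpX {f : Fin N → SpaceTime d → ℝ}
    (hf : ∀ i, MemLp (f i) 2 (surf (frontier (G.patch i)))) :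
    MemLp (G.jumpX f i j) 2 (surf (G.facet i j)) := by
  have h : ∀ i, MemLp (fun x => f i x • G.nx i x) 2 (surf (frontier (G.patch i))) := fun i =>
    (hf i).of_le ((hf i).1.smul (G.aestronglyMeasurable_nx i)) (Eventually.of_forall fun x => by
      rw [norm_smul]; exact mul_le_of_le_one_right (norm_nonneg _) (G.norm_nx_le i x))
  exact ((h i).mono_measure G.surf_facet_le_left).add ((h j).mono_measure G.surf_facet_le_right)

lemma memLp_avg (hf : ∀ i, MemLp (f i) 2 (surf (frontier (G.patch i)))) :
    MemLp (avg f i j) 2 (surf (G.facet i j)) :=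
  (((hf i).mono_measure G.surf_facet_le_left).add
    ((hf j).mono_measure G.surf_facet_le_right)).const_smul (1 / 2 : ℝ)

lemma sqL2_avg_le (hf : ∀ i, MemLp (f i) 2 (surf (frontier (G.patch i)))) :
    sqL2 (surf (G.facet i j)) (avg f i j) ≤
      1 / 2 * (sqL2 (surf (frontier (G.patch i))) (f i) +
        sqL2 (surf (frontier (G.patch j))) (f j)) := by
  have hi := (hf i).mono_measure (G.surf_facet_le_left (j := j))
  have hj := (hf j).mono_measure (G.surf_facet_le_right (i := i))
  have hi2 := (memLp_two_iff_integrable_sq_norm hi.1).1 hi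
  have hj2 := (memLp_two_iff_integrable_sq_norm hj.1).1 hj
  calc _ ≤ ∫ x, 1 / 2 * (‖f i x‖ ^ 2 + ‖f j x‖ ^ 2) ∂(surf (G.facet i j)) := by
        refine integral_mono_of_nonneg (Eventually.of_forall fun x => sq_nonneg _)
          ((hi2.add hj2).const_mul _) (Eventually.of_forall fun x => ?_)
        simp only [avg, norm_smul, mul_pow]
        have h1 := pow_le_pow_left₀ (norm_nonneg _) (norm_add_le (f i x) (f j x)) 2
        norm_num
        nlinarith [sq_nonneg (‖f i x‖ - ‖f j x‖)]
    _ = 1 / 2 * (sqL2 (surf (G.facet i j)) (f i) + sqL2 (surf (G.facet i j)) (f j)) := by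
        rw [integral_const_mul, integral_add hi2 hj2]; rfl
    _ ≤ _ := by
        gcongr
        · exact sqL2_mono_measure (hf i) G.surf_facet_le_left
        · exact sqL2_mono_measure (hf j) G.surf_facet_le_right

end facet

end MultiPatch

/-! ### Boundedness of the bilinear form -/

section memLp

variable {d : ℕ} (Ω : Set (SpaceTime d)) (u : SpaceTime d → ℝ)

lemma memLp_dt : MemLp (dt Ω u) 2 (volume.restrict Ω) := memLp_weakPartial Ω _ u

lemma memLp_gradx : MemLp (gradx Ω u) 2 (volume.restrict Ω) :=
  MemLp.of_eval_piLp fun _ => memLp_weakPartial Ω _ u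

lemma memLp_dtGradx : MemLp (dtGradx Ω u) 2 (volume.restrict Ω) :=
  MemLp.of_eval_piLp fun _ => memLp_weakPartial Ω _ _

lemma memLp_traceGradx : MemLp (traceGradx Ω u) 2 (surf (frontier Ω)) :=
  MemLp.of_eval_piLp fun _ => memLp_trace Ω _

end memLp

lemma abs_sum_le_of_abs_le {ι : Type*} {s : Finset ι} {f a b : ι → ℝ} {x y : ℝ}
    (h : ∀ i ∈ s, |f i| ≤ x * a i + y * b i) :
    |∑ i ∈ s, f i| ≤ x * ∑ i ∈ s, a i + y * ∑ i ∈ s, b i := by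
  rw [Finset.mul_sum, Finset.mul_sum, ← Finset.sum_add_distrib]
  exact (Finset.abs_sum_le_sum_abs _ _).trans (Finset.sum_le_sum h)

lemma abs_mul_le_of_abs_le {c f a b x y : ℝ} (hc : 0 ≤ c) (h : |f| ≤ x * a + y * b) :
    |c * f| ≤ x * (c * a) + y * (c * b) := by
  rw [abs_mul, abs_of_nonneg hc]
  calc c * |f| ≤ c * (x * a + y * b) := by gcongr
    _ = _ := by ring

/-- Four weighted Young inequalities on a facet, added up. The weights are chosen such that the
jumps of the first function carry the penalty weights. -/
lemma abs_consistency_le_of_abs_le {t R h θ Θ δ₁ δ₂ Au Av Ju Jv Tu Tv I₁ I₂ I₃ I₄ : ℝ}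
    (ht : 0 < t) (hR : 0 < R) (hh : 0 < h) (hθ : 0 < θ) (hδ₁ : 0 < δ₁) (hδ₂ : 0 < δ₂)
    (hθle : θ ≤ Θ) (hAv : 0 ≤ Av) (hJv : 0 ≤ Jv) (hTv : 0 ≤ Tv)
    (h₁ : |I₁| ≤ t / 2 * (h / R * Au) + 1 / (2 * t) * ((h / R)⁻¹ * Jv))
    (h₂ : |I₂| ≤ t / 2 * (δ₁ / h * Ju) + 1 / (2 * t) * ((δ₁ / h)⁻¹ * Av))
    (h₃ : |I₃| ≤ t / 2 * ((R * θ)⁻¹ * Au) + 1 / (2 * t) * ((R * θ)⁻¹⁻¹ * Tv))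
    (h₄ : |I₄| ≤ t / 2 * (δ₂ * Tu) + 1 / (2 * t) * (δ₂⁻¹ * Av)) :
    |-I₁ + I₂ + θ * h * (-I₃ + I₄)| ≤
      t / 2 * (2 / R * (h * Au) + (δ₁ / h * Ju + δ₂ * θ * h * Tu)) +
      1 / (2 * t) * (R * (δ₁⁻¹ + Θ * δ₂⁻¹) * (δ₁ / h * Jv + δ₂ * θ * h * Tv) +
        (δ₁⁻¹ + Θ * δ₂⁻¹) * (h * Av)) := by
  set X := δ₁⁻¹ + Θ * δ₂⁻¹ with hX
  have b₁ := abs_le.1 h₁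
  have b₂ := abs_le.1 h₂
  have b₃ := abs_le.1 (abs_mul_le_of_abs_le (mul_pos hθ hh).le h₃)
  have b₄ := abs_le.1 (abs_mul_le_of_abs_le (mul_pos hθ hh).le h₄)
  have eA : h / R * Au + δ₁ / h * Ju + θ * h * ((R * θ)⁻¹ * Au) + θ * h * (δ₂ * Tu) =
      2 / R * (h * Au) + (δ₁ / h * Ju + δ₂ * θ * h * Tu) := by
    field_simp
    ring
  have hX1 : δ₁⁻¹ ≤ X := le_add_of_nonneg_right (mul_nonneg (hθ.le.trans hθle) (by positivity))
  have hX2 : θ * δ₂⁻¹ ≤ X := le_trans (by gcongr) (le_add_of_nonneg_left (by positivity))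
  have eB : (h / R)⁻¹ * Jv + (δ₁ / h)⁻¹ * Av + θ * h * ((R * θ)⁻¹⁻¹ * Tv) +
      θ * h * (δ₂⁻¹ * Av) ≤ R * X * (δ₁ / h * Jv + δ₂ * θ * h * Tv) + X * (h * Av) := by
    have e1 : (h / R)⁻¹ * Jv = R * δ₁⁻¹ * (δ₁ / h * Jv) := by field_simp
    have e2 : θ * h * ((R * θ)⁻¹⁻¹ * Tv) = R * (θ * δ₂⁻¹) * (δ₂ * θ * h * Tv) := by
      field_simp
    have e3 : (δ₁ / h)⁻¹ * Av + θ * h * (δ₂⁻¹ * Av) = (δ₁⁻¹ + θ * δ₂⁻¹) * (h * Av) := by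
      field_simp
    have e4 : δ₁⁻¹ + θ * δ₂⁻¹ ≤ X := by rw [hX]; gcongr
    have f1 : R * δ₁⁻¹ * (δ₁ / h * Jv) ≤ R * X * (δ₁ / h * Jv) := by gcongr
    have f2 : R * (θ * δ₂⁻¹) * (δ₂ * θ * h * Tv) ≤ R * X * (δ₂ * θ * h * Tv) := by gcongr
    have f3 : (δ₁⁻¹ + θ * δ₂⁻¹) * (h * Av) ≤ X * (h * Av) := by gcongr
    linarith
  rw [← eA]
  have eB' := mul_le_mul_of_nonneg_left eB (by positivity : 0 ≤ 1 / (2 * t))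
  rw [abs_le]
  constructor <;> linarith [b₁.1, b₁.2, b₂.1, b₂.2, b₃.1, b₃.2, b₄.1, b₄.2]

namespace Discretization

variable {d N : ℕ} {G : MultiPatch d N} {p : Fin N → Fin (d + 1) → ℕ} (D : Discretization G p)
  (P : Params N)

/-- The part of `‖w‖_h²` with the integrals over the patches. -/
noncomputable def patchEnergy (w : SpaceTime d → ℝ) : ℝ :=
  ∑ i, (sqL2 (volume.restrict (G.patch i)) (gradx (G.patch i) w)
    + P.θ i * D.h i * sqL2 (volume.restrict (G.patch i)) (dt (G.patch i) w))

/-- The sum of the `‖w‖²` over the facets in `Σ_T`. -/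
noncomputable def topEnergy (G : MultiPatch d N) (w : SpaceTime d → ℝ) : ℝ :=
  ∑ i, sqL2 (surf (G.topFacet i)) (G.tr w i)

/-- The part of `‖w‖_h²` with `∇_x w` on the facets in `Σ_T`. -/
noncomputable def topGradEnergy (w : SpaceTime d → ℝ) : ℝ :=
  ∑ i, P.θ i * D.h i / 2 * sqL2 (surf (G.topFacet i)) (G.trGradx w i)

/-- The sum of the `‖⟦w⟧_t‖²` over the interior facets. -/
noncomputable def jumpTEnergy (G : MultiPatch d N) (w : SpaceTime d → ℝ) : ℝ :=
  ∑ F ∈ G.facets, sqL2 (surf (G.facet F.1 F.2)) (G.jumpT (G.tr w) F.1 F.2)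

/-- The part of `‖w‖_h²` with the jumps `⟦∇_x w⟧_t`. -/
noncomputable def jumpTGradEnergy (w : SpaceTime d → ℝ) : ℝ :=
  ∑ F ∈ G.facets, P.θ F.1 * D.h F.1 / 2 *
    sqL2 (surf (G.facet F.1 F.2)) (G.jumpT (G.trGradx w) F.1 F.2)

/-- The part of `‖w‖_h²` with the jumps `⟦w⟧_x` and `⟦∂_t w⟧_x`. -/
noncomputable def jumpXEnergy (w : SpaceTime d → ℝ) : ℝ :=
  ∑ F ∈ G.facets,
    (P.δ₁ / D.h F.1 * sqL2 (surf (G.facet F.1 F.2)) (G.jumpX (G.tr w) F.1 F.2)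
      + P.δ₂ * P.θ F.1 * D.h F.1 *
        sqL2 (surf (G.facet F.1 F.2)) (G.jumpX (G.trDt w) F.1 F.2))

/-- The part of `‖w‖_{h,*}² - ‖w‖_h²` with the integrals over the patches. -/
noncomputable def patchStarEnergy (w : SpaceTime d → ℝ) : ℝ :=
  ∑ i, ((P.θ i * D.h i)⁻¹ * sqL2 (volume.restrict (G.patch i)) w
    + (P.θ i * D.h i) ^ 2 * sqL2 (volume.restrict (G.patch i)) (dtGradx (G.patch i) w))

/-- The sum of the `‖{w}^up‖²` over the interior facets. -/
noncomputable def upEnergy (G : MultiPatch d N) (w : SpaceTime d → ℝ) : ℝ :=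
  ∑ F ∈ G.facets, sqL2 (surf (G.facet F.1 F.2)) (G.up (G.tr w) F.1 F.2)

/-- The part of `‖w‖_{h,*}²` with the upwind values of `∇_x w`. -/
noncomputable def upGradEnergy (w : SpaceTime d → ℝ) : ℝ :=
  ∑ F ∈ G.facets, P.θ F.1 * D.h F.1 *
    sqL2 (surf (G.facet F.1 F.2)) (G.up (G.trGradx w) F.1 F.2)

/-- The part of `‖w‖_{h,*}²` with `∇_x w` on the boundaries of the patches. -/
noncomputable def boundaryGradEnergy (w : SpaceTime d → ℝ) : ℝ :=
  ∑ i, D.h i * sqL2 (surf (frontier (G.patch i))) (G.trGradx w i)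

/-- The sum of the `h_i ‖{∇_x w}‖²` over the interior facets. -/
noncomputable def avgGradEnergy (w : SpaceTime d → ℝ) : ℝ :=
  ∑ F ∈ G.facets, D.h F.1 *
    sqL2 (surf (G.facet F.1 F.2)) (MultiPatch.avg (G.trGradx w) F.1 F.2)

lemma normSq_eq (w : SpaceTime d → ℝ) : D.normSq P w = D.patchEnergy P w + 1 / 2 * topEnergy G w +
    D.topGradEnergy P w + 1 / 2 * jumpTEnergy G w + D.jumpTGradEnergy P w + D.jumpXEnergy P w := rfl

lemma normStarSq_eq (w : SpaceTime d → ℝ) : D.normStarSq P w = D.normSq P w +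
    D.patchStarEnergy P w + upEnergy G w + D.upGradEnergy P w + D.boundaryGradEnergy w := rfl

section nonneg

variable {D} (hh : ∀ i, 0 < D.h i) (w : SpaceTime d → ℝ)

lemma topEnergy_nonneg : 0 ≤ topEnergy G w := Finset.sum_nonneg fun _ _ => sqL2_nonneg _ _

lemma jumpTEnergy_nonneg : 0 ≤ jumpTEnergy G w := Finset.sum_nonneg fun _ _ => sqL2_nonneg _ _

lemma upEnergy_nonneg : 0 ≤ upEnergy G w := Finset.sum_nonneg fun _ _ => sqL2_nonneg _ _

include hh

lemma patchEnergy_nonneg : 0 ≤ D.patchEnergy P w := Finset.sum_nonneg fun i _ =>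
  add_nonneg (sqL2_nonneg _ _) (mul_nonneg (mul_pos (P.θ_pos i) (hh i)).le (sqL2_nonneg _ _))

lemma topGradEnergy_nonneg : 0 ≤ D.topGradEnergy P w := Finset.sum_nonneg fun i _ =>
  mul_nonneg (half_pos (mul_pos (P.θ_pos i) (hh i))).le (sqL2_nonneg _ _)

lemma jumpTGradEnergy_nonneg : 0 ≤ D.jumpTGradEnergy P w := Finset.sum_nonneg fun F _ =>
  mul_nonneg (half_pos (mul_pos (P.θ_pos F.1) (hh F.1))).le (sqL2_nonneg _ _)

lemma jumpXEnergy_nonneg : 0 ≤ D.jumpXEnergy P w := Finset.sum_nonneg fun F _ =>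
  add_nonneg (mul_nonneg (div_pos P.δ₁_pos (hh F.1)).le (sqL2_nonneg _ _))
    (mul_nonneg (mul_pos (mul_pos P.δ₂_pos (P.θ_pos F.1)) (hh F.1)).le (sqL2_nonneg _ _))

lemma patchStarEnergy_nonneg : 0 ≤ D.patchStarEnergy P w := Finset.sum_nonneg fun i _ =>
  add_nonneg (mul_nonneg (inv_pos.2 (mul_pos (P.θ_pos i) (hh i))).le (sqL2_nonneg _ _))
    (mul_nonneg (sq_nonneg _) (sqL2_nonneg _ _))

lemma upGradEnergy_nonneg : 0 ≤ D.upGradEnergy P w := Finset.sum_nonneg fun F _ =>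
  mul_nonneg (mul_pos (P.θ_pos F.1) (hh F.1)).le (sqL2_nonneg _ _)

lemma boundaryGradEnergy_nonneg : 0 ≤ D.boundaryGradEnergy w := Finset.sum_nonneg fun i _ =>
  mul_nonneg (hh i).le (sqL2_nonneg _ _)

lemma normSq_nonneg : 0 ≤ D.normSq P w := by
  rw [normSq_eq]
  linarith [patchEnergy_nonneg P hh w, topEnergy_nonneg (G := G) w, topGradEnergy_nonneg P hh w,
    jumpTEnergy_nonneg (G := G) w, jumpTGradEnergy_nonneg P hh w, jumpXEnergy_nonneg P hh w]

end nonneg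

section terms

variable {D} (hh : ∀ i, 0 < D.h i) (u v : SpaceTime d → ℝ) {t : ℝ} (ht : 0 < t)

include hh ht

lemma abs_patch_terms_le (hu : ∀ i, MemLp u 2 (volume.restrict (G.patch i))) :
    |∑ i, ∫ x in G.patch i,
      (-(u x * dt (G.patch i) v x)
        + P.θ i * D.h i * (dt (G.patch i) u x * dt (G.patch i) v x)
        + inner ℝ (gradx (G.patch i) u x) (gradx (G.patch i) v x)
        - P.θ i * D.h i * inner ℝ (dtGradx (G.patch i) u x) (gradx (G.patch i) v x))| ≤
      t / 2 * (D.patchStarEnergy P u + D.patchEnergy P u) +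
        1 / (2 * t) * (2 * D.patchEnergy P v) := by
  simp only [patchStarEnergy, patchEnergy]
  rw [← Finset.sum_add_distrib, Finset.mul_sum _ _ (2 : ℝ)]
  refine abs_sum_le_of_abs_le fun i _ => ?_
  have hc : 0 < P.θ i * D.h i := mul_pos (P.θ_pos i) (hh i)
  set c := P.θ i * D.h i
  have mt := memLp_dt (G.patch i)
  have mg := memLp_gradx (G.patch i)
  have mtg := memLp_dtGradx (G.patch i)
  have i1 : Integrable (fun x => -(u x * dt (G.patch i) v x)) (volume.restrict (G.patch i)) :=
    (integrable_mul_of_memLp (hu i) (mt v)).neg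
  have i2 := (integrable_mul_of_memLp (mt u) (mt v)).const_mul c
  have i3 := integrable_inner_of_memLp (mg u) (mg v)
  have i4 := (integrable_inner_of_memLp (mtg u) (mg v)).const_mul c
  have i12 : Integrable (fun x => -(u x * dt (G.patch i) v x)
      + c * (dt (G.patch i) u x * dt (G.patch i) v x)) (volume.restrict (G.patch i)) := i1.add i2
  have i123 : Integrable (fun x => -(u x * dt (G.patch i) v x)
      + c * (dt (G.patch i) u x * dt (G.patch i) v x)
      + inner ℝ (gradx (G.patch i) u x) (gradx (G.patch i) v x))
      (volume.restrict (G.patch i)) := i12.add i3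
  rw [integral_sub i123 i4, integral_add i12 i3, integral_add i1 i2, integral_neg,
    integral_const_mul, integral_const_mul]
  have b1 := abs_le.1 (abs_integral_mul_le (hu i) (mt v) ht (inv_pos.2 hc))
  have b2 := abs_le.1 (abs_mul_le_of_abs_le hc.le (abs_integral_mul_le (mt u) (mt v) ht one_pos))
  have b3 := abs_le.1 (abs_integral_inner_le (mg u) (mg v) ht one_pos)
  have b4 := abs_le.1 (abs_mul_le_of_abs_le hc.le (abs_integral_inner_le (mtg u) (mg v) ht hc))
  rw [inv_inv] at b1
  rw [mul_inv_cancel_left₀ hc.ne'] at b4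
  simp only [inv_one, one_mul] at b2 b3
  rw [abs_le]
  constructor <;> linarith [b1.1, b1.2, b2.1, b2.2, b3.1, b3.2, b4.1, b4.2]

omit hh in
lemma abs_up_terms_le :
    |∑ F ∈ G.facets, ∫ x, G.up (G.tr u) F.1 F.2 x * G.jumpT (G.tr v) F.1 F.2 x
      ∂(surf (G.facet F.1 F.2))| ≤ t / 2 * upEnergy G u + 1 / (2 * t) * jumpTEnergy G v := by
  refine abs_sum_le_of_abs_le fun F _ => ?_
  have mu : MemLp (G.up (G.tr u) F.1 F.2) 2 (surf (G.facet F.1 F.2)) :=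
    G.memLp_up fun i => memLp_trace _ u
  have mv : MemLp (G.jumpT (G.tr v) F.1 F.2) 2 (surf (G.facet F.1 F.2)) :=
    G.memLp_jumpT fun i => memLp_trace _ v
  simpa using abs_integral_mul_le mu mv ht one_pos

omit hh in
lemma abs_top_terms_le :
    |∑ i, ∫ x, G.tr u i x * G.tr v i x ∂(surf (G.topFacet i))| ≤
      t / 2 * topEnergy G u + 1 / (2 * t) * topEnergy G v := by
  refine abs_sum_le_of_abs_le fun i _ => ?_
  have hm : surf (G.topFacet i) ≤ surf (frontier (G.patch i)) :=
    MultiPatch.surf_mono inter_subset_left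
  have m : ∀ w, MemLp (G.tr w i) 2 (surf (G.topFacet i)) :=
    fun w => (memLp_trace _ w).mono_measure hm
  simpa using abs_integral_mul_le (m u) (m v) ht one_pos

lemma abs_topGrad_terms_le :
    |∑ i, P.θ i * D.h i * ∫ x, inner ℝ (G.trGradx u i x) (G.trGradx v i x)
      ∂(surf (G.topFacet i))| ≤
      t / 2 * (2 * D.topGradEnergy P u) + 1 / (2 * t) * (2 * D.topGradEnergy P v) := by
  simp only [topGradEnergy, Finset.mul_sum _ _ (2 : ℝ)]
  refine abs_sum_le_of_abs_le fun i _ => ?_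
  have hm : surf (G.topFacet i) ≤ surf (frontier (G.patch i)) :=
    MultiPatch.surf_mono inter_subset_left
  have m : ∀ w, MemLp (G.trGradx w i) 2 (surf (G.topFacet i)) :=
    fun w => (memLp_traceGradx _ w).mono_measure hm
  refine (abs_mul_le_of_abs_le (mul_pos (P.θ_pos i) (hh i)).le
    (abs_integral_inner_le (m u) (m v) ht one_pos)).trans_eq ?_
  ring

lemma abs_upGrad_terms_le :
    |∑ F ∈ G.facets, P.θ F.1 * D.h F.1 *
      ∫ x, inner ℝ (G.up (G.trGradx u) F.1 F.2 x) (G.jumpT (G.trGradx v) F.1 F.2 x)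
        ∂(surf (G.facet F.1 F.2))| ≤
      t / 2 * D.upGradEnergy P u + 1 / (2 * t) * (2 * D.jumpTGradEnergy P v) := by
  simp only [jumpTGradEnergy, Finset.mul_sum _ _ (2 : ℝ)]
  refine abs_sum_le_of_abs_le fun F _ => ?_
  have mu : MemLp (G.up (G.trGradx u) F.1 F.2) 2 (surf (G.facet F.1 F.2)) :=
    G.memLp_up fun i => memLp_traceGradx _ u
  have mv : MemLp (G.jumpT (G.trGradx v) F.1 F.2) 2 (surf (G.facet F.1 F.2)) :=
    G.memLp_jumpT fun i => memLp_traceGradx _ v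
  refine (abs_mul_le_of_abs_le (mul_pos (P.θ_pos F.1) (hh F.1)).le
    (abs_integral_inner_le mu mv ht one_pos)).trans_eq ?_
  ring

lemma abs_penalty_terms_le :
    |∑ F ∈ G.facets,
      ∫ x, (P.δ₁ / D.h F.1 * inner ℝ (G.jumpX (G.tr u) F.1 F.2 x) (G.jumpX (G.tr v) F.1 F.2 x)
        + P.δ₂ * P.θ F.1 * D.h F.1 *
          inner ℝ (G.jumpX (G.trDt u) F.1 F.2 x) (G.jumpX (G.trDt v) F.1 F.2 x))
        ∂(surf (G.facet F.1 F.2))| ≤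
      t / 2 * D.jumpXEnergy P u + 1 / (2 * t) * D.jumpXEnergy P v := by
  refine abs_sum_le_of_abs_le fun F _ => ?_
  have m : ∀ w, MemLp (G.jumpX (G.tr w) F.1 F.2) 2 (surf (G.facet F.1 F.2)) :=
    fun w => G.memLp_jumpX fun i => memLp_trace _ w
  have m' : ∀ w, MemLp (G.jumpX (G.trDt w) F.1 F.2) 2 (surf (G.facet F.1 F.2)) :=
    fun w => G.memLp_jumpX fun i => memLp_trace _ _
  have hc1 : 0 ≤ P.δ₁ / D.h F.1 := (div_pos P.δ₁_pos (hh F.1)).le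
  have hc2 : 0 ≤ P.δ₂ * P.θ F.1 * D.h F.1 :=
    (mul_pos (mul_pos P.δ₂_pos (P.θ_pos F.1)) (hh F.1)).le
  rw [integral_add ((integrable_inner_of_memLp (m u) (m v)).const_mul _)
    ((integrable_inner_of_memLp (m' u) (m' v)).const_mul _), integral_const_mul,
    integral_const_mul]
  have b1 := abs_mul_le_of_abs_le hc1 (abs_integral_inner_le (m u) (m v) ht one_pos)
  have b2 := abs_mul_le_of_abs_le hc2 (abs_integral_inner_le (m' u) (m' v) ht one_pos)
  simp only [inv_one, one_mul] at b1 b2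
  refine (abs_add_le _ _).trans ((add_le_add b1 b2).trans_eq ?_)
  ring

/-- The consistency terms. The free parameter `R` shifts weight from the averages `{∇_x u}` to the
jumps of `v`. -/
lemma abs_consistency_terms_le {R : ℝ} (hR : 0 < R) :
    |(∑ F ∈ G.facets,
      ∫ x, (-inner ℝ (MultiPatch.avg (G.trGradx u) F.1 F.2 x) (G.jumpX (G.tr v) F.1 F.2 x)
        + inner ℝ (MultiPatch.avg (G.trGradx v) F.1 F.2 x) (G.jumpX (G.tr u) F.1 F.2 x))
        ∂(surf (G.facet F.1 F.2)))
    + (∑ F ∈ G.facets, P.θ F.1 * D.h F.1 *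
      ∫ x, (-inner ℝ (MultiPatch.avg (G.trGradx u) F.1 F.2 x) (G.jumpX (G.trDt v) F.1 F.2 x)
        + inner ℝ (MultiPatch.avg (G.trGradx v) F.1 F.2 x) (G.jumpX (G.trDt u) F.1 F.2 x))
        ∂(surf (G.facet F.1 F.2)))| ≤
      t / 2 * (2 / R * D.avgGradEnergy u + D.jumpXEnergy P u) +
        1 / (2 * t) * (R * (P.δ₁⁻¹ + (⨆ i, P.θ i) * P.δ₂⁻¹) * D.jumpXEnergy P v +
          (P.δ₁⁻¹ + (⨆ i, P.θ i) * P.δ₂⁻¹) * D.avgGradEnergy v) := by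
  set X := P.δ₁⁻¹ + (⨆ i, P.θ i) * P.δ₂⁻¹ with hX
  simp only [avgGradEnergy, jumpXEnergy, Finset.mul_sum _ _ (2 / R), Finset.mul_sum _ _ X,
    Finset.mul_sum _ _ (R * X)]
  rw [← Finset.sum_add_distrib, ← Finset.sum_add_distrib, ← Finset.sum_add_distrib]
  refine abs_sum_le_of_abs_le fun F _ => ?_
  have mj : ∀ w, MemLp (G.jumpX (G.tr w) F.1 F.2) 2 (surf (G.facet F.1 F.2)) :=
    fun w => G.memLp_jumpX fun i => memLp_trace _ w
  have mj' : ∀ w, MemLp (G.jumpX (G.trDt w) F.1 F.2) 2 (surf (G.facet F.1 F.2)) :=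
    fun w => G.memLp_jumpX fun i => memLp_trace _ _
  have ma : ∀ w, MemLp (MultiPatch.avg (G.trGradx w) F.1 F.2) 2 (surf (G.facet F.1 F.2)) :=
    fun w => G.memLp_avg fun i => memLp_traceGradx _ w
  have hδ₁ := P.δ₁_pos
  have hδ₂ := P.δ₂_pos
  have hθ := P.θ_pos F.1
  have hh' := hh F.1
  set h := D.h F.1
  set θ := P.θ F.1 with hθdef
  have hθle : θ ≤ ⨆ i, P.θ i := le_ciSup (Finite.bddAbove_range P.θ) F.1
  simp only [real_inner_comm (G.jumpX (G.tr u) F.1 F.2 _) (MultiPatch.avg (G.trGradx v) F.1 F.2 _),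
    real_inner_comm (G.jumpX (G.trDt u) F.1 F.2 _) (MultiPatch.avg (G.trGradx v) F.1 F.2 _)]
  have n1 : Integrable (fun x => -inner ℝ (MultiPatch.avg (G.trGradx u) F.1 F.2 x)
      (G.jumpX (G.tr v) F.1 F.2 x)) (surf (G.facet F.1 F.2)) :=
    (integrable_inner_of_memLp (ma u) (mj v)).neg
  have n2 : Integrable (fun x => -inner ℝ (MultiPatch.avg (G.trGradx u) F.1 F.2 x)
      (G.jumpX (G.trDt v) F.1 F.2 x)) (surf (G.facet F.1 F.2)) :=
    (integrable_inner_of_memLp (ma u) (mj' v)).neg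
  rw [integral_add n1 (integrable_inner_of_memLp (mj u) (ma v)),
    integral_add n2 (integrable_inner_of_memLp (mj' u) (ma v)), integral_neg, integral_neg]
  exact abs_consistency_le_of_abs_le ht hR hh' hθ hδ₁ hδ₂ hθle (sqL2_nonneg _ _) (sqL2_nonneg _ _)
    (sqL2_nonneg _ _) (abs_integral_inner_le (ma u) (mj v) ht (div_pos hh' hR))
    (abs_integral_inner_le (mj u) (ma v) ht (div_pos hδ₁ hh'))
    (abs_integral_inner_le (ma u) (mj' v) ht (inv_pos.2 (mul_pos hR hθ)))
    (abs_integral_inner_le (mj' u) (ma v) ht hδ₂)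

end terms

/-- Summation over the facets, where `Cq` is needed for the patches that come second in the order of
the two patches at a facet. The factor `N` comes from extending the sum to all pairs of patches. -/
lemma avgGradEnergy_le {Cq : ℝ} (hCq : 1 ≤ Cq) (hq : D.IsQuasiUniform Cq) (hh : ∀ i, 0 < D.h i)
    (w : SpaceTime d → ℝ) : D.avgGradEnergy w ≤ Cq * N * D.boundaryGradEnergy w := by
  set s : Fin N → ℝ := fun i => D.h i * sqL2 (surf (frontier (G.patch i))) (G.trGradx w i) with hs
  have hs0 : ∀ i, 0 ≤ s i := fun i => mul_nonneg (hh i).le (sqL2_nonneg _ _)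
  have hF : ∀ F ∈ G.facets, D.h F.1 * sqL2 (surf (G.facet F.1 F.2))
      (MultiPatch.avg (G.trGradx w) F.1 F.2) ≤ Cq / 2 * (s F.1 + s F.2) := by
    intro F hF
    have hCq0 : 0 < Cq := by linarith
    -- quasi-uniformity says nothing about patches that meet in a set of surface measure zero
    by_cases hne : surf (G.facet F.1 F.2) = 0
    · rw [hne, sqL2, integral_zero_measure, mul_zero]
      have := hs0 F.1
      have := hs0 F.2
      positivity
    have hle := hq.2 F.1 F.2 (G.facets_ne _ _ hF) hne
    have h1 := G.sqL2_avg_le (i := F.1) (j := F.2) (f := G.trGradx w)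
      fun i => memLp_traceGradx _ w
    set a := sqL2 (surf (frontier (G.patch F.1))) (G.trGradx w F.1)
    set b := sqL2 (surf (frontier (G.patch F.2))) (G.trGradx w F.2)
    have ha : 0 ≤ a := sqL2_nonneg _ _
    have hb : 0 ≤ b := sqL2_nonneg _ _
    calc _ ≤ D.h F.1 * (1 / 2 * (a + b)) := by gcongr; exact (hh _).le
      _ = 1 / 2 * (1 * D.h F.1 * a + D.h F.1 * b) := by ring
      _ ≤ 1 / 2 * (Cq * D.h F.1 * a + Cq * D.h F.2 * b) := by
        have := hh F.1
        gcongr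
      _ = _ := by simp only [hs, a, b]; ring
  calc D.avgGradEnergy w ≤ ∑ F ∈ G.facets, Cq / 2 * (s F.1 + s F.2) := Finset.sum_le_sum hF
    _ ≤ ∑ F : Fin N × Fin N, Cq / 2 * (s F.1 + s F.2) :=
        Finset.sum_le_sum_of_subset_of_nonneg (Finset.subset_univ _) fun F _ _ =>
          mul_nonneg (by linarith) (add_nonneg (hs0 _) (hs0 _))
    _ = _ := by
        rw [← Finset.mul_sum, Fintype.sum_prod_type]
        simp only [Finset.sum_add_distrib, Finset.sum_const, Finset.card_univ, Fintype.card_fin,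
          nsmul_eq_mul, ← Finset.mul_sum, boundaryGradEnergy, hs]
        ring

/-- The inverse inequality for `∇_x v`, summed over the patches. -/
lemma boundaryGradEnergy_le {C : ℝ} (hC : D.IsInverseConstant C) (hh : ∀ i, 0 < D.h i)
    {v : SpaceTime d → ℝ} (hv : v ∈ D.V0h) (hC0 : 0 ≤ C) :
    D.boundaryGradEnergy v ≤ C * D.patchEnergy P v := by
  rw [boundaryGradEnergy, patchEnergy, Finset.mul_sum]
  refine Finset.sum_le_sum fun i _ => ?_
  have h1 := (hC i v (hv.2 i).1).2
  have h2 := mul_nonneg (mul_pos (P.θ_pos i) (hh i)).le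
    (sqL2_nonneg (volume.restrict (G.patch i)) (dt (G.patch i) v))
  calc _ ≤ D.h i * (C * (D.h i)⁻¹ *
        sqL2 (volume.restrict (G.patch i)) (gradx (G.patch i) v)) := by
        have := (hh i).le; gcongr
    _ = C * sqL2 (volume.restrict (G.patch i)) (gradx (G.patch i) v) := by
        have := (hh i).ne'; field_simp
    _ ≤ _ := by gcongr; linarith

lemma memLp_patch_of_mem_V0hStar {u : SpaceTime d → ℝ} (hu : u ∈ D.V0hStar) (i : Fin N) :
    MemLp u 2 (volume.restrict (G.patch i)) := by
  obtain ⟨w, hw, v, hv, huv⟩ := hu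
  have h : MemLp u 2 (volume.restrict G.Q) := (memLp_congr_ae huv).2 (hw.1.add hv.1)
  exact h.mono_measure (Measure.restrict_mono (G.patch_subset i) le_rfl)

/-- Boundedness of `a_h`, given an inverse constant `C`. The constant `Cinv` in `μ_b` is larger than
`C` by a factor which compensates for the coarse counting of the facets of a patch. -/
theorem abs_ah_le {Cq C : ℝ} (hCq : 1 ≤ Cq) (hq : D.IsQuasiUniform Cq) (hh : ∀ i, 0 < D.h i)
    (hC0 : 0 ≤ C) (hC : D.IsInverseConstant C) {Cinv : ℝ} (hCinv : 2 * (N + 1) * (C + 1) ≤ Cinv)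
    {u v : SpaceTime d → ℝ} (hu : u ∈ D.V0hStar) (hv : v ∈ D.V0h) :
    |D.ah P u v| ≤ muB Cinv Cq P * D.normStar P u * D.norm P v := by
  set X := P.δ₁⁻¹ + (⨆ i, P.θ i) * P.δ₂⁻¹ with hX
  set M := max (Cinv * Cq * X / 4 + 1) (X / 8) with hM
  have hX0 : 0 ≤ X := by
    have h1 := P.δ₁_pos
    have h2 := P.δ₂_pos
    have h3 : 0 ≤ ⨆ i, P.θ i := Real.iSup_nonneg fun i => (P.θ_pos i).le
    positivity
  -- this `R` makes the weight of the averages of `∇_x u` fit into `‖u‖_{h,*}²`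
  set R := Cq * (N + 1) with hR
  have hCq0 : 0 < Cq := by linarith
  have hR0 : 0 < R := by positivity
  have hMR : 2 + R * X * (C + 1) ≤ 2 * M := by
    have h1 : Cinv * Cq * X / 4 + 1 ≤ M := le_max_left _ _
    have h2 : 2 * (N + 1) * (C + 1) * (Cq * X) ≤ Cinv * (Cq * X) := by gcongr
    simp only [hR]
    nlinarith
  have hRX : 0 ≤ R * X := by positivity
  have hRXC : 0 ≤ R * X * C := by positivity
  -- all terms are estimated with the same free weight `t`, which is optimized at the end
  have key : ∀ t > 0, |D.ah P u v| ≤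
      t / 2 * (2 * D.normStarSq P u) + 1 / (2 * t) * (2 * M * D.normSq P v) := by
    intro t ht
    have ht2 : 0 < 1 / (2 * t) := by positivity
    have b1 := abs_le.1 (abs_patch_terms_le P hh u v ht (D.memLp_patch_of_mem_V0hStar hu))
    have b2 := abs_le.1 (abs_up_terms_le (G := G) u v ht)
    have b3 := abs_le.1 (abs_top_terms_le (G := G) u v ht)
    have b4 := abs_le.1 (abs_topGrad_terms_le P hh u v ht)
    have b5 := abs_le.1 (abs_upGrad_terms_le P hh u v ht)
    have b6 := abs_le.1 (abs_consistency_terms_le P hh u v ht hR0)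
    have b7 := abs_le.1 (abs_penalty_terms_le P hh u v ht)
    have avg_le : ∀ w, D.avgGradEnergy w ≤ R * D.boundaryGradEnergy w := fun w =>
      (D.avgGradEnergy_le hCq hq hh w).trans (by
        have := boundaryGradEnergy_nonneg hh w
        rw [hR]; gcongr; linarith)
    have qu : 2 / R * D.avgGradEnergy u ≤ 2 * D.boundaryGradEnergy u := by
      calc _ ≤ 2 / R * (R * D.boundaryGradEnergy u) := by gcongr; exact avg_le u
        _ = _ := by field_simp
    have qv : X * D.avgGradEnergy v ≤ R * X * C * D.patchEnergy P v := by
      calc _ ≤ X * (R * (C * D.patchEnergy P v)) := by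
            gcongr
            exact (avg_le v).trans (by gcongr; exact D.boundaryGradEnergy_le P hC hh hv hC0)
        _ = _ := by ring
    -- the weights of `u`: no part of `‖u‖_{h,*}²` is used more than twice
    have hA : D.patchStarEnergy P u + D.patchEnergy P u + upEnergy G u + topEnergy G u +
        2 * D.topGradEnergy P u + D.upGradEnergy P u +
        (2 / R * D.avgGradEnergy u + D.jumpXEnergy P u) + D.jumpXEnergy P u ≤
        2 * D.normStarSq P u := by
      rw [normStarSq_eq, normSq_eq]
      linarith [patchEnergy_nonneg P hh u, topEnergy_nonneg (G := G) u, topGradEnergy_nonneg P hh u,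
        jumpTEnergy_nonneg (G := G) u, jumpTGradEnergy_nonneg P hh u, jumpXEnergy_nonneg P hh u,
        patchStarEnergy_nonneg P hh u, upEnergy_nonneg (G := G) u, upGradEnergy_nonneg P hh u,
        boundaryGradEnergy_nonneg hh u]
    -- the weights of `v`: only here the inverse inequality and the penalty terms enter
    have hB : 2 * D.patchEnergy P v + jumpTEnergy G v + topEnergy G v + 2 * D.topGradEnergy P v +
        2 * D.jumpTGradEnergy P v + (R * X * D.jumpXEnergy P v + X * D.avgGradEnergy v) +
        D.jumpXEnergy P v ≤ 2 * M * D.normSq P v := by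
      have hM2 : 2 ≤ 2 * M := by nlinarith
      have p1 : (2 + R * X * C) * D.patchEnergy P v ≤ 2 * M * D.patchEnergy P v :=
        mul_le_mul_of_nonneg_right (by linarith) (patchEnergy_nonneg P hh v)
      have p2 : (1 + R * X) * D.jumpXEnergy P v ≤ 2 * M * D.jumpXEnergy P v :=
        mul_le_mul_of_nonneg_right (by linarith) (jumpXEnergy_nonneg P hh v)
      have p3 := mul_le_mul_of_nonneg_right hM2 (topEnergy_nonneg (G := G) v)
      have p4 := mul_le_mul_of_nonneg_right hM2 (topGradEnergy_nonneg P hh v)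
      have p5 := mul_le_mul_of_nonneg_right hM2 (jumpTEnergy_nonneg (G := G) v)
      have p6 := mul_le_mul_of_nonneg_right hM2 (jumpTGradEnergy_nonneg P hh v)
      rw [normSq_eq]
      linarith
    have hA' := mul_le_mul_of_nonneg_left hA (half_pos ht).le
    have hB' := mul_le_mul_of_nonneg_left hB ht2.le
    rw [ah, abs_le]
    constructor <;> linarith [b1.1, b1.2, b2.1, b2.2, b3.1, b3.2, b4.1, b4.2, b5.1, b5.2, b6.1,
      b6.2, b7.1, b7.2]
  have hnu : 0 ≤ D.normStarSq P u := by
    rw [normStarSq_eq]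
    linarith [normSq_nonneg P hh u, patchStarEnergy_nonneg P hh u, upEnergy_nonneg (G := G) u,
      upGradEnergy_nonneg P hh u, boundaryGradEnergy_nonneg hh u]
  have hM0 : 0 ≤ M := by nlinarith
  refine (le_sqrt_mul_sqrt_of_forall (by positivity)
    (mul_nonneg (by positivity) (normSq_nonneg P hh v)) key).trans_eq ?_
  rw [muB, normStar, norm, ← hX, ← hM, Real.sqrt_mul zero_le_two, Real.sqrt_mul (by positivity),
    Real.sqrt_mul zero_le_two]
  linear_combination (√M * √(D.normStarSq P u) * √(D.normSq P v)) * Real.mul_self_sqrt zero_le_two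

end Discretization

end SpaceTimeDG

open SpaceTimeDG

theorem lemma7 {d N : ℕ} (hd : 1 ≤ d) (G : MultiPatch d N) (p : Fin N → Fin (d + 1) → ℕ)
    (hp : ∀ i α, 1 ≤ p i α) (Cq ρ : ℝ) (hCq : 1 ≤ Cq) (hρ : 1 ≤ ρ) :
    ∃ Cinv : ℝ, 0 < Cinv ∧ ∀ D : Discretization G p, D.IsQuasiUniform Cq → D.IsShapeRegular ρ →
      D.IsInverseConstant Cinv ∧
      ∀ P : Params N, ∀ u ∈ D.V0hStar, ∀ v ∈ D.V0h,
        |D.ah P u v| ≤ muB Cinv Cq P * D.normStar P u * D.norm P v := by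
  obtain ⟨C, hC0, hC⟩ := Discretization.exists_isInverseConstant G p (ρ := ρ)
    (zero_le_one.trans hCq)
  refine ⟨2 * (N + 1) * (C + 1), by positivity, fun D hq hs => ?_⟩
  obtain ⟨hh, hinv⟩ := hC D hq hs
  refine ⟨fun i v hv => ?_, fun P u hu v hv => D.abs_ah_le P hCq hq hh hC0 hinv le_rfl hu hv⟩
  have hle : C * (D.h i)⁻¹ ≤ 2 * (N + 1) * (C + 1) * (D.h i)⁻¹ := by
    have := hh i
    have hN : (0 : ℝ) ≤ N := Nat.cast_nonneg N
    gcongr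
    nlinarith
  exact ⟨(hinv i v hv).1.trans (mul_le_mul_of_nonneg_right hle (sqL2_nonneg _ _)),
    (hinv i v hv).2.trans (mul_le_mul_of_nonneg_right hle (sqL2_nonneg _ _))⟩
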